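/- Let $\mathfrak g$ be a simple finite-dimensional complex Lie algebra with a nondegenerate symmetric invariant bilinear form $(\bullet|\bullet)$ (for instance $\frac{1}{2h^\vee}$ times the Killing form), and let $G$ be a connected algebraic group with Lie algebra $\mathfrak g$. Let $\mathfrak h$ be a Cartan subalgebra, let $H_1,H_2\in\mathfrak h$ and let $f_1,f_2\in\mathfrak g$ be nilpotent. For $i=1,2$ put $\mathfrak g^{(i)}_\delta=\{x\in\mathfrak g : [H_i,x]=\delta x\}$ and suppose that $\mathfrak g=\bigoplus_{\delta\in\mathbf Z}\mathfrak g^{(i)}_\delta$ is a good grading for $f_i$: $f_i\in\mathfrak g^{(i)}_{-2}$, and $\operatorname{ad}(f_i):\mathfrak g^{(i)}_\delta\to\mathfrak g^{(i)}_{\delta-2}$ is injective for $\delta\geqslant 1$ and surjective for $\delta\leqslant 1$. Put $\mathfrak g_{\delta_1,\delta_2}=\mathfrak g^{(1)}_{\delta_1}\cap\mathfrak g^{(2)}_{\delta_2}$, $\mathfrak g^{(i)}_{\geqslant k}=\bigoplus_{\delta\geqslant k}\mathfrak g^{(i)}_\delta$ and $f_0=f_2-f_1$, and assume $$\mathfrak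 g^{(1)}_{\geqslant 2}\subseteq\mathfrak g^{(2)}_{\geqslant 1}\subseteq\mathfrak g^{(1)}_{\geqslant 0},\quad \mathfrak g^{(1)}_1\subseteq\bigoplus_{\delta=0}^2\mathfrak g_{1,\delta},\quad \mathfrak g^{(2)}_1\subseteq\bigoplus_{\delta=0}^2\mathfrak g_{\delta,1},\quad f_0\in\mathfrak g_{0,-2}.\qquad(\bigstar)$$ Let $\omega_2(x,y)=(f_2|[x,y])$ on $\mathfrak g^{(2)}_1$. There exists a subspace $\mathfrak a\subseteq\mathfrak g_{0,1}$ with $[f_1,\mathfrak a]=0$ such that $\mathfrak l_2:=\mathfrak a\oplus\mathfrak g_{2,1}$ is a Lagrangian subspace of $\mathfrak g_{0,1}\oplus\mathfrak g_{2,1}$ for $\omega_2$. For every such $\mathfrak a$ put $$\mathfrak n_2=\mathfrak l_2^{\perp,\omega_2}\oplus\mathfrak g^{(2)}_{\geqslant 2},\qquad \mathfrak n_0=\mathfrak a\oplus(\mathfrak g^{(1)}_0\cap\mathfrak g^{(2)}_{\geqslant 2}),\qquad \widetilde{\mathfrak n}_2=\mathfrak g^{(1)}_{\geqslant 1}\oplus\mathfrak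 n_0,$$ where $\mathfrak l_2^{\perp,\omega_2}$ is the orthogonal of $\mathfrak l_2$ in $\mathfrak g^{(2)}_1$. These are Lie algebras of unipotent subgroups $N_2,\widetilde N_2$ of $G$. Let $\chi_2=(f_2|\bullet)$, let $\pi_2:\mathfrak g^*\to\mathfrak n_2^*$ and $\widetilde\pi_2:\mathfrak g^*\to\widetilde{\mathfrak n}_2^*$ be the restriction maps, and let $\mathcal O_2^-=-\mathrm{Ad}^*(N_2)(\chi_2|_{\mathfrak n_2})$ and $\widetilde{\mathcal O}_2^-=-\mathrm{Ad}^*(\widetilde N_2)(\chi_2|_{\widetilde{\mathfrak n}_2})$. For a scheme-theoretic preimage $X=\pi^{-1}(\mathcal O^-)$ of this kind with group $N$, let $X/\!/N=\operatorname{Spec}\mathbf C[X]^N$, with the Poisson bracket on $\mathbf C[X]^N$ obtained by extending invariant functions to $\mathfrak g^*$, taking their Kirillov--Kostant bracket, and restricting it to $X$. Then: 1. There is an inclusion $\pi_2^{-1}(\mathcal O_2^-)\subseteq\widetilde\pi_2^{-1}(\widetilde{\mathcal O}_2^-)$ (of sets of points, and of closed subschemes of $\mathfrak g^*$). 2. This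 inclusion induces a morphism $\pi_2^{-1}(\mathcal O_2^-)/\!/N_2\to\widetilde\pi_2^{-1}(\widetilde{\mathcal O}_2^-)/\!/\widetilde N_2$, which is an isomorphism of Poisson schemes. 3. Let $(e,h,f_2)$ satisfy $[h,e]=2e$, $[h,f_2]=-2f_2$, $[e,f_2]=h$, with $e\in\mathfrak g^{(2)}_2$ and $h\in\mathfrak g^{(2)}_0$, and let $S_{f_2}=-\chi_2+[\mathfrak g,e]^\perp\subseteq\mathfrak g^*$ be the Slodowy slice. Then $S_{f_2}\subseteq\pi_2^{-1}(\mathcal O_2^-)$, and the morphisms $S_{f_2}\to\pi_2^{-1}(\mathcal O_2^-)/\!/N_2$ and $S_{f_2}\to\widetilde\pi_2^{-1}(\widetilde{\mathcal O}_2^-)/\!/\widetilde N_2$ induced by the inclusions are isomorphisms of schemes, which transport the two Poisson brackets to the same bracket on $\mathbf C[S_{f_2}]$. -/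

import Mathlib

namespace SlodowyReduction

open CategoryTheory

noncomputable section

/-! ## The Poisson algebra `ℂ[𝔤*] = Sym(𝔤)` -/

section Poisson

variable {V : Type*} [AddCommGroup V] [Module ℂ V]

/-- The derivation of `Sym(V)` that extends a linear map `d : V → Sym(V)`. -/
def symDer (d : V →ₗ[ℂ] SymmetricAlgebra ℂ V) :
    Derivation ℂ (SymmetricAlgebra ℂ V) (SymmetricAlgebra ℂ V) :=
  let Φ : SymmetricAlgebra ℂ V →ₐ[ℂ]
      TrivSqZeroExt (SymmetricAlgebra ℂ V) (SymmetricAlgebra ℂ V) :=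
    SymmetricAlgebra.lift
      ((TrivSqZeroExt.inlAlgHom ℂ (SymmetricAlgebra ℂ V)
          (SymmetricAlgebra ℂ V)).toLinearMap ∘ₗ SymmetricAlgebra.ι ℂ V +
        (TrivSqZeroExt.inrHom (SymmetricAlgebra ℂ V)
          (SymmetricAlgebra ℂ V)).restrictScalars ℂ ∘ₗ d)
  have hfst : ∀ a, (Φ a).fst = a := by
    intro a
    have : (TrivSqZeroExt.fstHom ℂ (SymmetricAlgebra ℂ V) (SymmetricAlgebra ℂ V)).comp Φ =
        AlgHom.id ℂ _ := by
      apply SymmetricAlgebra.algHom_ext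
      ext v
      simp [Φ]
    exact DFunLike.congr_fun this a
  Derivation.mk'
    ((TrivSqZeroExt.sndHom (SymmetricAlgebra ℂ V)
      (SymmetricAlgebra ℂ V)).restrictScalars ℂ ∘ₗ Φ.toLinearMap)
    (by
      intro a b
      simp [hfst, mul_comm])

@[simp] theorem symDer_ι (d : V →ₗ[ℂ] SymmetricAlgebra ℂ V) (v : V) :
    symDer d (SymmetricAlgebra.ι ℂ V v) = d v := by
  simp [symDer]

theorem symDer_unique {D D' : Derivation ℂ (SymmetricAlgebra ℂ V) (SymmetricAlgebra ℂ V)}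
    (h : ∀ v, D (SymmetricAlgebra.ι ℂ V v) = D' (SymmetricAlgebra.ι ℂ V v)) : D = D' := by
  ext a
  induction a using SymmetricAlgebra.induction with
  | algebraMap r => simp
  | ι x => exact h x
  | mul a b ha hb => simp [ha, hb]
  | add a b ha hb => simp [ha, hb]

variable {g : Type*} [LieRing g] [LieAlgebra ℂ g]

/-- The action of `x ∈ 𝔤` on `ℂ[𝔤*] = Sym(𝔤)`: the derivation extending `y ↦ [x, y]`. -/
def adDer : g →ₗ[ℂ] Derivation ℂ (SymmetricAlgebra ℂ g) (SymmetricAlgebra ℂ g) where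
  toFun x := symDer (SymmetricAlgebra.ι ℂ g ∘ₗ (LieAlgebra.ad ℂ g x : g →ₗ[ℂ] g))
  map_add' x y := symDer_unique (by intro v; simp)
  map_smul' c x := symDer_unique (by intro v; simp)

@[simp] theorem adDer_ι (x y : g) :
    adDer x (SymmetricAlgebra.ι ℂ g y) = SymmetricAlgebra.ι ℂ g ⁅x, y⁆ := by
  simp [adDer]

/-- The Hamiltonian derivation `{F, •}`, determined by `{F, y} = - y · F` for `y ∈ 𝔤`. -/
def ham (F : SymmetricAlgebra ℂ g) :
    Derivation ℂ (SymmetricAlgebra ℂ g) (SymmetricAlgebra ℂ g) :=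
  symDer
    { toFun := fun y => - adDer y F
      map_add' := by intro x y; simp; abel
      map_smul' := by intro c x; simp }

/-- The Kirillov-Kostant-Poisson bracket on `ℂ[𝔤*] = Sym(𝔤)`: the biderivation with
`{x, y} = [x, y]` for `x, y ∈ 𝔤`. -/
def pb (F G : SymmetricAlgebra ℂ g) : SymmetricAlgebra ℂ g := ham F G

theorem pb_ι_right (F : SymmetricAlgebra ℂ g) (y : g) :
    pb F (SymmetricAlgebra.ι ℂ g y) = - adDer y F := by
  simp [pb, ham]

theorem pb_ι_ι (x y : g) :
    pb (SymmetricAlgebra.ι ℂ g x) (SymmetricAlgebra.ι ℂ g y) =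
      SymmetricAlgebra.ι ℂ g ⁅x, y⁆ := by
  rw [pb_ι_right, adDer_ι, ← lie_skew x y, map_neg]

theorem pb_mul_right (F G H : SymmetricAlgebra ℂ g) :
    pb F (G * H) = G * pb F H + H * pb F G := by
  simp [pb]

theorem pb_add_right (F G H : SymmetricAlgebra ℂ g) : pb F (G + H) = pb F G + pb F H := by
  simp [pb]

theorem pb_mul_left (F G H : SymmetricAlgebra ℂ g) :
    pb (F * G) H = F * pb G H + G * pb F H := by
  have : ham (F * G) = F • ham G + G • ham F := by
    apply symDer_unique
    intro v
    have h1 := pb_ι_right (F * G) v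
    have h2 := pb_ι_right F v
    have h3 := pb_ι_right G v
    simp only [pb] at h1 h2 h3
    simp [h1, h2, h3]
    ring
  simp [pb, this]

theorem pb_add_left (F G H : SymmetricAlgebra ℂ g) : pb (F + G) H = pb F H + pb G H := by
  have : ham (F + G) = ham F + ham G := by
    apply symDer_unique
    intro v
    have h1 := pb_ι_right (F + G) v
    have h2 := pb_ι_right F v
    have h3 := pb_ι_right G v
    simp only [pb] at h1 h2 h3
    simp [h1, h2, h3]
    ring
  simp [pb, this]

theorem pb_algebraMap_left (c : ℂ) (H : SymmetricAlgebra ℂ g) :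
    pb (algebraMap ℂ _ c) H = 0 := by
  have : ham (g := g) (algebraMap ℂ _ c) = 0 := by
    apply symDer_unique
    intro v
    have h1 := pb_ι_right (algebraMap ℂ (SymmetricAlgebra ℂ g) c) v
    simp only [pb] at h1
    simp [h1]
  simp [pb, this]

theorem pb_ι_left (x : g) (F : SymmetricAlgebra ℂ g) :
    pb (SymmetricAlgebra.ι ℂ g x) F = adDer x F := by
  have : ham (SymmetricAlgebra.ι ℂ g x) = adDer x :=
    symDer_unique (fun v => by rw [adDer_ι, ← pb_ι_ι]; rfl)
  rw [pb, this]

theorem pb_antisymm (F G : SymmetricAlgebra ℂ g) : pb F G = - pb G F := by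
  induction G using SymmetricAlgebra.induction with
  | algebraMap r => rw [pb_algebraMap_left]; simp [pb]
  | ι y => rw [pb_ι_right, pb_ι_left]
  | mul a b ha hb => rw [pb_mul_right, pb_mul_left, ha, hb]; ring
  | add a b ha hb => rw [pb_add_right, pb_add_left, ha, hb]; ring

theorem pb_sub_left (F G H : SymmetricAlgebra ℂ g) : pb (F - G) H = pb F H - pb G H := by
  have := pb_add_left (F - G) G H
  rw [sub_add_cancel] at this
  rw [this, add_sub_cancel_right]

theorem pb_sub_right (F G H : SymmetricAlgebra ℂ g) : pb F (G - H) = pb F G - pb F H := by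
  simp [pb]

end Poisson

variable {g : Type*} [LieRing g] [LieAlgebra ℂ g]

/-! ## Unipotent groups, coadjoint orbits and the fibres of the moment map -/

/-- `exp(ad x)`, for `x` with `ad x` nilpotent. -/
def expAd (x : g) : Module.End ℂ g :=
  ∑ k ∈ Finset.range (nilpotencyClass (LieAlgebra.ad ℂ g x)),
    ((k.factorial : ℂ)⁻¹) • (LieAlgebra.ad ℂ g x) ^ k

variable (g) in
/-- A Lie subalgebra of `𝔤` all of whose elements are ad-nilpotent. -/
structure AdNilpotentSubalgebra extends LieSubalgebra ℂ g where
  isNilpotent_ad : ∀ x ∈ toLieSubalgebra, IsNilpotent (LieAlgebra.ad ℂ g x)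

namespace AdNilpotentSubalgebra

/-- The unipotent group `N` with Lie algebra `𝔫`, as a group of automorphisms of `𝔤` through its
adjoint action: it is generated by the `exp(ad x)`, `x ∈ 𝔫`. -/
def unipotentGroup (n : AdNilpotentSubalgebra g) : Subgroup (g ≃ₗ[ℂ] g) :=
  Subgroup.closure {φ | ∃ x ∈ n.toLieSubalgebra, (φ : g →ₗ[ℂ] g) = expAd x}

/-- The coadjoint action `Ad*(φ) ξ = ξ ∘ Ad(φ)⁻¹`. -/
def coAd (φ : g ≃ₗ[ℂ] g) (ξ : Module.Dual ℂ g) : Module.Dual ℂ g :=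
  ξ ∘ₗ (φ.symm : g →ₗ[ℂ] g)

/-- The moment map `π : 𝔤* → 𝔫*`, the restriction of linear forms. -/
def momentMap (n : AdNilpotentSubalgebra g) (ξ : Module.Dual ℂ g) :
    Module.Dual ℂ n.toLieSubalgebra :=
  ξ ∘ₗ n.toLieSubalgebra.toSubmodule.subtype

/-- The opposite `𝒪⁻ = - Ad*(N) (χ|_𝔫)` of the coadjoint orbit of `χ|_𝔫` in `𝔫*`. As the
restriction `𝔤* → 𝔫*` is `N`-equivariant, `Ad*(φ) (χ|_𝔫) = (Ad*(φ) χ)|_𝔫`. -/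
def oppositeOrbit (n : AdNilpotentSubalgebra g) (χ : Module.Dual ℂ g) :
    Set (Module.Dual ℂ n.toLieSubalgebra) :=
  {η | ∃ φ ∈ n.unipotentGroup, η = - n.momentMap (coAd φ χ)}

/-- The `ℂ`-points of `π⁻¹(𝒪⁻)`. -/
def fiber (n : AdNilpotentSubalgebra g) (χ : Module.Dual ℂ g) : Set (Module.Dual ℂ g) :=
  n.momentMap ⁻¹' n.oppositeOrbit χ

end AdNilpotentSubalgebra

/-- The ideal of the functions in `ℂ[V*] = Sym(V)` that vanish on `S ⊆ V*`. -/
def vanishingIdeal {V : Type*} [AddCommGroup V] [Module ℂ V] (S : Set (Module.Dual ℂ V)) :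
    Ideal (SymmetricAlgebra ℂ V) :=
  ⨅ ξ ∈ S, RingHom.ker (SymmetricAlgebra.lift ξ)

/-- The action of an automorphism `φ` on `ℂ[𝔤*]`: `(φ · F)(ξ) = F(Ad*(φ)⁻¹ ξ)`. -/
def symMap (φ : g ≃ₗ[ℂ] g) : SymmetricAlgebra ℂ g →ₐ[ℂ] SymmetricAlgebra ℂ g :=
  SymmetricAlgebra.lift (SymmetricAlgebra.ι ℂ g ∘ₗ (φ : g →ₗ[ℂ] g))

@[simp] theorem symMap_ι (φ : g ≃ₗ[ℂ] g) (x : g) :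
    symMap φ (SymmetricAlgebra.ι ℂ g x) = SymmetricAlgebra.ι ℂ g (φ x) := by
  simp [symMap]

theorem symMap_mul (φ ψ : g ≃ₗ[ℂ] g) (F : SymmetricAlgebra ℂ g) :
    symMap (φ * ψ) F = symMap φ (symMap ψ F) := by
  have : symMap (φ * ψ) = (symMap φ).comp (symMap ψ) := by
    apply SymmetricAlgebra.algHom_ext
    ext x
    simp
  exact DFunLike.congr_fun this F

namespace AdNilpotentSubalgebra

/-- The comorphism `μ^♯ : ℂ[𝔫*] → ℂ[𝔤*]` of the moment map. -/
def comoment (n : AdNilpotentSubalgebra g) :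
    SymmetricAlgebra ℂ n.toLieSubalgebra →ₐ[ℂ] SymmetricAlgebra ℂ g :=
  SymmetricAlgebra.lift (SymmetricAlgebra.ι ℂ g ∘ₗ n.toLieSubalgebra.toSubmodule.subtype)

/-- The ideal of the scheme-theoretic preimage `π⁻¹(𝒪⁻) ⊆ 𝔤*`, generated by the pullbacks of the
functions on `𝔫*` that vanish on `𝒪⁻`. -/
def fiberIdeal (n : AdNilpotentSubalgebra g) (χ : Module.Dual ℂ g) :
    Ideal (SymmetricAlgebra ℂ g) :=
  (vanishingIdeal (n.oppositeOrbit χ)).map n.comoment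

/-- The coordinate ring of the scheme `π⁻¹(𝒪⁻)`. -/
abbrev FiberRing (n : AdNilpotentSubalgebra g) (χ : Module.Dual ℂ g) : Type _ :=
  SymmetricAlgebra ℂ g ⧸ n.fiberIdeal χ

/-- The functions `F` on `𝔤*` whose restriction to `π⁻¹(𝒪⁻)` is `N`-invariant: `φ · F` and `F` have
the same restriction for all `φ ∈ N`. -/
def invariantLifts (n : AdNilpotentSubalgebra g) (χ : Module.Dual ℂ g) :
    Subalgebra ℂ (SymmetricAlgebra ℂ g) where
  carrier := {F | ∀ φ ∈ n.unipotentGroup, symMap φ F - F ∈ n.fiberIdeal χ}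
  mul_mem' := by
    intro a b ha hb φ hφ
    have : symMap φ (a * b) - a * b =
        (symMap φ a - a) * symMap φ b + a * (symMap φ b - b) := by rw [map_mul]; ring
    rw [this]
    exact Ideal.add_mem _ (Ideal.mul_mem_right _ _ (ha φ hφ)) (Ideal.mul_mem_left _ _ (hb φ hφ))
  add_mem' := by
    intro a b ha hb φ hφ
    have : symMap φ (a + b) - (a + b) = (symMap φ a - a) + (symMap φ b - b) := by
      rw [map_add]; ring
    rw [this]
    exact Ideal.add_mem _ (ha φ hφ) (hb φ hφ)
  algebraMap_mem' := by
    intro r φ hφ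
    simp

/-- The algebra `ℂ[π⁻¹(𝒪⁻)]^N` of the `N`-invariant functions on `π⁻¹(𝒪⁻)`. -/
def invariants (n : AdNilpotentSubalgebra g) (χ : Module.Dual ℂ g) :
    Subalgebra ℂ (n.FiberRing χ) :=
  (n.invariantLifts χ).map (Ideal.Quotient.mkₐ ℂ (n.fiberIdeal χ))

/-- The affine GIT quotient `π⁻¹(𝒪⁻) // N = Spec ℂ[π⁻¹(𝒪⁻)]^N`. -/
def gitQuotient (n : AdNilpotentSubalgebra g) (χ : Module.Dual ℂ g) : AlgebraicGeometry.Scheme :=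
  AlgebraicGeometry.Spec (CommRingCat.of (n.invariants χ))

end AdNilpotentSubalgebra

/-! ## The Poisson bracket on the Hamiltonian reduction -/

theorem expAd_lie {x : g} (hx : IsNilpotent (LieAlgebra.ad ℂ g x)) :
    ∃ φ : g ≃ₗ[ℂ] g, (φ : g →ₗ[ℂ] g) = expAd x ∧ ∀ y z, φ ⁅y, z⁆ = ⁅φ y, φ z⁆ := by
  let _ : Module ℚ g := Module.compHom g (algebraMap ℚ ℂ)
  let _ : LieAlgebra ℚ g :=
    { lie_smul := fun t x y => lie_smul (algebraMap ℚ ℂ t) x y }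
  let D : LieDerivation ℂ g g := LieDerivation.inner ℂ g g (-x)
  have hD : D.toLinearMap = LieAlgebra.ad ℂ g x := by
    ext y
    simp [D]
  have hn : IsNilpotent D.toLinearMap := by rw [hD]; exact hx
  refine ⟨(LieDerivation.exp D hn).toLinearEquiv, ?_, ?_⟩
  · have h1 : ((LieDerivation.exp D hn).toLinearEquiv : g →ₗ[ℂ] g) =
        IsNilpotent.exp D.toLinearMap := rfl
    rw [h1, hD]
    ext y
    simp only [IsNilpotent.exp, expAd, LinearMap.sum_apply, LinearMap.smul_apply]
    refine Finset.sum_congr rfl fun k _ => ?_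
    change (algebraMap ℚ ℂ ((k.factorial : ℚ)⁻¹)) • ((LieAlgebra.ad ℂ g x ^ k) y) = _
    simp
  · intro y z
    exact (LieDerivation.exp D hn).toLieHom.map_lie y z

namespace AdNilpotentSubalgebra

variable (n : AdNilpotentSubalgebra g) (χ : Module.Dual ℂ g)

theorem map_lie_of_mem {φ : g ≃ₗ[ℂ] g} (hφ : φ ∈ n.unipotentGroup) :
    ∀ y z, φ ⁅y, z⁆ = ⁅φ y, φ z⁆ := by
  induction hφ using Subgroup.closure_induction with
  | mem φ h =>
    obtain ⟨x, hx, hφ⟩ := h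
    obtain ⟨ψ, hψ, h⟩ := expAd_lie (n.isNilpotent_ad x hx)
    have : φ = ψ := LinearEquiv.toLinearMap_injective (hφ.trans hψ.symm)
    exact this ▸ h
  | one => intro y z; rfl
  | mul φ ψ _ _ h1 h2 => intro y z; simp [h1, h2]
  | inv φ _ h =>
    intro y z
    apply φ.injective
    have key : ∀ w, φ (φ⁻¹ w) = w := fun w => φ.apply_symm_apply w
    rw [h, key, key, key]

end AdNilpotentSubalgebra

theorem symMap_pb {φ : g ≃ₗ[ℂ] g} (hφ : ∀ y z, φ ⁅y, z⁆ = ⁅φ y, φ z⁆)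
    (F G : SymmetricAlgebra ℂ g) :
    symMap φ (pb F G) = pb (symMap φ F) (symMap φ G) := by
  induction G using SymmetricAlgebra.induction with
  | algebraMap r => simp [pb]
  | ι y =>
    induction F using SymmetricAlgebra.induction with
    | algebraMap r => simp [pb_algebraMap_left]
    | ι x => simp [pb_ι_ι, hφ]
    | mul a b ha hb => rw [pb_mul_left]; simp only [map_mul, map_add, ha, hb, pb_mul_left]
    | add a b ha hb => rw [pb_add_left]; simp only [map_add, ha, hb, pb_add_left]
  | mul a b ha hb => rw [pb_mul_right]; simp only [map_mul, map_add, ha, hb, pb_mul_right]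
  | add a b ha hb => rw [pb_add_right]; simp only [map_add, ha, hb, pb_add_right]

/-- `F ↦ exp(T ad x) · F`, with a formal parameter `T`. -/
def formalExp (x : g) : SymmetricAlgebra ℂ g →ₐ[ℂ] Polynomial (SymmetricAlgebra ℂ g) :=
  SymmetricAlgebra.lift
    (∑ k ∈ Finset.range (nilpotencyClass (LieAlgebra.ad ℂ g x)),
      ((Polynomial.monomial k).restrictScalars ℂ ∘ₗ SymmetricAlgebra.ι ℂ g) ∘ₗ
        (((k.factorial : ℂ)⁻¹) • (LieAlgebra.ad ℂ g x) ^ k))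

theorem formalExp_ι (x y : g) : formalExp x (SymmetricAlgebra.ι ℂ g y) =
    ∑ k ∈ Finset.range (nilpotencyClass (LieAlgebra.ad ℂ g x)),
      Polynomial.monomial k (SymmetricAlgebra.ι ℂ g
        (((k.factorial : ℂ)⁻¹) • ((LieAlgebra.ad ℂ g x) ^ k) y)) := by
  simp [formalExp, LinearMap.sum_apply]

theorem formalExp_ι_coeff {x : g} (hx : IsNilpotent (LieAlgebra.ad ℂ g x)) (y : g) (k : ℕ) :
    (formalExp x (SymmetricAlgebra.ι ℂ g y)).coeff k =
      SymmetricAlgebra.ι ℂ g (((k.factorial : ℂ)⁻¹) • ((LieAlgebra.ad ℂ g x) ^ k) y) := by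
  rw [formalExp_ι, Polynomial.finsetSum_coeff]
  simp only [Polynomial.coeff_monomial]
  rw [Finset.sum_ite_eq' (Finset.range _) k]
  split_ifs with h
  · rfl
  · rw [pow_eq_zero_of_le (by simpa using h) (pow_nilpotencyClass hx)]
    simp

theorem formalExp_eval {x : g} (hx : IsNilpotent (LieAlgebra.ad ℂ g x)) (t : ℂ)
    {φ : g ≃ₗ[ℂ] g} (hφ : (φ : g →ₗ[ℂ] g) = expAd (t • x)) (F : SymmetricAlgebra ℂ g) :
    (formalExp x F).eval (algebraMap ℂ _ t) = symMap φ F := by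
  have hle : ∀ y, expAd (t • x) y = ∑ k ∈ Finset.range (nilpotencyClass (LieAlgebra.ad ℂ g x)),
      ((k.factorial : ℂ)⁻¹) • (t ^ k) • ((LieAlgebra.ad ℂ g x) ^ k) y := by
    intro y
    have hsub : nilpotencyClass (LieAlgebra.ad ℂ g (t • x)) ≤
        nilpotencyClass (LieAlgebra.ad ℂ g x) := by
      apply csInf_le'
      change (LieAlgebra.ad ℂ g (t • x)) ^ nilpotencyClass (LieAlgebra.ad ℂ g x) = 0
      rw [map_smul, smul_pow, pow_nilpotencyClass hx, smul_zero]
    have hn : IsNilpotent (LieAlgebra.ad ℂ g (t • x)) :=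
      ⟨nilpotencyClass (LieAlgebra.ad ℂ g x), by rw [map_smul, smul_pow, pow_nilpotencyClass hx, smul_zero]⟩
    rw [expAd, LinearMap.sum_apply]
    rw [Finset.sum_subset (Finset.range_mono hsub)]
    · refine Finset.sum_congr rfl fun k _ => ?_
      rw [map_smul, smul_pow]
      simp
    · intro k _ hk
      rw [pow_eq_zero_of_le (by simpa using hk) (pow_nilpotencyClass hn)]
      simp
  let ev : Polynomial (SymmetricAlgebra ℂ g) →ₐ[ℂ] SymmetricAlgebra ℂ g :=
    (Polynomial.aeval (algebraMap ℂ (SymmetricAlgebra ℂ g) t)).restrictScalars ℂ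
  have hev : ∀ p, ev p = p.eval (algebraMap ℂ _ t) := fun p => by simp [ev, Polynomial.aeval_def]
  have : ev.comp (formalExp x) = symMap φ := by
    apply SymmetricAlgebra.algHom_ext
    ext y
    have h1 : φ y = expAd (t • x) y := by rw [← hφ]; rfl
    change ev (formalExp x (SymmetricAlgebra.ι ℂ g y)) = symMap φ (SymmetricAlgebra.ι ℂ g y)
    rw [hev, symMap_ι, h1, hle, formalExp_ι, Polynomial.eval_finsetSum, map_sum]
    refine Finset.sum_congr rfl fun k _ => ?_
    simp [Algebra.smul_def]
    ring
  rw [← hev]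
  exact DFunLike.congr_fun this F

theorem formalExp_coeff_zero {x : g} (hx : IsNilpotent (LieAlgebra.ad ℂ g x))
    (F : SymmetricAlgebra ℂ g) : (formalExp x F).coeff 0 = F := by
  induction F using SymmetricAlgebra.induction with
  | algebraMap r => simp [Polynomial.algebraMap_apply]
  | ι y => simp [formalExp_ι_coeff hx]
  | mul a b ha hb => rw [map_mul, Polynomial.mul_coeff_zero, ha, hb]
  | add a b ha hb => simp [ha, hb]

theorem formalExp_coeff_one {x : g} (hx : IsNilpotent (LieAlgebra.ad ℂ g x))
    (F : SymmetricAlgebra ℂ g) : (formalExp x F).coeff 1 = adDer x F := by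
  induction F using SymmetricAlgebra.induction with
  | algebraMap r => simp [Polynomial.algebraMap_apply]
  | ι y => simp [formalExp_ι_coeff hx]
  | mul a b ha hb =>
    rw [map_mul, Polynomial.mul_coeff_one, formalExp_coeff_zero hx, formalExp_coeff_zero hx, ha, hb]
    simp
    ring
  | add a b ha hb => simp [ha, hb]

theorem coeff_mem_of_eval_mem {A : Type*} [CommRing A] [Algebra ℂ A] (I : Ideal A)
    (p : Polynomial A) (hp : ∀ t : ℂ, p.eval (algebraMap ℂ A t) ∈ I) (k : ℕ) : p.coeff k ∈ I := by
  rw [← Ideal.Quotient.eq_zero_iff_mem, ← Module.forall_dual_apply_eq_zero_iff ℂ]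
  intro f
  let q : Polynomial ℂ := ∑ i ∈ p.support, Polynomial.monomial i (f (Ideal.Quotient.mk I (p.coeff i)))
  have hq : q = 0 := by
    apply Polynomial.funext
    intro t
    have h1 : f (Ideal.Quotient.mk I (p.eval (algebraMap ℂ A t))) = 0 := by
      rw [Ideal.Quotient.eq_zero_iff_mem.mpr (hp t), map_zero]
    rw [Polynomial.eval_eq_sum, Polynomial.sum, map_sum, map_sum] at h1
    simp only [q, Polynomial.eval_finsetSum, Polynomial.eval_monomial, Polynomial.eval_zero]
    rw [← h1]
    refine Finset.sum_congr rfl fun i _ => ?_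
    have h2 : Ideal.Quotient.mk I (p.coeff i * algebraMap ℂ A t ^ i) =
        t ^ i • Ideal.Quotient.mk I (p.coeff i) := by
      rw [← map_pow, mul_comm, ← Algebra.smul_def]
      exact (Ideal.Quotient.mkₐ ℂ I).toLinearMap.map_smul (t ^ i) (p.coeff i)
    rw [h2, map_smul, smul_eq_mul, mul_comm]
  have h3 : q.coeff k = f (Ideal.Quotient.mk I (p.coeff k)) := by
    simp only [q, Polynomial.finsetSum_coeff, Polynomial.coeff_monomial]
    rw [Finset.sum_ite_eq' p.support k]
    split_ifs with h
    · rfl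
    · rw [Polynomial.notMem_support_iff.mp h]; simp
  rw [← h3, hq, Polynomial.coeff_zero]

namespace AdNilpotentSubalgebra

variable (n : AdNilpotentSubalgebra g) (χ : Module.Dual ℂ g)

theorem adDer_mem {x : g} (hx : x ∈ n.toLieSubalgebra) {F : SymmetricAlgebra ℂ g}
    (hF : F ∈ n.invariantLifts χ) : adDer x F ∈ n.fiberIdeal χ := by
  have hn := n.isNilpotent_ad x hx
  have key := coeff_mem_of_eval_mem (n.fiberIdeal χ) (formalExp x F - Polynomial.C F) (by
    intro t
    have htx : t • x ∈ n.toLieSubalgebra := n.toLieSubalgebra.smul_mem t hx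
    obtain ⟨φ, hφ, -⟩ := expAd_lie (n.isNilpotent_ad _ htx)
    rw [Polynomial.eval_sub, Polynomial.eval_C, formalExp_eval hn t hφ]
    exact hF φ (Subgroup.subset_closure ⟨_, htx, hφ⟩)) 1
  simpa [formalExp_coeff_one hn, Polynomial.coeff_C] using key

theorem pb_mem_left {A F : SymmetricAlgebra ℂ g} (hA : A ∈ n.fiberIdeal χ)
    (hF : F ∈ n.invariantLifts χ) : pb A F ∈ n.fiberIdeal χ := by
  refine Submodule.span_induction ?_ ?_ ?_ ?_ hA
  · rintro _ ⟨p, -, rfl⟩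
    change pb (n.comoment p) F ∈ _
    induction p using SymmetricAlgebra.induction with
    | algebraMap r => simp [pb_algebraMap_left]
    | ι x =>
      have : n.comoment (SymmetricAlgebra.ι ℂ _ x) = SymmetricAlgebra.ι ℂ g (x : g) := by
        simp [comoment]
        rfl
      rw [this, pb_ι_left]
      exact n.adDer_mem χ x.2 hF
    | mul a b ha hb =>
      rw [map_mul, pb_mul_left]
      exact Ideal.add_mem _ (Ideal.mul_mem_left _ _ hb) (Ideal.mul_mem_left _ _ ha)
    | add a b ha hb => rw [map_add, pb_add_left]; exact Ideal.add_mem _ ha hb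
  · have := pb_algebraMap_left 0 F
    rw [map_zero] at this
    simp [this]
  · intro a b _ _ ha hb
    rw [pb_add_left]; exact Ideal.add_mem _ ha hb
  · intro a b hb' hb
    rw [smul_eq_mul, pb_mul_left]
    exact Ideal.add_mem _ (Ideal.mul_mem_left _ _ hb) (Ideal.mul_mem_right _ _ hb')

theorem pb_mem_right {A F : SymmetricAlgebra ℂ g} (hA : A ∈ n.fiberIdeal χ)
    (hF : F ∈ n.invariantLifts χ) : pb F A ∈ n.fiberIdeal χ := by
  rw [pb_antisymm]
  exact neg_mem (n.pb_mem_left χ hA hF)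

theorem symMap_mem {F : SymmetricAlgebra ℂ g} (hF : F ∈ n.invariantLifts χ)
    {φ : g ≃ₗ[ℂ] g} (hφ : φ ∈ n.unipotentGroup) : symMap φ F ∈ n.invariantLifts χ := by
  intro ψ hψ
  have h := sub_mem (hF (ψ * φ) (mul_mem hψ hφ)) (hF φ hφ)
  rwa [symMap_mul, sub_sub_sub_cancel_right] at h

theorem pb_mem {F G : SymmetricAlgebra ℂ g} (hF : F ∈ n.invariantLifts χ)
    (hG : G ∈ n.invariantLifts χ) : pb F G ∈ n.invariantLifts χ := by
  intro φ hφ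
  have : symMap φ (pb F G) - pb F G =
      pb (symMap φ F - F) (symMap φ G) + pb F (symMap φ G - G) := by
    rw [symMap_pb (n.map_lie_of_mem hφ), pb_sub_left, pb_sub_right]; ring
  rw [this]
  exact add_mem (n.pb_mem_left χ (hF φ hφ) (n.symMap_mem χ hG hφ))
    (n.pb_mem_right χ (hG φ hφ) hF)

/-- The Poisson bracket of `ℂ[π⁻¹(𝒪⁻)]^N`: extend two invariant functions to `𝔤*`, take the
bracket of the extensions and restrict it to `π⁻¹(𝒪⁻)`. By `reducedBracket_mk` the result does not
depend on the extensions. -/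
def reducedBracket (a b : n.invariants χ) : n.invariants χ :=
  ⟨Ideal.Quotient.mkₐ ℂ (n.fiberIdeal χ) (pb a.2.choose b.2.choose),
    _, n.pb_mem χ a.2.choose_spec.1 b.2.choose_spec.1, rfl⟩

theorem reducedBracket_mk {F G : SymmetricAlgebra ℂ g} (hF : F ∈ n.invariantLifts χ)
    (a b : n.invariants χ)
    (ha : (a : n.FiberRing χ) = Ideal.Quotient.mk _ F)
    (hb : (b : n.FiberRing χ) = Ideal.Quotient.mk _ G) :
    (n.reducedBracket χ a b : n.FiberRing χ) = Ideal.Quotient.mk _ (pb F G) := by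
  have ha' := a.2.choose_spec
  have hb' := b.2.choose_spec
  change Ideal.Quotient.mk _ (pb a.2.choose b.2.choose) = _
  rw [Ideal.Quotient.mk_eq_mk_iff_sub_mem]
  have h1 : a.2.choose - F ∈ n.fiberIdeal χ :=
    Ideal.Quotient.mk_eq_mk_iff_sub_mem _ _ |>.mp (ha'.2.trans ha)
  have h2 : b.2.choose - G ∈ n.fiberIdeal χ :=
    Ideal.Quotient.mk_eq_mk_iff_sub_mem _ _ |>.mp (hb'.2.trans hb)
  have : pb a.2.choose b.2.choose - pb F G =
      pb (a.2.choose - F) b.2.choose + pb F (b.2.choose - G) := by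
    rw [pb_sub_left, pb_sub_right]; ring
  rw [this]
  exact add_mem (n.pb_mem_left χ h1 hb'.1) (n.pb_mem_right χ h2 hF)

/-- The restriction of `N`-invariant functions on `π⁻¹(𝒪⁻)` to the closed subscheme of `𝔤*`
with ideal `J`, if it lies in `π⁻¹(𝒪⁻)`. -/
def restrictInvariants (J : Ideal (SymmetricAlgebra ℂ g)) (hJ : n.fiberIdeal χ ≤ J) :
    n.invariants χ →ₐ[ℂ] SymmetricAlgebra ℂ g ⧸ J :=
  (Ideal.Quotient.factorₐ ℂ hJ).comp (n.invariants χ).val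

end AdNilpotentSubalgebra

/-- The morphism `π⁻¹(𝒪⁻) // N → π'⁻¹(𝒪'⁻) // N'` with comorphism `φ`. -/
def quotientMap (n n' : AdNilpotentSubalgebra g) (χ : Module.Dual ℂ g)
    (φ : n'.invariants χ →ₐ[ℂ] n.invariants χ) : n.gitQuotient χ ⟶ n'.gitQuotient χ :=
  AlgebraicGeometry.Spec.map (CommRingCat.ofHom φ.toRingHom)

/-! ## Good gradings -/

/-- `𝔤_δ = {x | [H, x] = δ x}`. -/
def gr (H : g) (δ : ℤ) : Submodule ℂ g :=
  Module.End.eigenspace (LieAlgebra.ad ℂ g H : Module.End ℂ g) (δ : ℂ)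

/-- `𝔤_{≥ k} = ⨁_{δ ≥ k} 𝔤_δ`. -/
def grGE (H : g) (k : ℤ) : Submodule ℂ g := ⨆ (δ : ℤ) (_ : k ≤ δ), gr H δ

/-- `𝔤_{i, j} = 𝔤^{(1)}_i ∩ 𝔤^{(2)}_j`. -/
def bigr (H₁ H₂ : g) (i j : ℤ) : Submodule ℂ g := gr H₁ i ⊓ gr H₂ j

/-- The eigenspace decomposition of `ad H` is a good `ℤ`-grading for `f` (so that `f` is
nilpotent). -/
structure IsGoodGrading (H f : g) : Prop where
  iSup_gr : ⨆ δ : ℤ, gr H δ = ⊤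
  mem : f ∈ gr H (-2)
  injective : ∀ δ : ℤ, 1 ≤ δ → ∀ x ∈ gr H δ, ⁅f, x⁆ = 0 → x = 0
  surjective : ∀ δ : ℤ, δ ≤ 1 → ∀ y ∈ gr H (δ - 2), ∃ x ∈ gr H δ, ⁅f, x⁆ = y

/-- The compatibility conditions on the two gradings and the two nilpotent elements. -/
structure StarConditions (H₁ H₂ f₁ f₂ : g) : Prop where
  ge_two_le : grGE H₁ 2 ≤ grGE H₂ 1
  ge_one_le : grGE H₂ 1 ≤ grGE H₁ 0
  gr_one_le : gr H₁ 1 ≤ ⨆ δ ∈ Finset.Icc (0 : ℤ) 2, bigr H₁ H₂ 1 δ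
  gr_one_le' : gr H₂ 1 ≤ ⨆ δ ∈ Finset.Icc (0 : ℤ) 2, bigr H₁ H₂ δ 1
  sub_mem : f₂ - f₁ ∈ bigr H₁ H₂ 0 (-2)

/-- `𝔞 ⊆ 𝔤_{0,1} ∩ 𝔤^{f₁}` is a subspace such that `𝔞 ⊕ 𝔤_{2,1}` is Lagrangian in
`𝔤_{0,1} ⊕ 𝔤_{2,1}` for the form `ω₂(x, y) = (f₂ | [x, y])`, i.e. equal to its own orthogonal. -/
structure IsLagrangianChoice (B : LinearMap.BilinForm ℂ g) (H₁ H₂ f₁ f₂ : g)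
    (a : Submodule ℂ g) : Prop where
  le_bigr : a ≤ bigr H₁ H₂ 0 1
  lie_eq_zero : ∀ x ∈ a, ⁅f₁, x⁆ = 0
  lagrangian : ∀ x ∈ bigr H₁ H₂ 0 1 ⊔ bigr H₁ H₂ 2 1,
    x ∈ a ⊔ bigr H₁ H₂ 2 1 ↔ ∀ y ∈ a ⊔ bigr H₁ H₂ 2 1, B f₂ ⁅x, y⁆ = 0

theorem mem_gr {H x : g} {δ : ℤ} : x ∈ gr H δ ↔ ⁅H, x⁆ = (δ : ℂ) • x := by
  rw [gr, Module.End.mem_eigenspace_iff]; rfl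

theorem gr_le_grGE (H : g) {k δ : ℤ} (h : k ≤ δ) : gr H δ ≤ grGE H k :=
  le_iSup₂_of_le δ h le_rfl

theorem grGE_anti (H : g) {k l : ℤ} (h : k ≤ l) : grGE H l ≤ grGE H k :=
  iSup₂_le fun _ hδ => gr_le_grGE H (h.trans hδ)

theorem lie_mem_gr {H x y : g} {i j : ℤ} (hx : x ∈ gr H i) (hy : y ∈ gr H j) :
    ⁅x, y⁆ ∈ gr H (i + j) := by
  rw [mem_gr] at *
  rw [leibniz_lie, hx, hy]
  simp [add_smul]

theorem lie_mem_grGE {H x y : g} {i j : ℤ} (hx : x ∈ grGE H i) (hy : y ∈ grGE H j) :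
    ⁅x, y⁆ ∈ grGE H (i + j) := by
  have h1 : grGE H i ≤ (grGE H (i + j)).comap (LieAlgebra.ad ℂ g y : g →ₗ[ℂ] g) := by
    refine iSup₂_le fun δ hδ u hu => ?_
    have h2 : grGE H j ≤ (grGE H (i + j)).comap (LieAlgebra.ad ℂ g u : g →ₗ[ℂ] g) :=
      iSup₂_le fun ε hε v hv => gr_le_grGE H (add_le_add hδ hε) (lie_mem_gr hu hv)
    have h3 : ⁅u, y⁆ ∈ grGE H (i + j) := h2 hy
    have h5 : ⁅y, u⁆ = -⁅u, y⁆ := (lie_skew y u).symm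
    change ⁅y, u⁆ ∈ grGE H (i + j)
    rw [h5]
    exact neg_mem h3
  have h4 : ⁅y, x⁆ ∈ grGE H (i + j) := h1 hx
  rw [← lie_skew]
  exact neg_mem h4

theorem lie_mem_grGE_two {H x y : g} (hx : x ∈ grGE H 1) (hy : y ∈ grGE H 1) :
    ⁅x, y⁆ ∈ grGE H 2 := by
  have h := lie_mem_grGE hx hy
  rwa [show (1 : ℤ) + 1 = 2 by norm_num] at h

theorem isNilpotent_ad_add [FiniteDimensional ℂ g] {H u v : g} (hH : ⨆ δ : ℤ, gr H δ = ⊤)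
    (hu : u ∈ grGE H 1) (hv : v ∈ gr H 0) (hn : IsNilpotent (LieAlgebra.ad ℂ g v)) :
    IsNilpotent (LieAlgebra.ad ℂ g (u + v)) := by
  obtain ⟨m, hm⟩ := hn
  have hv' : v ∈ grGE H 0 := gr_le_grGE H le_rfl hv
  have huv : u + v ∈ grGE H 0 := add_mem (grGE_anti H (by norm_num) hu) hv'
  have key : ∀ (j : ℕ) (k : ℤ), ∀ y ∈ grGE H k, (LieAlgebra.ad ℂ g v ^ j) y ∈ grGE H k ∧
      (LieAlgebra.ad ℂ g (u + v) ^ j) y - (LieAlgebra.ad ℂ g v ^ j) y ∈ grGE H (k + 1) := by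
    intro j k y hy
    induction j with
    | zero => simpa using hy
    | succ j ih =>
      rw [pow_succ', pow_succ', Module.End.mul_apply, Module.End.mul_apply,
        LieAlgebra.ad_apply, LieAlgebra.ad_apply]
      refine ⟨by simpa using lie_mem_grGE hv' ih.1, ?_⟩
      have h1 := lie_mem_grGE huv ih.2
      have h2 := lie_mem_grGE hu ih.1
      rw [zero_add] at h1
      rw [add_comm] at h2
      have h3 := add_mem h1 h2
      rw [lie_sub, add_lie u v ((LieAlgebra.ad ℂ g v ^ j) y)] at h3
      convert h3 using 1
      abel
  have hstep : ∀ (k : ℤ), ∀ y ∈ grGE H k, (LieAlgebra.ad ℂ g (u + v) ^ m) y ∈ grGE H (k + 1) := by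
    intro k y hy
    have := (key m k y hy).2
    rwa [hm, LinearMap.zero_apply, sub_zero] at this
  have hiter : ∀ (r : ℕ) (k : ℤ), ∀ y ∈ grGE H k,
      ((LieAlgebra.ad ℂ g (u + v) ^ m) ^ r) y ∈ grGE H (k + r) := by
    intro r k y hy
    induction r with
    | zero => simpa using hy
    | succ r ih =>
      rw [pow_succ', Module.End.mul_apply]
      have := hstep _ _ ih
      rwa [add_assoc] at this
  have hfin : {δ : ℤ | gr H δ ≠ ⊥}.Finite := by
    have hind : iSupIndep (fun δ : ℤ => gr H δ) :=
      (Module.End.eigenspaces_iSupIndep (LieAlgebra.ad ℂ g H : Module.End ℂ g)).comp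
        (f := fun δ : ℤ => (δ : ℂ)) Int.cast_injective
    exact WellFoundedGT.finite_ne_bot_of_iSupIndep hind
  obtain ⟨K, hK⟩ : ∃ K : ℕ, ∀ δ : ℤ, gr H δ ≠ ⊥ → -(K : ℤ) ≤ δ ∧ δ < K := by
    obtain ⟨b, hb⟩ := hfin.bddAbove
    obtain ⟨c, hc⟩ := hfin.bddBelow
    refine ⟨(|b| + |c| + 1).toNat, fun δ hδ => ?_⟩
    have h1 := hb hδ
    have h2 := hc hδ
    have := le_abs_self b
    have := neg_abs_le c
    have := abs_nonneg b
    have := abs_nonneg c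
    omega
  have htop : grGE H (-(K : ℤ)) = ⊤ := by
    rw [eq_top_iff, ← hH]
    refine iSup_le fun δ => ?_
    by_cases h : gr H δ = ⊥
    · simp [h]
    · exact gr_le_grGE H (hK δ h).1
  have hbot : grGE H (K : ℤ) = ⊥ := by
    rw [eq_bot_iff]
    refine iSup₂_le fun δ hδ => ?_
    by_contra h
    have := (hK δ (fun h' => h (by rw [h']))).2
    omega
  refine ⟨m * (2 * K), ?_⟩
  ext y
  have h := hiter (2 * K) (-(K : ℤ)) y (by rw [htop]; trivial)
  have h' : -(K : ℤ) + ((2 * K : ℕ) : ℤ) = K := by push_cast; ring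
  rw [h', hbot, ← pow_mul] at h
  simpa using h

theorem isNilpotent_ad_of_mem [FiniteDimensional ℂ g] {H u : g} (hH : ⨆ δ : ℤ, gr H δ = ⊤)
    (hu : u ∈ grGE H 1) : IsNilpotent (LieAlgebra.ad ℂ g u) := by
  have := isNilpotent_ad_add hH hu (v := 0) (zero_mem _) (by simp)
  simpa using this

/-! ## The nilpotent Lie algebras -/

/-- `𝔩^{⊥,ω}`, the orthogonal in `𝔤_1` of a subspace `𝔩`, for `ω(x, y) = (f | [x, y])`. -/
def omegaPerp (B : LinearMap.BilinForm ℂ g) (H f : g) (l : Submodule ℂ g) : Submodule ℂ g where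
  carrier := {x | x ∈ gr H 1 ∧ ∀ y ∈ l, B f ⁅x, y⁆ = 0}
  add_mem' := by
    rintro x x' ⟨hx, h⟩ ⟨hx', h'⟩
    exact ⟨add_mem hx hx', fun y hy => by rw [add_lie, map_add, h y hy, h' y hy, add_zero]⟩
  zero_mem' := ⟨zero_mem _, fun y _ => by simp⟩
  smul_mem' := by
    rintro c x ⟨hx, h⟩
    exact ⟨Submodule.smul_mem _ c hx, fun y hy => by rw [smul_lie, map_smul, h y hy, smul_zero]⟩

theorem omegaPerp_sup_le (B : LinearMap.BilinForm ℂ g) (H f : g) (l : Submodule ℂ g) :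
    omegaPerp B H f l ⊔ grGE H 2 ≤ grGE H 1 :=
  sup_le (fun _ hx => gr_le_grGE H le_rfl hx.1) (grGE_anti H (by norm_num))

/-- `𝔫_𝔩 = 𝔩^{⊥,ω} ⊕ 𝔤_{≥ 2}`. -/
def nilAlgebra [FiniteDimensional ℂ g] (B : LinearMap.BilinForm ℂ g) {H f : g}
    (hgood : IsGoodGrading H f) (l : Submodule ℂ g) : AdNilpotentSubalgebra g where
  toLieSubalgebra :=
    { toSubmodule := omegaPerp B H f l ⊔ grGE H 2
      lie_mem' := fun hx hy => Submodule.mem_sup_right (lie_mem_grGE_two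
        (omegaPerp_sup_le B H f l hx) (omegaPerp_sup_le B H f l hy)) }
  isNilpotent_ad := fun _ hx => isNilpotent_ad_of_mem hgood.iSup_gr (omegaPerp_sup_le B H f l hx)

/-- `𝔫₂ = 𝔩₂^{⊥,ω₂} ⊕ 𝔤^{(2)}_{≥ 2}`, where `𝔩₂ = 𝔞 ⊕ 𝔤_{2,1}`. -/
def nTwo [FiniteDimensional ℂ g] (B : LinearMap.BilinForm ℂ g) (H₁ : g) {H₂ f₂ : g}
    (hgood₂ : IsGoodGrading H₂ f₂) (a : Submodule ℂ g) : AdNilpotentSubalgebra g :=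
  nilAlgebra B hgood₂ (a ⊔ bigr H₁ H₂ 2 1)

/-- `𝔫₀ = 𝔞 ⊕ (𝔤^{(1)}_0 ∩ 𝔤^{(2)}_{≥ 2})`. -/
def nZero (H₁ H₂ : g) (a : Submodule ℂ g) : Submodule ℂ g := a ⊔ (gr H₁ 0 ⊓ grGE H₂ 2)

theorem nZero_le {H₁ H₂ : g} {a : Submodule ℂ g} (ha : a ≤ bigr H₁ H₂ 0 1) :
    nZero H₁ H₂ a ≤ gr H₁ 0 ⊓ grGE H₂ 1 :=
  sup_le (ha.trans (inf_le_inf le_rfl (gr_le_grGE H₂ le_rfl)))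
    (inf_le_inf le_rfl (grGE_anti H₂ (by norm_num)))

theorem lie_mem_nTwoTilde {H₁ H₂ : g} {a : Submodule ℂ g} (ha : a ≤ bigr H₁ H₂ 0 1) {x y : g}
    (hx : x ∈ grGE H₁ 1 ⊔ nZero H₁ H₂ a) (hy : y ∈ grGE H₁ 1 ⊔ nZero H₁ H₂ a) :
    ⁅x, y⁆ ∈ grGE H₁ 1 ⊔ nZero H₁ H₂ a := by
  obtain ⟨u, hu, v, hv, rfl⟩ := Submodule.mem_sup.mp hx
  obtain ⟨u', hu', v', hv', rfl⟩ := Submodule.mem_sup.mp hy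
  have h0 := nZero_le ha hv
  have h0' := nZero_le ha hv'
  have e0 : v ∈ grGE H₁ 0 := gr_le_grGE H₁ le_rfl h0.1
  have e0' : v' ∈ grGE H₁ 0 := gr_le_grGE H₁ le_rfl h0'.1
  have h1 : ⁅u, u'⁆ ∈ grGE H₁ 1 := grGE_anti H₁ (by norm_num) (lie_mem_grGE_two hu hu')
  have h2 : ⁅u, v'⁆ ∈ grGE H₁ 1 := by simpa using lie_mem_grGE hu e0'
  have h3 : ⁅v, u'⁆ ∈ grGE H₁ 1 := by simpa using lie_mem_grGE e0 hu'
  have h4 : ⁅v, v'⁆ ∈ nZero H₁ H₂ a :=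
    Submodule.mem_sup_right ⟨by simpa using lie_mem_gr h0.1 h0'.1, lie_mem_grGE_two h0.2 h0'.2⟩
  have : ⁅u + v, u' + v'⁆ = (⁅u, u'⁆ + ⁅u, v'⁆ + ⁅v, u'⁆) + ⁅v, v'⁆ := by
    simp only [add_lie, lie_add]; abel
  rw [this]
  exact add_mem (Submodule.mem_sup_left (add_mem (add_mem h1 h2) h3))
    (Submodule.mem_sup_right h4)

theorem isNilpotent_ad_of_mem_nTwoTilde [FiniteDimensional ℂ g] {H₁ H₂ : g}
    (h₁ : ⨆ δ : ℤ, gr H₁ δ = ⊤) (h₂ : ⨆ δ : ℤ, gr H₂ δ = ⊤) {a : Submodule ℂ g}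
    (ha : a ≤ bigr H₁ H₂ 0 1) {x : g} (hx : x ∈ grGE H₁ 1 ⊔ nZero H₁ H₂ a) :
    IsNilpotent (LieAlgebra.ad ℂ g x) := by
  obtain ⟨u, hu, v, hv, rfl⟩ := Submodule.mem_sup.mp hx
  have h0 := nZero_le ha hv
  exact isNilpotent_ad_add h₁ hu h0.1 (isNilpotent_ad_of_mem h₂ h0.2)

/-- `𝔫̃₂ = 𝔤^{(1)}_{≥ 1} ⊕ 𝔫₀`. -/
def nTwoTilde [FiniteDimensional ℂ g] {H₁ H₂ f₁ f₂ : g} (hgood₁ : IsGoodGrading H₁ f₁)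
    (hgood₂ : IsGoodGrading H₂ f₂) (a : Submodule ℂ g) (ha : a ≤ bigr H₁ H₂ 0 1) :
    AdNilpotentSubalgebra g where
  toLieSubalgebra :=
    { toSubmodule := grGE H₁ 1 ⊔ nZero H₁ H₂ a
      lie_mem' := fun hx hy => lie_mem_nTwoTilde ha hx hy }
  isNilpotent_ad := fun _ hx =>
    isNilpotent_ad_of_mem_nTwoTilde hgood₁.iSup_gr hgood₂.iSup_gr ha hx

/-! ## Slodowy slices -/

/-- The Slodowy slice `-χ + [𝔤, e]^⊥ ⊆ 𝔤*`. -/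
def slodowySlice (χ : Module.Dual ℂ g) (e : g) : Set (Module.Dual ℂ g) :=
  {ξ | ∃ η : Module.Dual ℂ g, (∀ y : g, η ⁅y, e⁆ = 0) ∧ ξ = -χ + η}

/-- The coordinate ring of the Slodowy slice. -/
abbrev SliceRing (χ : Module.Dual ℂ g) (e : g) : Type _ :=
  SymmetricAlgebra ℂ g ⧸ vanishingIdeal (slodowySlice χ e)

/-- The composition `S → π⁻¹(𝒪⁻) → π⁻¹(𝒪⁻) // N` of the inclusion of a Slodowy slice and the
quotient morphism. -/
def sliceToQuotient (n : AdNilpotentSubalgebra g) (χ : Module.Dual ℂ g) (e : g)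
    (hS : n.fiberIdeal χ ≤ vanishingIdeal (slodowySlice χ e)) :
    AlgebraicGeometry.Spec (CommRingCat.of (SliceRing χ e)) ⟶ n.gitQuotient χ :=
  AlgebraicGeometry.Spec.map (CommRingCat.ofHom (n.restrictInvariants χ _ hS).toRingHom)

end

end SlodowyReduction

open SlodowyReduction

/-! Everything rests on one elimination principle. A unipotent group acts on a set `X` of linear
forms by `ξ ↦ ξ ∘ exp(ad x)`. Suppose that `ξ(v) + c` grows with unit speed along `x` everywhere on
`X`, and that it is fixed by a subspace `n'` which `ad x` preserves and which together with `x`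
spans `n`. Flowing along `x` for the time `-(ξ(v) + c)` then retracts `X` onto the locus `ξ(v) =
-c`, and `n`-invariant functions on `X` are the same as `n'`-invariant functions on that locus
(`Reduces.step`). Iterating this along a pairing `χ[y, v]` between `n / n'` and a space `V` gives
`Reduces.of_pairing`, which yields both reductions below.

From `𝔫̃₂` to `𝔫₂`: by (★) the two algebras differ only by `𝔤_{1,0}`, which `(f₂ | [•, •])` pairs
perfectly with `𝔤_{1,2}`. Imposing `ξ = -χ₂` on `𝔤_{1,2}` cuts the large fibre down to the small one
exactly (`fiber_nTwoTilde_inter`).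

From `𝔫₂` to `0`: in degree `d ≥ 1` of the second grading, `y` is paired with `[e, z]`, `z` of
degree `-d`, through `-([e, [f₂, y]] | z)`. By `sl₂`-theory `ad e ∘ ad f₂` is invertible on that
degree, so the degrees of `𝔫₂` can be eliminated one after the other, and what remains is the
Slodowy slice (`reduces_slodowySlice`).

The small fibre is the affine space `-χ₂ + 𝔪₂^⊥` with `𝔪₂ = 𝔩₂ ⊕ 𝔤^{(2)}_{≥ 2}`: `N₂` does not
change `χ₂` on `𝔪₂`, and conversely a single exponential from `𝔫₂` carries `-χ₂` to any point of it,
even modulo the annihilator of the larger algebra `𝔫̃₂` (`exists_expAd_eq`). This also gives the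
inclusion of the fibres.

The ideals of the scheme-theoretic fibres are vanishing ideals (`fiberIdeal_eq`), so all statements
can be checked on points. The Poisson brackets agree because a lift of an `Ñ₂`-invariant function is
also a lift of an `N₂`-invariant one (`restriction_reducedBracket`). -/

namespace SlodowyReduction

variable {g : Type*} [LieRing g] [LieAlgebra ℂ g]

/-! ## Exponentials of ad-nilpotent elements -/

/-- The elements of `n` are ad-nilpotent. -/
def AdNilpotent (n : Submodule ℂ g) : Prop := ∀ x ∈ n, IsNilpotent (LieAlgebra.ad ℂ g x)

/-- The rational structure comes from restriction of scalars along `ℚ → ℂ`; it gives access to the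
general theory of `IsNilpotent.exp`. -/
theorem expAd_eq_exp (x : g) :
    letI : Module ℚ (Module.End ℂ g) := Module.compHom _ (algebraMap ℚ ℂ)
    expAd x = IsNilpotent.exp (LieAlgebra.ad ℂ g x) := by
  unfold expAd IsNilpotent.exp
  refine Finset.sum_congr rfl fun k _ => ?_
  change _ = (algebraMap ℚ ℂ ((k.factorial : ℚ)⁻¹)) • (LieAlgebra.ad ℂ g x ^ k)
  simp

theorem expAd_eq_sum {x : g} {k : ℕ} (hk : LieAlgebra.ad ℂ g x ^ k = 0) :
    expAd x = ∑ i ∈ Finset.range k, ((i.factorial : ℂ)⁻¹) • (LieAlgebra.ad ℂ g x) ^ i := by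
  let _ : Module ℚ (Module.End ℂ g) := Module.compHom _ (algebraMap ℚ ℂ)
  rw [expAd_eq_exp, IsNilpotent.exp_eq_sum hk]
  refine Finset.sum_congr rfl fun i _ => ?_
  change (algebraMap ℚ ℂ ((i.factorial : ℚ)⁻¹)) • (LieAlgebra.ad ℂ g x ^ i) = _
  simp

theorem isNilpotent_ad_smul {x : g} (hx : IsNilpotent (LieAlgebra.ad ℂ g x)) (s : ℂ) :
    IsNilpotent (LieAlgebra.ad ℂ g (s • x)) := by
  rw [map_smul]
  exact hx.smul s

theorem expAd_smul_comp {x : g} (hx : IsNilpotent (LieAlgebra.ad ℂ g x)) (s t : ℂ) :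
    expAd (s • x) ∘ₗ expAd (t • x) = expAd ((s + t) • x) := by
  let _ : Module ℚ (Module.End ℂ g) := Module.compHom _ (algebraMap ℚ ℂ)
  rw [expAd_eq_exp, expAd_eq_exp, expAd_eq_exp, add_smul, map_add,
    IsNilpotent.exp_add_of_commute _ (isNilpotent_ad_smul hx s) (isNilpotent_ad_smul hx t)]
  · rfl
  · rw [map_smul, map_smul]
    exact ((Commute.refl _).smul_left s).smul_right t

@[simp] theorem expAd_zero : expAd (0 : g) = LinearMap.id := by
  rw [expAd_eq_sum (k := 1) (by simp)]
  simp
  rfl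

theorem expAd_comp_neg {x : g} (hx : IsNilpotent (LieAlgebra.ad ℂ g x)) :
    expAd x ∘ₗ expAd (-x) = LinearMap.id := by
  have := expAd_smul_comp hx 1 (-1)
  simpa using this

/-- `exp(ad x)` intertwines `exp(ad y)` and `exp(ad (exp(ad x) y))`. -/
theorem expAd_comp_expAd {x y : g} (hx : IsNilpotent (LieAlgebra.ad ℂ g x))
    (hy : IsNilpotent (LieAlgebra.ad ℂ g y)) :
    expAd x ∘ₗ expAd y = expAd (expAd x y) ∘ₗ expAd x := by
  obtain ⟨φ, hφ, hlie⟩ := expAd_lie hx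
  have hφ' : ∀ z, expAd x z = φ z := fun z => by rw [← hφ]; rfl
  have key : ∀ (k : ℕ) (z : g), φ (((LieAlgebra.ad ℂ g y) ^ k) z) =
      ((LieAlgebra.ad ℂ g (φ y)) ^ k) (φ z) := by
    intro k z
    induction k with
    | zero => simp
    | succ k ih =>
      rw [pow_succ', pow_succ', Module.End.mul_apply, Module.End.mul_apply, ← ih]
      exact hlie _ _
  obtain ⟨m, hm⟩ := hy
  have hm' : LieAlgebra.ad ℂ g (φ y) ^ m = 0 := by
    ext z
    obtain ⟨w, rfl⟩ := φ.surjective z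
    rw [← key, hm]
    simp
  ext z
  simp only [LinearMap.comp_apply]
  rw [hφ', hφ', hφ', expAd_eq_sum hm, expAd_eq_sum hm']
  simp [LinearMap.sum_apply, map_sum, key]

/-- Modulo a submodule stable under `ad x`, `exp(ad x)` can be truncated. -/
theorem expAd_sub_sum_mem {x : g} (hx : IsNilpotent (LieAlgebra.ad ℂ g x)) {W : Submodule ℂ g}
    (hW : ∀ w ∈ W, ⁅x, w⁆ ∈ W) {y : g} {j : ℕ} (hy : ((LieAlgebra.ad ℂ g x) ^ j) y ∈ W) :
    expAd x y - ∑ i ∈ Finset.range j, ((i.factorial : ℂ)⁻¹) • ((LieAlgebra.ad ℂ g x) ^ i) y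
      ∈ W := by
  obtain ⟨m, hm⟩ := hx
  have hmem : ∀ k, j ≤ k → ((LieAlgebra.ad ℂ g x) ^ k) y ∈ W := by
    intro k hk
    induction k, hk using Nat.le_induction with
    | base => exact hy
    | succ k _ ih =>
      rw [pow_succ', Module.End.mul_apply]
      exact hW _ ih
  have hm' : LieAlgebra.ad ℂ g x ^ (j + m) = 0 := by rw [pow_add, hm, mul_zero]
  rw [expAd_eq_sum hm', LinearMap.sum_apply, Finset.sum_range_add]
  simp only [LinearMap.smul_apply, add_sub_cancel_left]
  exact Submodule.sum_mem _ fun i _ => W.smul_mem _ (hmem _ (Nat.le_add_right _ _))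

theorem expAd_mem {x : g} (hx : IsNilpotent (LieAlgebra.ad ℂ g x)) {W : Submodule ℂ g}
    (hW : ∀ w ∈ W, ⁅x, w⁆ ∈ W) {y : g} (hy : y ∈ W) : expAd x y ∈ W := by
  simpa using expAd_sub_sum_mem hx hW (y := y) (j := 0) (by simpa using hy)

theorem expAd_sub_self_mem {x : g} (hx : IsNilpotent (LieAlgebra.ad ℂ g x)) {W : Submodule ℂ g}
    (hW : ∀ w ∈ W, ⁅x, w⁆ ∈ W) {y : g} (hy : ⁅x, y⁆ ∈ W) : expAd x y - y ∈ W := by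
  simpa using expAd_sub_sum_mem hx hW (y := y) (j := 1) (by simpa using hy)

theorem expAd_sub_sub_mem {x : g} (hx : IsNilpotent (LieAlgebra.ad ℂ g x)) {W : Submodule ℂ g}
    (hW : ∀ w ∈ W, ⁅x, w⁆ ∈ W) {y : g} (hy : ⁅x, ⁅x, y⁆⁆ ∈ W) :
    expAd x y - (y + ⁅x, y⁆) ∈ W := by
  simpa [Finset.sum_range_succ] using
    expAd_sub_sum_mem hx hW (y := y) (j := 2) (by simpa [pow_two] using hy)

/-! ## Evaluation and infinitesimal invariance -/

theorem mem_vanishingIdeal {V : Type*} [AddCommGroup V] [Module ℂ V] {S : Set (Module.Dual ℂ V)}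
    {F : SymmetricAlgebra ℂ V} :
    F ∈ vanishingIdeal S ↔ ∀ ξ ∈ S, SymmetricAlgebra.lift ξ F = 0 := by
  simp [vanishingIdeal, Submodule.mem_iInf]

theorem vanishingIdeal_anti {V : Type*} [AddCommGroup V] [Module ℂ V]
    {S T : Set (Module.Dual ℂ V)} (h : S ⊆ T) : vanishingIdeal T ≤ vanishingIdeal S :=
  fun _ hF => mem_vanishingIdeal.mpr fun ξ hξ => mem_vanishingIdeal.mp hF ξ (h hξ)

theorem lift_symMap (ξ : Module.Dual ℂ g) (φ : g ≃ₗ[ℂ] g) (F : SymmetricAlgebra ℂ g) :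
    SymmetricAlgebra.lift ξ (symMap φ F) =
      SymmetricAlgebra.lift (ξ ∘ₗ (φ : g →ₗ[ℂ] g)) F := by
  have : (SymmetricAlgebra.lift ξ).comp (symMap φ) =
      SymmetricAlgebra.lift (ξ ∘ₗ (φ : g →ₗ[ℂ] g)) := by
    apply SymmetricAlgebra.algHom_ext
    ext x
    simp
  exact DFunLike.congr_fun this F

/-- `exp(t ad x) · F - F` is a polynomial in `t` with values in `I`, so all its coefficients lie in
`I`; the linear one is `adDer x F`. -/
theorem adDer_mem_of_forall_symMap {x : g} (hx : IsNilpotent (LieAlgebra.ad ℂ g x))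
    {I : Ideal (SymmetricAlgebra ℂ g)} {F : SymmetricAlgebra ℂ g}
    (h : ∀ (t : ℂ) (φ : g ≃ₗ[ℂ] g), (φ : g →ₗ[ℂ] g) = expAd (t • x) → symMap φ F - F ∈ I) :
    adDer x F ∈ I := by
  have key := coeff_mem_of_eval_mem I (formalExp x F - Polynomial.C F) (by
    intro t
    obtain ⟨φ, hφ, -⟩ := expAd_lie (isNilpotent_ad_smul hx t)
    rw [Polynomial.eval_sub, Polynomial.eval_C, formalExp_eval hx t hφ]
    exact h t φ hφ) 1
  simpa [formalExp_coeff_one hx, Polynomial.coeff_C] using key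

theorem derivative_formalExp {x : g} (hx : IsNilpotent (LieAlgebra.ad ℂ g x))
    (F : SymmetricAlgebra ℂ g) :
    Polynomial.derivative (formalExp x F) = formalExp x (adDer x F) := by
  induction F using SymmetricAlgebra.induction with
  | algebraMap r => simp [Polynomial.algebraMap_apply]
  | ι y =>
    ext k
    rw [Polynomial.coeff_derivative, adDer_ι, formalExp_ι_coeff hx, formalExp_ι_coeff hx,
      pow_succ (LieAlgebra.ad ℂ g x) k, Module.End.mul_apply, LieAlgebra.ad_apply, map_smul,
      map_smul, smul_mul_assoc, Nat.factorial_succ]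
    have h1 : ((k : SymmetricAlgebra ℂ g) + 1) = algebraMap ℂ _ ((k : ℂ) + 1) := by simp
    rw [h1, mul_comm (SymmetricAlgebra.ι ℂ g _), ← Algebra.smul_def, smul_smul]
    congr 1
    have : (k : ℂ) + 1 ≠ 0 := Nat.cast_add_one_ne_zero k
    push_cast
    field_simp
  | mul a b ha hb =>
    rw [map_mul, Polynomial.derivative_mul, ha, hb]
    simp
    ring
  | add a b ha hb => simp [ha, hb]

theorem factorial_smul_coeff_formalExp {x : g} (hx : IsNilpotent (LieAlgebra.ad ℂ g x))
    (k : ℕ) (F : SymmetricAlgebra ℂ g) :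
    (k.factorial : ℂ) • (formalExp x F).coeff k = (adDer x)^[k] F := by
  induction k generalizing F with
  | zero => simp [formalExp_coeff_zero hx]
  | succ k ih =>
    rw [Function.iterate_succ_apply, ← ih, ← derivative_formalExp hx, Polynomial.coeff_derivative,
      Nat.factorial_succ]
    have h1 : ((k : SymmetricAlgebra ℂ g) + 1) = algebraMap ℂ _ ((k : ℂ) + 1) := by simp
    rw [h1, mul_comm ((formalExp x F).coeff (k + 1)), ← Algebra.smul_def, smul_smul]
    congr 1
    push_cast
    ring

/-- Taylor expansion: the `k`-th coefficient of `exp(T ad x) · F` is the `k`-th iterate of `adDer x`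
divided by `k!`, which lies in `I` for `k ≥ 1`. -/
theorem symMap_sub_mem {x : g} (hx : IsNilpotent (LieAlgebra.ad ℂ g x))
    {I : Ideal (SymmetricAlgebra ℂ g)} (hI : ∀ F ∈ I, adDer x F ∈ I) {F : SymmetricAlgebra ℂ g}
    (hF : adDer x F ∈ I) {φ : g ≃ₗ[ℂ] g} (hφ : (φ : g →ₗ[ℂ] g) = expAd x) :
    symMap φ F - F ∈ I := by
  have hcoeff : ∀ k, (formalExp x F).coeff (k + 1) ∈ I := by
    intro k
    have h1 : (adDer x)^[k + 1] F ∈ I := by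
      induction k with
      | zero => exact hF
      | succ k ih => rw [Function.iterate_succ_apply']; exact hI _ ih
    rw [← factorial_smul_coeff_formalExp hx] at h1
    have h2 := Submodule.smul_of_tower_mem I (((k + 1).factorial : ℂ)⁻¹) h1
    rwa [smul_smul, inv_mul_cancel₀ (Nat.cast_ne_zero.mpr (Nat.factorial_ne_zero _)),
      one_smul] at h2
  rw [← formalExp_eval hx 1 (by rw [one_smul]; exact hφ), map_one, Polynomial.eval_eq_sum_range,
    Finset.sum_range_succ', formalExp_coeff_zero hx]
  simp only [one_pow, mul_one, add_sub_cancel_right]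
  exact Submodule.sum_mem _ fun k _ => hcoeff k

/-- A set of linear forms stable under `exp(ad x)` for all `x ∈ n`. -/
def ExpStable (n : Submodule ℂ g) (X : Set (Module.Dual ℂ g)) : Prop :=
  ∀ x ∈ n, ∀ ξ ∈ X, ξ ∘ₗ expAd x ∈ X

/-- `F` is invariant on `X` under `exp(ad x)` for all `x ∈ n`. -/
def ExpInvariant (n : Submodule ℂ g) (X : Set (Module.Dual ℂ g)) (F : SymmetricAlgebra ℂ g) :
    Prop :=
  ∀ x ∈ n, ∀ ξ ∈ X, SymmetricAlgebra.lift (ξ ∘ₗ expAd x) F = SymmetricAlgebra.lift ξ F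

theorem ExpStable.adDer_mem {n : Submodule ℂ g} (hn : AdNilpotent n)
    {X : Set (Module.Dual ℂ g)} (hX : ExpStable n X) {x : g} (hx : x ∈ n)
    {F : SymmetricAlgebra ℂ g} (hF : F ∈ vanishingIdeal X) :
    adDer x F ∈ vanishingIdeal X := by
  refine adDer_mem_of_forall_symMap (hn x hx) fun t φ hφ => sub_mem ?_ hF
  rw [mem_vanishingIdeal] at hF ⊢
  intro ξ hξ
  rw [lift_symMap, hφ]
  exact hF _ (hX _ (n.smul_mem t hx) ξ hξ)

theorem ExpInvariant.adDer_mem {n : Submodule ℂ g} (hn : AdNilpotent n)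
    {X : Set (Module.Dual ℂ g)} {F : SymmetricAlgebra ℂ g} (hF : ExpInvariant n X F)
    {x : g} (hx : x ∈ n) : adDer x F ∈ vanishingIdeal X := by
  refine adDer_mem_of_forall_symMap (hn x hx) fun t φ hφ => ?_
  rw [mem_vanishingIdeal]
  intro ξ hξ
  rw [map_sub, lift_symMap, hφ, hF _ (n.smul_mem t hx) ξ hξ, sub_self]

/-- Infinitesimal invariance is linear in `x`, unlike invariance under `exp(ad x)`. Hence invariance
under a sum of two subspaces follows from invariance under each of them. -/
theorem ExpStable.expInvariant_of_adDer_mem {n : Submodule ℂ g} (hn : AdNilpotent n)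
    {X : Set (Module.Dual ℂ g)} (hX : ExpStable n X) {F : SymmetricAlgebra ℂ g}
    (hF : ∀ x ∈ n, adDer x F ∈ vanishingIdeal X) : ExpInvariant n X F := by
  intro x hx ξ hξ
  obtain ⟨φ, hφ, -⟩ := expAd_lie (hn x hx)
  have := mem_vanishingIdeal.mp
    (symMap_sub_mem (hn x hx) (fun F hF => hX.adDer_mem hn hx hF) (hF x hx) hφ) ξ hξ
  rw [map_sub, lift_symMap, hφ] at this
  exact sub_eq_zero.mp this

/-- If `ξ [x, v] = c` on `X`, then `ξ(exp(ad x) v) = ξ(v) + c`. -/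
theorem ExpStable.apply_expAd {n : Submodule ℂ g} (hn : AdNilpotent n)
    {X : Set (Module.Dual ℂ g)} (hX : ExpStable n X) {x v : g} (hx : x ∈ n) {c : ℂ}
    (hc : ∀ ξ ∈ X, ξ ⁅x, v⁆ = c) : ∀ ξ ∈ X, ξ (expAd x v) = ξ v + c := by
  -- Modulo the linear functions that vanish on `X`, the exponential series stops after its linear
  -- term: `[x, v]` is a constant there, and the derivative of a constant is zero.
  let W : Submodule ℂ g :=
    { carrier := {w | SymmetricAlgebra.ι ℂ g w ∈ vanishingIdeal X}
      add_mem' := fun ha hb => by simpa using add_mem ha hb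
      zero_mem' := by simp
      smul_mem' := fun c w hw => by simpa using Submodule.smul_of_tower_mem _ c hw }
  have hW : ∀ w ∈ W, ⁅x, w⁆ ∈ W := fun w hw => by
    have := hX.adDer_mem hn hx hw
    rwa [adDer_ι] at this
  have h0 : SymmetricAlgebra.ι ℂ g ⁅x, v⁆ - algebraMap ℂ _ c ∈ vanishingIdeal X := by
    rw [mem_vanishingIdeal]
    intro ξ hξ
    simp [hc ξ hξ]
  have h1 : ⁅x, ⁅x, v⁆⁆ ∈ W := by
    have := hX.adDer_mem hn hx h0
    rw [map_sub, adDer_ι, Derivation.map_algebraMap, sub_zero] at this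
    exact this
  intro ξ hξ
  have h2 := mem_vanishingIdeal.mp (show SymmetricAlgebra.ι ℂ g _ ∈ vanishingIdeal X from
    expAd_sub_sub_mem (hn x hx) hW h1) ξ hξ
  rw [SymmetricAlgebra.lift_ι_apply, map_sub, map_add, hc ξ hξ] at h2
  exact sub_eq_zero.mp h2

/-! ## Reduction of invariants -/

/-- `(n', X')` is a reduction of `(n, X)`: restriction to `X' ⊆ X` is a bijection from the
`n`-invariant functions on `X` to the `n'`-invariant functions on `X'`. -/
structure Reduces (n : Submodule ℂ g) (X : Set (Module.Dual ℂ g)) (n' : Submodule ℂ g)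
    (X' : Set (Module.Dual ℂ g)) : Prop where
  le : n' ≤ n
  subset : X' ⊆ X
  eq_zero : ∀ F, ExpInvariant n X F → (∀ ξ ∈ X', SymmetricAlgebra.lift ξ F = 0) →
    ∀ ξ ∈ X, SymmetricAlgebra.lift ξ F = 0
  extend : ∀ f, ExpInvariant n' X' f → ∃ F, ExpInvariant n X F ∧
    ∀ ξ ∈ X', SymmetricAlgebra.lift ξ F = SymmetricAlgebra.lift ξ f

theorem ExpInvariant.mono {n n' : Submodule ℂ g} {X X' : Set (Module.Dual ℂ g)}
    {F : SymmetricAlgebra ℂ g} (hF : ExpInvariant n X F) (hn : n' ≤ n) (hX : X' ⊆ X) :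
    ExpInvariant n' X' F :=
  fun x hx ξ hξ => hF x (hn hx) ξ (hX hξ)

theorem Reduces.refl (n : Submodule ℂ g) (X : Set (Module.Dual ℂ g)) : Reduces n X n X :=
  ⟨le_rfl, le_rfl, fun _ _ h => h, fun f hf => ⟨f, hf, fun _ _ => rfl⟩⟩

theorem Reduces.trans {n n' n'' : Submodule ℂ g} {X X' X'' : Set (Module.Dual ℂ g)}
    (h : Reduces n X n' X') (h' : Reduces n' X' n'' X'') : Reduces n X n'' X'' where
  le := h'.le.trans h.le
  subset := h'.subset.trans h.subset
  eq_zero F hF h0 := h.eq_zero F hF (h'.eq_zero F (hF.mono h.le h.subset) h0)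
  extend f hf := by
    obtain ⟨F', hF', e'⟩ := h'.extend f hf
    obtain ⟨F, hF, e⟩ := h.extend F' hF'
    exact ⟨F, hF, fun ξ hξ => (e ξ (h'.subset hξ)).trans (e' ξ hξ)⟩

/-- The time of the flow may itself be a function `t` on `𝔤*`. This makes the pullback under a
retraction with variable flow time a polynomial function. -/
theorem lift_eval_formalExp {x : g} (hx : IsNilpotent (LieAlgebra.ad ℂ g x))
    (t F : SymmetricAlgebra ℂ g) (ξ : Module.Dual ℂ g) :
    SymmetricAlgebra.lift ξ ((formalExp x F).eval t) =
      SymmetricAlgebra.lift (ξ ∘ₗ expAd (SymmetricAlgebra.lift ξ t • x)) F := by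
  obtain ⟨φ, hφ, -⟩ := expAd_lie (isNilpotent_ad_smul hx (SymmetricAlgebra.lift ξ t))
  rw [← hφ, ← lift_symMap, ← formalExp_eval hx _ hφ, Polynomial.eval_eq_sum_range,
    Polynomial.eval_eq_sum_range]
  simp

/-- Elimination of one direction `x`, along which the function `ξ ↦ ξ(v) + c` is a coordinate. -/
theorem Reduces.step {n n' : Submodule ℂ g} (hn : AdNilpotent n) (hle : n' ≤ n) {x : g}
    (hx : x ∈ n) (hsup : n ≤ n' ⊔ Submodule.span ℂ {x}) (hideal : ∀ y ∈ n', ⁅x, y⁆ ∈ n')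
    {X : Set (Module.Dual ℂ g)} (hX : ExpStable n X) (v : g) (c : ℂ)
    (h1 : ∀ ξ ∈ X, ξ ⁅x, v⁆ = 1) (h0 : ∀ ξ ∈ X, ∀ y ∈ n', ξ ⁅y, v⁆ = 0) :
    Reduces n X n' {ξ ∈ X | ξ v + c = 0} := by
  have hxs : ∀ (s : ℂ), ∀ ξ ∈ X, ξ (expAd (s • x) v) = ξ v + s := fun s =>
    hX.apply_expAd hn (n.smul_mem s hx) fun ξ hξ => by
      rw [smul_lie, map_smul, h1 ξ hξ, smul_eq_mul, mul_one]
  have hys : ∀ y ∈ n', ∀ ξ ∈ X, ξ (expAd y v) = ξ v := fun y hy ξ hξ => by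
    simpa using hX.apply_expAd hn (hle hy) (fun ξ hξ => h0 ξ hξ y hy) ξ hξ
  have hmem : ∀ ξ ∈ X, ξ ∘ₗ expAd (-(ξ v + c) • x) ∈ {ξ ∈ X | ξ v + c = 0} := by
    intro ξ hξ
    refine ⟨hX _ (n.smul_mem _ hx) ξ hξ, ?_⟩
    rw [LinearMap.comp_apply, hxs _ ξ hξ]
    ring
  refine ⟨hle, fun ξ hξ => hξ.1, ?_, ?_⟩
  · intro F hF h ξ hξ
    rw [← hF _ (n.smul_mem (-(ξ v + c)) hx) ξ hξ]
    exact h _ (hmem ξ hξ)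
  · intro f hf
    -- The time needed to flow from `ξ` to the locus `ξ(v) + c = 0`; the extension of `f` is its
    -- pullback under the resulting retraction.
    let t : SymmetricAlgebra ℂ g := -(SymmetricAlgebra.ι ℂ g v + algebraMap ℂ _ c)
    have hF : ∀ ξ, SymmetricAlgebra.lift ξ ((formalExp x f).eval t) =
        SymmetricAlgebra.lift (ξ ∘ₗ expAd (-(ξ v + c) • x)) f := by
      intro ξ
      rw [lift_eval_formalExp (hn x hx)]
      simp [t]
    have hinvx : ExpInvariant (Submodule.span ℂ {x}) X ((formalExp x f).eval t) := by
      intro z hz ξ hξ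
      obtain ⟨s, rfl⟩ := Submodule.mem_span_singleton.mp hz
      rw [hF, hF, LinearMap.comp_apply, hxs s ξ hξ, LinearMap.comp_assoc,
        expAd_smul_comp (hn x hx)]
      congr 5
      ring
    have hinvn' : ExpInvariant n' X ((formalExp x f).eval t) := by
      intro y hy ξ hξ
      rw [hF, hF, LinearMap.comp_apply, hys y hy ξ hξ]
      set s := ξ v + c with hs
      have hsx := n.smul_mem s hx
      -- The flow time is unchanged by `y ∈ n'`. Moving `exp(ad y)` past the flow replaces `y` by a
      -- conjugate, which stays in `n'`, and `f` is `n'`-invariant on the locus.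
      have hy' : expAd (s • x) y ∈ n' := expAd_mem (hn _ hsx) (fun w hw => by
        rw [smul_lie]; exact n'.smul_mem s (hideal w hw)) hy
      have hcomm : expAd y ∘ₗ expAd (-s • x) = expAd (-s • x) ∘ₗ expAd (expAd (s • x) y) := by
        have h3 := expAd_comp_expAd (hn _ hsx) (hn y (hle hy))
        have h4 : expAd (-s • x) ∘ₗ expAd (s • x) = LinearMap.id := by
          rw [expAd_smul_comp (hn x hx)]; simp
        have h5 : expAd (s • x) ∘ₗ expAd (-s • x) = LinearMap.id := by
          rw [expAd_smul_comp (hn x hx)]; simp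
        calc expAd y ∘ₗ expAd (-s • x)
            = (expAd (-s • x) ∘ₗ expAd (s • x)) ∘ₗ expAd y ∘ₗ expAd (-s • x) := by
              rw [h4, LinearMap.id_comp]
          _ = expAd (-s • x) ∘ₗ (expAd (s • x) ∘ₗ expAd y) ∘ₗ expAd (-s • x) := rfl
          _ = (expAd (-s • x) ∘ₗ expAd (expAd (s • x) y)) ∘ₗ
              (expAd (s • x) ∘ₗ expAd (-s • x)) := by rw [h3]; rfl
          _ = _ := by rw [h5, LinearMap.comp_id]
      rw [LinearMap.comp_assoc, hcomm, ← LinearMap.comp_assoc]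
      exact hf _ hy' _ (hmem ξ hξ)
    refine ⟨(formalExp x f).eval t, hX.expInvariant_of_adDer_mem hn fun z hz => ?_, ?_⟩
    · obtain ⟨y, hy, z', hz', rfl⟩ := Submodule.mem_sup.mp (hsup hz)
      have e1 := hinvn'.adDer_mem (fun a ha => hn a (hle ha)) hy
      have e2 := hinvx.adDer_mem (fun a ha => hn a
        ((Submodule.span_singleton_le_iff_mem x n).mpr hx ha)) hz'
      rw [map_add, Derivation.add_apply]
      exact add_mem e1 e2
    · intro ξ hξ
      rw [hF, hξ.2]
      simp

theorem ExpStable.inter {n n' : Submodule ℂ g} (hn : AdNilpotent n) (hle : n' ≤ n)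
    {X : Set (Module.Dual ℂ g)} (hX : ExpStable n X) {V : Set g} (c : g → ℂ)
    (h0 : ∀ ξ ∈ X, ∀ y ∈ n', ∀ v ∈ V, ξ ⁅y, v⁆ = 0) :
    ExpStable n' {ξ ∈ X | ∀ v ∈ V, ξ v = c v} := by
  intro y hy ξ hξ
  refine ⟨hX y (hle hy) ξ hξ.1, fun v hv => ?_⟩
  rw [LinearMap.comp_apply, hX.apply_expAd hn (hle hy) (fun ξ hξ => h0 ξ hξ y hy v hv) ξ hξ.1,
    add_zero, hξ.2 v hv]

/-- Elimination of all the directions in `n / n'`, which is paired with `V` by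
`(y, v) ↦ χ [y, v]`. -/
theorem Reduces.of_pairing [FiniteDimensional ℂ g] {n n' : Submodule ℂ g} (hn : AdNilpotent n)
    (hle : n' ≤ n) (hlie : ∀ x ∈ n, ∀ y ∈ n, ⁅x, y⁆ ∈ n') {X : Set (Module.Dual ℂ g)}
    (hX : ExpStable n X) (χ : Module.Dual ℂ g) (V : Submodule ℂ g)
    (hχ : ∀ ξ ∈ X, ∀ y ∈ n, ∀ v ∈ V, ξ ⁅y, v⁆ = -χ ⁅y, v⁆)
    (h0 : ∀ y ∈ n', ∀ v ∈ V, χ ⁅y, v⁆ = 0)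
    (hleft : ∀ y ∈ n, (∀ v ∈ V, χ ⁅y, v⁆ = 0) → y ∈ n')
    (hright : ∀ v ∈ V, (∀ y ∈ n, χ ⁅y, v⁆ = 0) → ∀ ξ ∈ X, ξ v = -χ v) :
    Reduces n X n' {ξ ∈ X | ∀ v ∈ V, ξ v = -χ v} := by
  -- The dimension of `n` decreases while `n'` and `V` stay fixed; the constraints already imposed
  -- are absorbed into `X`.
  induction hk : Module.finrank ℂ n using Nat.strong_induction_on generalizing n X with
  | _ k ih =>
  subst hk
  by_cases hn' : n ≤ n'
  · have heq : {ξ ∈ X | ∀ v ∈ V, ξ v = -χ v} = X := by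
      ext ξ
      exact ⟨fun h => h.1, fun h => ⟨h, fun v hv =>
        hright v hv (fun y hy => h0 y (hn' hy) v hv) ξ h⟩⟩
    rw [heq, le_antisymm hle hn']
    exact Reduces.refl _ _
  obtain ⟨x₀, hx₀, hx₀'⟩ := SetLike.not_le_iff_exists.mp hn'
  obtain ⟨v, hv, hxv⟩ : ∃ v ∈ V, χ ⁅x₀, v⁆ ≠ 0 := by
    by_contra! hcon
    exact hx₀' (hleft x₀ hx₀ hcon)
  -- The sign is forced by `ξ = -χ` on brackets: `χ[x, v] = -1` means `ξ[x, v] = 1` on `X`.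
  let x : g := (-(χ ⁅x₀, v⁆)⁻¹) • x₀
  have hx : x ∈ n := n.smul_mem _ hx₀
  have hxv1 : χ ⁅x, v⁆ = -1 := by
    simp only [x, smul_lie, map_smul, smul_eq_mul]
    field_simp
  let q : Submodule ℂ g :=
    { carrier := {y | y ∈ n ∧ χ ⁅y, v⁆ = 0}
      add_mem' := fun ha hb => ⟨add_mem ha.1 hb.1, by rw [add_lie, map_add, ha.2, hb.2, add_zero]⟩
      zero_mem' := ⟨zero_mem _, by simp⟩
      smul_mem' := fun c y hy => ⟨n.smul_mem c hy.1, by rw [smul_lie, map_smul, hy.2, smul_zero]⟩ }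
  have hqn : q ≤ n := fun y hy => hy.1
  have hn'q : n' ≤ q := fun y hy => ⟨hle hy, h0 y hy v hv⟩
  have hqlt : q < n := lt_of_le_of_ne hqn fun h => by
    have : x ∈ q := h ▸ hx
    have := this.2
    rw [hxv1] at this
    norm_num at this
  have hsup : n ≤ q ⊔ Submodule.span ℂ {x} := by
    intro y hy
    have h2 : y = (y + χ ⁅y, v⁆ • x) + (-χ ⁅y, v⁆) • x := by simp
    rw [h2]
    refine add_mem (Submodule.mem_sup_left ⟨add_mem hy (n.smul_mem _ hx), ?_⟩)
      (Submodule.mem_sup_right (Submodule.smul_mem _ _ (Submodule.mem_span_singleton_self x)))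
    rw [add_lie, smul_lie, map_add, map_smul, hxv1]
    simp
  have hq0 : ∀ ξ ∈ X, ∀ y ∈ q, ξ ⁅y, v⁆ = 0 := fun ξ hξ y hy => by
    rw [hχ ξ hξ y hy.1 v hv, hy.2, neg_zero]
  have hstep := Reduces.step hn hqn hx hsup (fun y hy => hn'q (hlie x hx y hy.1)) hX v (χ v)
    (fun ξ hξ => by rw [hχ ξ hξ x hx v hv, hxv1, neg_neg]) hq0
  have hstable : ExpStable q {ξ ∈ X | ξ v + χ v = 0} := by
    have := hX.inter hn hqn (V := {v}) (fun w => -χ w) (fun ξ hξ y hy w hw => by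
      rw [Set.mem_singleton_iff.mp hw]; exact hq0 ξ hξ y hy)
    simpa [eq_neg_iff_add_eq_zero] using this
  have hrec := ih _ (Submodule.finrank_lt_finrank_of_lt hqlt) (n := q)
    (fun y hy => hn y (hqn hy)) hn'q (fun a ha b hb => hlie a (hqn ha) b (hqn hb)) hstable
    (fun ξ hξ y hy w hw => hχ ξ hξ.1 y (hqn hy) w hw)
    (fun y hy hyV => hleft y (hqn hy) hyV)
    (fun w hw hwq ξ hξ => by
      -- If `w` is orthogonal to `q`, adding this multiple of `v` makes it orthogonal to `x` too,
      -- hence to all of `n`. The value of `ξ` on `v` is already fixed on the smaller set.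
      have h3 := hright (w + χ ⁅x, w⁆ • v) (add_mem hw (V.smul_mem _ hv)) (fun y hy => by
        obtain ⟨z, hz, z', hz', rfl⟩ := Submodule.mem_sup.mp (hsup hy)
        obtain ⟨s, rfl⟩ := Submodule.mem_span_singleton.mp hz'
        simp only [add_lie, lie_add, lie_smul, smul_lie, map_add, map_smul, smul_eq_mul, hxv1,
          hwq z hz, hz.2]
        ring) ξ hξ.1
      have h4 : ξ v = -χ v := eq_neg_of_add_eq_zero_left hξ.2
      rw [map_add, map_add, map_smul, map_smul, h4] at h3
      simp only [smul_eq_mul] at h3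
      linear_combination h3) rfl
  have heq : {ξ ∈ {ξ ∈ X | ξ v + χ v = 0} | ∀ w ∈ V, ξ w = -χ w} =
      {ξ ∈ X | ∀ w ∈ V, ξ w = -χ w} := by
    ext ξ
    refine ⟨fun h => ⟨h.1.1, h.2⟩, fun h => ⟨⟨h.1, ?_⟩, h.2⟩⟩
    rw [h.2 v hv, neg_add_cancel]
  rw [heq] at hrec
  exact hstep.trans hrec

end SlodowyReduction

namespace SlodowyReduction

/-! ## The ideal of a fibre of the moment map -/

/-- A complement of `W` makes `Sym(V)` a polynomial ring over `Sym(W)`. A polynomial vanishing on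
all extensions of the points of `S` has coefficients that vanish on `S`, so the extended ideal is
already the full vanishing ideal. -/
theorem map_vanishingIdeal_eq {V : Type*} [AddCommGroup V] [Module ℂ V] (W : Submodule ℂ V)
    (S : Set (Module.Dual ℂ W)) :
    (vanishingIdeal S).map (SymmetricAlgebra.lift (SymmetricAlgebra.ι ℂ V ∘ₗ W.subtype)) =
      vanishingIdeal {ξ : Module.Dual ℂ V | ξ ∘ₗ W.subtype ∈ S} := by
  set i : SymmetricAlgebra ℂ W →ₐ[ℂ] SymmetricAlgebra ℂ V :=
    SymmetricAlgebra.lift (SymmetricAlgebra.ι ℂ V ∘ₗ W.subtype) with hi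
  have hlift : ∀ (ξ : Module.Dual ℂ V) (p : SymmetricAlgebra ℂ W),
      SymmetricAlgebra.lift ξ (i p) = SymmetricAlgebra.lift (ξ ∘ₗ W.subtype) p := by
    intro ξ p
    have : (SymmetricAlgebra.lift ξ).comp i = SymmetricAlgebra.lift (ξ ∘ₗ W.subtype) := by
      apply SymmetricAlgebra.algHom_ext
      ext x
      simp [hi]
    exact DFunLike.congr_fun this p
  apply le_antisymm
  · rw [Ideal.map_le_iff_le_comap]
    intro p hp
    rw [Ideal.mem_comap, mem_vanishingIdeal]
    intro ξ hξ
    change SymmetricAlgebra.lift ξ (i p) = 0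
    rw [hlift]
    exact mem_vanishingIdeal.mp hp _ hξ
  intro F hF
  obtain ⟨C, hC⟩ := W.exists_isCompl
  let b := Module.Basis.ofVectorSpace ℂ C
  let Ψ : MvPolynomial (Module.Basis.ofVectorSpaceIndex ℂ C) (SymmetricAlgebra ℂ W) →+*
      SymmetricAlgebra ℂ V :=
    MvPolynomial.eval₂Hom i.toRingHom fun k => SymmetricAlgebra.ι ℂ V (b k)
  have hsurj : ∀ F, ∃ P, Ψ P = F := by
    intro F
    induction F using SymmetricAlgebra.induction with
    | algebraMap r => exact ⟨MvPolynomial.C (algebraMap ℂ _ r), by simp [Ψ]⟩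
    | ι v =>
      obtain ⟨w, hw, c, hc, rfl⟩ : ∃ w ∈ W, ∃ c ∈ C, w + c = v :=
        Submodule.mem_sup.mp (by rw [hC.sup_eq_top]; trivial)
      refine ⟨MvPolynomial.C (SymmetricAlgebra.ι ℂ W ⟨w, hw⟩) + ∑ k ∈ (b.repr ⟨c, hc⟩).support,
        MvPolynomial.C (algebraMap ℂ _ (b.repr ⟨c, hc⟩ k)) * MvPolynomial.X k, ?_⟩
      have h1 : c = ∑ k ∈ (b.repr ⟨c, hc⟩).support, b.repr ⟨c, hc⟩ k • (b k : V) := by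
        have := congrArg C.subtype (b.linearCombination_repr ⟨c, hc⟩)
        rw [Finsupp.linearCombination_apply, Finsupp.sum, map_sum] at this
        simpa using this.symm
      conv_rhs => rw [h1]
      simp [Ψ, hi, Algebra.smul_def]
    | mul a b ha hb =>
      obtain ⟨P, rfl⟩ := ha
      obtain ⟨Q, rfl⟩ := hb
      exact ⟨P * Q, map_mul _ _ _⟩
    | add a b ha hb =>
      obtain ⟨P, rfl⟩ := ha
      obtain ⟨Q, rfl⟩ := hb
      exact ⟨P + Q, map_add _ _ _⟩
  obtain ⟨P, rfl⟩ := hsurj F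
  have hcoeff : ∀ m, P.coeff m ∈ vanishingIdeal S := by
    intro m
    rw [mem_vanishingIdeal]
    intro η hη
    have hmap : MvPolynomial.map (SymmetricAlgebra.lift η).toRingHom P = 0 := by
      apply MvPolynomial.funext
      intro z
      -- Every value `z` of the polynomial variables is attained by some form `ξ` that restricts to
      -- `η` on `W`.
      let ζ : Module.Dual ℂ C := b.constr ℂ z
      let ξ : Module.Dual ℂ V :=
        η ∘ₗ W.projectionOnto C hC + ζ ∘ₗ C.projectionOnto W hC.symm
      have hξW : ξ ∘ₗ W.subtype = η := by
        ext w
        simp [ξ]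
      have hξC : ∀ k, ξ (b k) = z k := by
        intro k
        simp [ξ, ζ]
      have h2 := mem_vanishingIdeal.mp hF ξ (by rw [Set.mem_ofPred_eq, hξW]; exact hη)
      rw [map_zero, ← h2, MvPolynomial.eval_map]
      change _ = (SymmetricAlgebra.lift ξ).toRingHom (Ψ P)
      simp only [Ψ, MvPolynomial.coe_eval₂Hom]
      rw [MvPolynomial.hom_eval₂]
      congr 1
      · ext p
        change SymmetricAlgebra.lift η p = SymmetricAlgebra.lift ξ (i p)
        rw [hlift, hξW]
      · ext k
        simp [hξC]
    have := congrArg (MvPolynomial.coeff m) hmap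
    rwa [MvPolynomial.coeff_map, MvPolynomial.coeff_zero] at this
  simp only [Ψ, MvPolynomial.coe_eval₂Hom, MvPolynomial.eval₂_eq]
  exact Submodule.sum_mem _ fun m _ => Ideal.mul_mem_right _ _ (Ideal.mem_map_of_mem i (hcoeff m))

variable {g : Type*} [LieRing g] [LieAlgebra ℂ g]

namespace AdNilpotentSubalgebra

variable (n : AdNilpotentSubalgebra g) (χ : Module.Dual ℂ g)

theorem fiberIdeal_eq : n.fiberIdeal χ = vanishingIdeal (n.fiber χ) :=
  map_vanishingIdeal_eq n.toLieSubalgebra.toSubmodule (n.oppositeOrbit χ)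

theorem adNilpotent : AdNilpotent n.toLieSubalgebra.toSubmodule := n.isNilpotent_ad

theorem map_mem {φ : g ≃ₗ[ℂ] g} (hφ : φ ∈ n.unipotentGroup) :
    ∀ y ∈ n.toLieSubalgebra, φ y ∈ n.toLieSubalgebra ∧ φ⁻¹ y ∈ n.toLieSubalgebra := by
  have hexp : ∀ x ∈ n.toLieSubalgebra, ∀ y ∈ n.toLieSubalgebra, expAd x y ∈ n.toLieSubalgebra :=
    fun x hx y hy => expAd_mem (n.isNilpotent_ad x hx)
      (W := n.toLieSubalgebra.toSubmodule) (fun w hw => n.toLieSubalgebra.lie_mem hx hw) hy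
  induction hφ using Subgroup.closure_induction with
  | mem φ h =>
    obtain ⟨x, hx, hφ⟩ := h
    intro y hy
    have h1 : ∀ z, φ z = expAd x z := fun z => by rw [← hφ]; rfl
    refine ⟨h1 y ▸ hexp x hx y hy, ?_⟩
    have h2 : φ⁻¹ y = expAd (-x) y := by
      apply φ.injective
      have h3 := DFunLike.congr_fun (expAd_comp_neg (n.isNilpotent_ad x hx)) y
      rw [h1 (expAd (-x) y)]
      exact (φ.apply_symm_apply y).trans h3.symm
    rw [h2]
    exact hexp _ (neg_mem hx) y hy
  | one => exact fun y hy => ⟨hy, hy⟩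
  | mul φ ψ _ _ h1 h2 =>
    intro y hy
    refine ⟨(h1 _ (h2 y hy).1).1, ?_⟩
    rw [mul_inv_rev]
    exact (h2 _ (h1 y hy).2).2
  | inv φ _ h =>
    intro y hy
    rw [inv_inv]
    exact (h y hy).symm

/-- Replacing the group element by its inverse removes the inverse from the coadjoint action. -/
theorem mem_fiber_iff {ξ : Module.Dual ℂ g} : ξ ∈ n.fiber χ ↔
    ∃ φ ∈ n.unipotentGroup, ∀ y ∈ n.toLieSubalgebra, ξ y = -χ (φ y) := by
  constructor
  · rintro ⟨φ, hφ, h⟩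
    exact ⟨φ⁻¹, inv_mem hφ, fun y hy => DFunLike.congr_fun h ⟨y, hy⟩⟩
  · rintro ⟨φ, hφ, h⟩
    exact ⟨φ⁻¹, inv_mem hφ, LinearMap.ext fun y => h y y.2⟩

theorem mem_unipotentGroup_of_expAd {x : g} (hx : x ∈ n.toLieSubalgebra) {φ : g ≃ₗ[ℂ] g}
    (hφ : (φ : g →ₗ[ℂ] g) = expAd x) : φ ∈ n.unipotentGroup :=
  Subgroup.subset_closure ⟨x, hx, hφ⟩

theorem comp_mem_fiber {φ : g ≃ₗ[ℂ] g} (hφ : φ ∈ n.unipotentGroup) {ξ : Module.Dual ℂ g}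
    (hξ : ξ ∈ n.fiber χ) : ξ ∘ₗ (φ : g →ₗ[ℂ] g) ∈ n.fiber χ := by
  rw [mem_fiber_iff] at hξ ⊢
  obtain ⟨ψ, hψ, h⟩ := hξ
  exact ⟨ψ * φ, mul_mem hψ hφ, fun y hy => h _ (n.map_mem hφ y hy).1⟩

theorem expStable_fiber : ExpStable n.toLieSubalgebra.toSubmodule (n.fiber χ) := by
  intro x hx ξ hξ
  obtain ⟨φ, hφ, -⟩ := expAd_lie (n.isNilpotent_ad x hx)
  rw [← hφ]
  exact n.comp_mem_fiber χ (n.mem_unipotentGroup_of_expAd hx hφ) hξ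

theorem unipotentGroup_mono {n n' : AdNilpotentSubalgebra g}
    (h : n'.toLieSubalgebra.toSubmodule ≤ n.toLieSubalgebra.toSubmodule) :
    n'.unipotentGroup ≤ n.unipotentGroup :=
  Subgroup.closure_mono fun _ ⟨x, hx, hφ⟩ => ⟨x, h hx, hφ⟩

theorem mem_invariantLifts_iff {F : SymmetricAlgebra ℂ g} : F ∈ n.invariantLifts χ ↔
    ExpInvariant n.toLieSubalgebra.toSubmodule (n.fiber χ) F := by
  constructor
  · intro hF x hx ξ hξ
    obtain ⟨φ, hφ, -⟩ := expAd_lie (n.isNilpotent_ad x hx)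
    have := hF φ (n.mem_unipotentGroup_of_expAd hx hφ)
    rw [fiberIdeal_eq, mem_vanishingIdeal] at this
    have := this ξ hξ
    rw [map_sub, lift_symMap, hφ] at this
    exact sub_eq_zero.mp this
  · intro hF φ hφ
    rw [fiberIdeal_eq, mem_vanishingIdeal]
    suffices h : ∀ ξ ∈ n.fiber χ, SymmetricAlgebra.lift (ξ ∘ₗ (φ : g →ₗ[ℂ] g)) F =
        SymmetricAlgebra.lift ξ F by
      intro ξ hξ
      rw [map_sub, lift_symMap, h ξ hξ, sub_self]
    induction hφ using Subgroup.closure_induction with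
    | mem φ h =>
      obtain ⟨x, hx, hφ⟩ := h
      intro ξ hξ
      rw [hφ]
      exact hF x hx ξ hξ
    | one => exact fun _ _ => rfl
    | mul φ ψ hφ _ h1 h2 =>
      exact fun ξ hξ => (h2 _ (n.comp_mem_fiber χ hφ hξ)).trans (h1 ξ hξ)
    | inv φ hφ h =>
      intro ξ hξ
      rw [← h _ (n.comp_mem_fiber χ (inv_mem hφ) hξ)]
      congr 2
      ext y
      exact congrArg ξ (φ.symm_apply_apply y)

/-! ### From reductions of point sets to isomorphisms of rings of invariants. -/

theorem mk_mem_invariants {F : SymmetricAlgebra ℂ g} (hF : F ∈ n.invariantLifts χ) :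
    Ideal.Quotient.mk (n.fiberIdeal χ) F ∈ n.invariants χ :=
  ⟨F, hF, rfl⟩

theorem exists_lift (a : n.invariants χ) :
    ∃ F ∈ n.invariantLifts χ, (a : n.FiberRing χ) = Ideal.Quotient.mk _ F := by
  obtain ⟨a, F, hF, rfl⟩ := a
  exact ⟨F, hF, rfl⟩

/-- The restriction of invariant functions along an inclusion of fibres. -/
theorem exists_restriction {n n' : AdNilpotentSubalgebra g} {χ : Module.Dual ℂ g}
    (hle : n'.toLieSubalgebra.toSubmodule ≤ n.toLieSubalgebra.toSubmodule)
    (hI : n.fiberIdeal χ ≤ n'.fiberIdeal χ) :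
    ∃ φ : n.invariants χ →ₐ[ℂ] n'.invariants χ,
      ∀ F, (φ F : n'.FiberRing χ) = Ideal.Quotient.factorₐ ℂ hI F := by
  refine ⟨((Ideal.Quotient.factorₐ ℂ hI).comp (n.invariants χ).val).codRestrict _ ?_,
    fun F => rfl⟩
  intro a
  obtain ⟨F, hF, ha⟩ := n.exists_lift χ a
  have h1 : Ideal.Quotient.factorₐ ℂ hI (a : n.FiberRing χ) = Ideal.Quotient.mk _ F := by
    rw [ha]; rfl
  change Ideal.Quotient.factorₐ ℂ hI (a : n.FiberRing χ) ∈ _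
  rw [h1]
  exact n'.mk_mem_invariants χ fun ψ hψ => hI (hF ψ (unipotentGroup_mono hle hψ))

/-- The same two functions on `𝔤*` serve as lifts on both sides: the smaller group and the larger
ideal only weaken the invariance condition. -/
theorem restriction_reducedBracket {n n' : AdNilpotentSubalgebra g} {χ : Module.Dual ℂ g}
    (hle : n'.toLieSubalgebra.toSubmodule ≤ n.toLieSubalgebra.toSubmodule)
    (hI : n.fiberIdeal χ ≤ n'.fiberIdeal χ) {φ : n.invariants χ →ₐ[ℂ] n'.invariants χ}
    (hφ : ∀ F, (φ F : n'.FiberRing χ) = Ideal.Quotient.factorₐ ℂ hI F) (a b : n.invariants χ) :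
    φ (n.reducedBracket χ a b) = n'.reducedBracket χ (φ a) (φ b) := by
  obtain ⟨F, hF, ha⟩ := n.exists_lift χ a
  obtain ⟨G, hG, hb⟩ := n.exists_lift χ b
  have hF' : F ∈ n'.invariantLifts χ := fun ψ hψ => hI (hF ψ (unipotentGroup_mono hle hψ))
  apply Subtype.ext
  rw [hφ, n.reducedBracket_mk χ hF a b ha hb, n'.reducedBracket_mk χ (G := G) hF' (φ a) (φ b)
    (by rw [hφ, ha]; rfl) (by rw [hφ, hb]; rfl)]
  rfl

theorem restriction_bijective {n n' : AdNilpotentSubalgebra g} {χ : Module.Dual ℂ g}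
    (hred : Reduces n.toLieSubalgebra.toSubmodule (n.fiber χ)
      n'.toLieSubalgebra.toSubmodule (n'.fiber χ))
    (hI : n.fiberIdeal χ ≤ n'.fiberIdeal χ) {φ : n.invariants χ →ₐ[ℂ] n'.invariants χ}
    (hφ : ∀ F, (φ F : n'.FiberRing χ) = Ideal.Quotient.factorₐ ℂ hI F) :
    Function.Bijective φ := by
  constructor
  · rw [injective_iff_map_eq_zero]
    intro a ha
    obtain ⟨F, hF, haF⟩ := n.exists_lift χ a
    have h1 : Ideal.Quotient.mk (n'.fiberIdeal χ) F = 0 := by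
      have h2 := hφ a
      rw [ha, haF] at h2
      exact h2.symm
    rw [Ideal.Quotient.eq_zero_iff_mem, fiberIdeal_eq, mem_vanishingIdeal] at h1
    apply Subtype.ext
    rw [haF, ZeroMemClass.coe_zero, Ideal.Quotient.eq_zero_iff_mem, fiberIdeal_eq,
      mem_vanishingIdeal]
    exact hred.eq_zero F ((n.mem_invariantLifts_iff χ).mp hF) h1
  · intro b
    obtain ⟨f, hf, hb⟩ := n'.exists_lift χ b
    obtain ⟨F, hF, hFf⟩ := hred.extend f ((n'.mem_invariantLifts_iff χ).mp hf)
    refine ⟨⟨_, n.mk_mem_invariants χ ((n.mem_invariantLifts_iff χ).mpr hF)⟩, Subtype.ext ?_⟩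
    rw [hφ, hb]
    change Ideal.Quotient.mk _ F = _
    rw [Ideal.Quotient.mk_eq_mk_iff_sub_mem, fiberIdeal_eq, mem_vanishingIdeal]
    intro ξ hξ
    rw [map_sub, hFf ξ hξ, sub_self]

theorem restrictInvariants_bijective {S : Set (Module.Dual ℂ g)}
    (hred : Reduces n.toLieSubalgebra.toSubmodule (n.fiber χ) ⊥ S)
    (hJ : n.fiberIdeal χ ≤ vanishingIdeal S) :
    Function.Bijective (n.restrictInvariants χ _ hJ) := by
  have hmk : ∀ (F : SymmetricAlgebra ℂ g) (hF), n.restrictInvariants χ _ hJ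
      ⟨Ideal.Quotient.mk _ F, hF⟩ = Ideal.Quotient.mk _ F := fun _ _ => rfl
  constructor
  · rw [injective_iff_map_eq_zero]
    rintro ⟨a, ha'⟩ ha
    obtain ⟨F, hF, rfl⟩ := id ha'
    have h1 : Ideal.Quotient.mk (vanishingIdeal S) F = 0 := ha
    rw [Ideal.Quotient.eq_zero_iff_mem, mem_vanishingIdeal] at h1
    apply Subtype.ext
    change Ideal.Quotient.mk (n.fiberIdeal χ) F = 0
    rw [Ideal.Quotient.eq_zero_iff_mem, fiberIdeal_eq, mem_vanishingIdeal]
    exact hred.eq_zero F ((n.mem_invariantLifts_iff χ).mp hF) h1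
  · intro b
    obtain ⟨f, rfl⟩ := Ideal.Quotient.mk_surjective b
    obtain ⟨F, hF, hFf⟩ := hred.extend f (fun x hx ξ _ => by
      rw [(Submodule.mem_bot ℂ).mp hx, expAd_zero, LinearMap.comp_id])
    refine ⟨⟨_, n.mk_mem_invariants χ ((n.mem_invariantLifts_iff χ).mpr hF)⟩, ?_⟩
    rw [hmk, Ideal.Quotient.mk_eq_mk_iff_sub_mem, mem_vanishingIdeal]
    intro ξ hξ
    rw [map_sub, hFf ξ hξ, sub_self]

end AdNilpotentSubalgebra

theorem isIso_specMap_of_bijective.{u} {R S : Type u} [CommRing R] [CommRing S] [Algebra ℂ R]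
    [Algebra ℂ S] (f : R →ₐ[ℂ] S) (hf : Function.Bijective f) :
    CategoryTheory.IsIso (AlgebraicGeometry.Spec.map (CommRingCat.ofHom f.toRingHom)) := by
  have : CategoryTheory.IsIso (CommRingCat.ofHom f.toRingHom) :=
    (CategoryTheory.ConcreteCategory.isIso_iff_bijective _).mpr hf
  infer_instance

end SlodowyReduction

namespace SlodowyReduction

variable {g : Type*} [LieRing g] [LieAlgebra ℂ g]

/-! ## Invariant forms and gradings -/

theorem iSupIndep_gr (H : g) : iSupIndep (gr H) :=
  (Module.End.eigenspaces_iSupIndep (LieAlgebra.ad ℂ g H : Module.End ℂ g)).comp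
    (f := fun δ : ℤ => (δ : ℂ)) Int.cast_injective

theorem eq_zero_of_mem_gr_of_mem_grGE {H x : g} {i j : ℤ} (hij : i < j) (hi : x ∈ gr H i)
    (hj : x ∈ grGE H j) : x = 0 := by
  have h1 : grGE H j ≤ ⨆ (δ : ℤ) (_ : δ ≠ i), gr H δ :=
    iSup₂_le fun δ hδ => le_iSup₂_of_le δ (by omega) le_rfl
  exact Submodule.disjoint_def.mp (iSupIndep_gr H i) x hi (h1 hj)

theorem grGE_le_sup (H : g) (k : ℤ) : grGE H k ≤ gr H k ⊔ grGE H (k + 1) := by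
  refine iSup₂_le fun δ hδ => ?_
  rcases hδ.eq_or_lt with rfl | h
  · exact le_sup_left
  · exact (gr_le_grGE H (by omega)).trans le_sup_right

theorem exists_grGE_eq_bot [FiniteDimensional ℂ g] (H : g) : ∃ K : ℕ, grGE H K = ⊥ := by
  have hfin : {δ : ℤ | gr H δ ≠ ⊥}.Finite :=
    WellFoundedGT.finite_ne_bot_of_iSupIndep (iSupIndep_gr H)
  obtain ⟨b, hb⟩ := hfin.bddAbove
  refine ⟨(b + 1).toNat, ?_⟩
  rw [eq_bot_iff]
  refine iSup₂_le fun δ hδ => ?_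
  by_contra h
  have : δ ≤ b := hb (show gr H δ ≠ ⊥ from fun h' => h (by rw [h']))
  omega

theorem lie_mem_gr_of_eq {H x y : g} {i j k : ℤ} (hx : x ∈ gr H i) (hy : y ∈ gr H j)
    (hk : i + j = k) : ⁅x, y⁆ ∈ gr H k :=
  hk ▸ lie_mem_gr hx hy

theorem lie_mem_grGE_of_le {H x y : g} {i j k : ℤ} (hx : x ∈ grGE H i) (hy : y ∈ grGE H j)
    (hk : k ≤ i + j) : ⁅x, y⁆ ∈ grGE H k :=
  grGE_anti H hk (lie_mem_grGE hx hy)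

section Form

variable {B : LinearMap.BilinForm ℂ g} (hBinv : B.lieInvariant g)

include hBinv

theorem form_lie_left (x y z : g) : B ⁅x, y⁆ z = B x ⁅y, z⁆ := by
  rw [← lie_skew, map_neg, LinearMap.neg_apply, hBinv y x z, neg_neg]

theorem form_eq_zero {H x y : g} {i j : ℤ} (hij : i + j ≠ 0) (hx : x ∈ gr H i)
    (hy : y ∈ gr H j) : B x y = 0 := by
  have h := hBinv H x y
  rw [mem_gr.mp hx, mem_gr.mp hy, map_smul, map_smul, LinearMap.smul_apply, smul_eq_mul,
    smul_eq_mul] at h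
  have h1 : ((i + j : ℤ) : ℂ) * B x y = 0 := by push_cast; linear_combination h
  exact (mul_eq_zero.mp h1).resolve_left (Int.cast_ne_zero.mpr hij)

theorem eq_zero_of_form_left (hB : B.Nondegenerate) {H : g} (hH : ⨆ δ : ℤ, gr H δ = ⊤) {x : g}
    {i : ℤ} (hx : x ∈ gr H i) (h : ∀ y ∈ gr H (-i), B x y = 0) : x = 0 := by
  refine hB.1 x fun y => ?_
  have : (⊤ : Submodule ℂ g) ≤ LinearMap.ker (B x) := by
    rw [← hH]
    refine iSup_le fun δ y hy => ?_
    by_cases hδ : δ = -i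
    · exact h y (hδ ▸ hy)
    · exact form_eq_zero hBinv (by omega) hx hy
  exact this (Submodule.mem_top (x := y))

theorem eq_zero_of_form_right (hB : B.Nondegenerate) (hBsymm : B.IsSymm) {H : g}
    (hH : ⨆ δ : ℤ, gr H δ = ⊤) {x : g} {i : ℤ} (hx : x ∈ gr H i)
    (h : ∀ y ∈ gr H (-i), B y x = 0) : x = 0 :=
  eq_zero_of_form_left hBinv hB hH hx fun y hy => by rw [hBsymm.eq]; exact h y hy

theorem form_grGE_eq_zero {H f y : g} (hf : f ∈ gr H (-2)) (hy : y ∈ grGE H 3) : B f y = 0 := by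
  have : grGE H 3 ≤ LinearMap.ker (B f) :=
    iSup₂_le fun δ hδ y hy => form_eq_zero hBinv (by omega) hf hy
  exact this hy

end Form

/-! ## Slodowy slices as reductions -/

/-- The usual formula for a lowest weight vector persists when only `[e, [f, x]] = 0` is known, in
place of `[f, x] = 0`. -/
theorem lie_pow_ad_of_lie_lie_eq_zero {e k f x : g} {μ : ℂ} (hke : ⁅k, e⁆ = (2 : ℂ) • e)
    (hef : ⁅e, f⁆ = k) (hx : ⁅k, x⁆ = μ • x) (hefx : ⁅e, ⁅f, x⁆⁆ = 0) (j : ℕ) :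
    ⁅k, (LieAlgebra.ad ℂ g e ^ j) x⁆ = (μ + 2 * j) • (LieAlgebra.ad ℂ g e ^ j) x ∧
    ⁅f, (LieAlgebra.ad ℂ g e ^ (j + 1)) x⁆ =
      (-((j + 1) * (μ + j))) • (LieAlgebra.ad ℂ g e ^ j) x := by
  have hfe : ∀ y : g, ⁅f, ⁅e, y⁆⁆ = ⁅e, ⁅f, y⁆⁆ - ⁅k, y⁆ := fun y => by
    rw [leibniz_lie f e y, ← lie_skew f e, hef, neg_lie]; abel
  induction j with
  | zero => simp [hx, hfe, hefx]
  | succ j ih =>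
    have h1 : ⁅k, (LieAlgebra.ad ℂ g e ^ (j + 1)) x⁆ =
        (μ + 2 * (j + 1 : ℕ)) • (LieAlgebra.ad ℂ g e ^ (j + 1)) x := by
      rw [pow_succ', Module.End.mul_apply, LieAlgebra.ad_apply, leibniz_lie, hke, ih.1,
        smul_lie, lie_smul, ← add_smul]
      congr 1
      push_cast
      ring
    refine ⟨h1, ?_⟩
    rw [pow_succ', Module.End.mul_apply, LieAlgebra.ad_apply, hfe, ih.2, lie_smul, h1]
    have h2 : ⁅e, (LieAlgebra.ad ℂ g e ^ j) x⁆ = (LieAlgebra.ad ℂ g e ^ (j + 1)) x := by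
      rw [pow_succ', Module.End.mul_apply, LieAlgebra.ad_apply]
    rw [h2, ← sub_smul]
    congr 1
    push_cast
    ring

variable [FiniteDimensional ℂ g]

/-- An element `e` of degree `2` completing `f` to an `sl₂`-triple `(e, k, f)`. -/
structure IsGradedTriple (H e k f : g) : Prop where
  lie_k_e : ⁅k, e⁆ = (2 : ℂ) • e
  lie_k_f : ⁅k, f⁆ = (-2 : ℂ) • f
  lie_e_f : ⁅e, f⁆ = k
  e_mem : e ∈ gr H 2
  k_mem : k ∈ gr H 0

namespace IsGradedTriple

variable {H e k f : g} (ht : IsGradedTriple H e k f) (hgood : IsGoodGrading H f)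

include ht hgood

omit [FiniteDimensional ℂ g] in
theorem lie_lie_mem {d : ℤ} {x : g} (hx : x ∈ gr H d) : ⁅e, ⁅f, x⁆⁆ ∈ gr H d :=
  lie_mem_gr_of_eq ht.e_mem (lie_mem_gr hgood.mem hx) (by ring)

/-- As `k` may differ from `H`, the degree `d` says nothing directly about `sl₂`-weights. In the
kernel of `ad e ∘ ad f` on degree `d`, choose an eigenvector `y` of `ad k`, of weight `μ`. Goodness
gives `[f, y] ≠ 0`, and this vector is primitive of weight `μ - 2`, so `μ - 2` is a natural number.
Then the coefficients `(j + 1)(μ + j)` never vanish, all `(ad e)^j y` are nonzero, and `e` is not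
ad-nilpotent. -/
theorem eq_zero_of_lie_lie {d : ℤ} (hd : 1 ≤ d) {x : g} (hx : x ∈ gr H d)
    (h0 : ⁅e, ⁅f, x⁆⁆ = 0) : x = 0 := by
  let U : Submodule ℂ g := gr H d ⊓
    LinearMap.ker ((LieAlgebra.ad ℂ g e : Module.End ℂ g) * LieAlgebra.ad ℂ g f)
  have hU : ∀ y, y ∈ U ↔ y ∈ gr H d ∧ ⁅e, ⁅f, y⁆⁆ = 0 := fun y => Iff.rfl
  suffices h : U = ⊥ by
    have hxU : x ∈ U := ⟨hx, h0⟩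
    rw [h] at hxU
    exact hxU
  by_contra hne
  have hkU : ∀ y ∈ U, (LieAlgebra.ad ℂ g k : Module.End ℂ g) y ∈ U := by
    intro y hy
    rw [hU] at hy ⊢
    rw [LieAlgebra.ad_apply]
    refine ⟨by simpa using lie_mem_gr ht.k_mem hy.1, ?_⟩
    have h1 : ⁅f, ⁅k, y⁆⁆ = ⁅k, ⁅f, y⁆⁆ + (2 : ℂ) • ⁅f, y⁆ := by
      rw [leibniz_lie k f y, ht.lie_k_f, smul_lie, neg_smul]; abel
    have h2 : ⁅e, ⁅k, ⁅f, y⁆⁆⁆ = ⁅k, ⁅e, ⁅f, y⁆⁆⁆ - (2 : ℂ) • ⁅e, ⁅f, y⁆⁆ := by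
      rw [leibniz_lie k e, ht.lie_k_e, smul_lie]; abel
    rw [h1, lie_add, lie_smul, h2, hy.2]
    simp
  have : Nontrivial U := Submodule.nontrivial_iff_ne_bot.mpr hne
  obtain ⟨μ, hμ⟩ := Module.End.exists_eigenvalue
    ((LieAlgebra.ad ℂ g k : Module.End ℂ g).restrict hkU)
  obtain ⟨⟨y, hyU⟩, hy⟩ := hμ.exists_hasEigenvector
  have hy0 : y ≠ 0 := fun h => hy.2 (Subtype.ext h)
  have hky : ⁅k, y⁆ = μ • y := congrArg Subtype.val hy.apply_eq_smul
  have hefy := ((hU y).mp hyU).2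
  have hfy : ⁅f, y⁆ ≠ 0 := fun h => hy0 (hgood.injective d hd y hyU.1 h)
  have hk0 : k ≠ 0 := by
    rintro rfl
    have h1 := ht.lie_k_f
    rw [zero_lie, eq_comm, smul_eq_zero] at h1
    rcases h1 with h1 | h1
    · norm_num at h1
    · exact hfy (by rw [h1, zero_lie])
  have htriple : IsSl2Triple k e f := by
    refine ⟨hk0, ht.lie_e_f, ?_, ?_⟩
    · rw [ht.lie_k_e, two_smul, two_smul]
    · rw [ht.lie_k_f, neg_smul, two_smul, two_smul]
  have hprim : htriple.HasPrimitiveVectorWith ⁅f, y⁆ (μ - 2) := by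
    refine ⟨hfy, ?_, hefy⟩
    rw [leibniz_lie, ht.lie_k_f, hky, smul_lie, lie_smul, ← add_smul]
    congr 1
    ring
  obtain ⟨N, hN⟩ := hprim.exists_nat
  have hμN : μ = N + 2 := by linear_combination hN
  have hpow : ∀ j : ℕ, (LieAlgebra.ad ℂ g e ^ j) y ≠ 0 := by
    intro j
    induction j with
    | zero => simpa using hy0
    | succ j ih =>
      intro h
      have h1 := (lie_pow_ad_of_lie_lie_eq_zero ht.lie_k_e ht.lie_e_f hky hefy j).2
      rw [h, lie_zero, eq_comm, smul_eq_zero, neg_eq_zero] at h1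
      refine h1.elim (fun h2 => ?_) ih
      rw [hμN] at h2
      have : ((((j + 1) * (N + 2 + j) : ℕ)) : ℂ) = 0 := by push_cast; exact h2
      have := Nat.cast_eq_zero.mp this
      simp at this
  obtain ⟨m, hm⟩ := isNilpotent_ad_of_mem hgood.iSup_gr
    (gr_le_grGE H (by norm_num : (1 : ℤ) ≤ 2) ht.e_mem)
  exact hpow m (by rw [hm]; rfl)

theorem exists_lie_lie_eq {d : ℤ} (hd : 1 ≤ d) {x : g} (hx : x ∈ gr H d) :
    ∃ y ∈ gr H d, ⁅e, ⁅f, y⁆⁆ = x := by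
  let M : Module.End ℂ (gr H d) :=
    LinearMap.restrict ((LieAlgebra.ad ℂ g e : Module.End ℂ g) * LieAlgebra.ad ℂ g f)
      fun y hy => ht.lie_lie_mem hgood hy
  have hinj : Function.Injective M := by
    rw [injective_iff_map_eq_zero]
    rintro ⟨y, hy⟩ h
    exact Subtype.ext (ht.eq_zero_of_lie_lie hgood hd hy (congrArg Subtype.val h))
  obtain ⟨⟨y, hy⟩, h⟩ := LinearMap.injective_iff_surjective.mp hinj ⟨x, hx⟩
  exact ⟨y, hy, congrArg Subtype.val h⟩

end IsGradedTriple

/-- The affine subspace of the `ξ` with `ξ = -χ` on `m`. -/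
def affineFiber (χ : Module.Dual ℂ g) (m : Submodule ℂ g) : Set (Module.Dual ℂ g) :=
  {ξ | ∀ w ∈ m, ξ w = -χ w}

omit [FiniteDimensional ℂ g] in
theorem expStable_affineFiber {n m : Submodule ℂ g} {χ : Module.Dual ℂ g} (hn : AdNilpotent n)
    (h : ∀ x ∈ n, ∀ w ∈ m, ⁅x, w⁆ ∈ m ∧ χ ⁅x, w⁆ = 0) : ExpStable n (affineFiber χ m) := by
  intro x hx ξ hξ w hw
  have h1 : expAd x w - w ∈ m ⊓ LinearMap.ker χ :=
    expAd_sub_self_mem (W := m ⊓ LinearMap.ker χ) (hn x hx) (fun z hz => h x hx z hz.1)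
      (h x hx w hw)
  have h2 := hξ _ h1.1
  rw [LinearMap.mem_ker.mp h1.2, neg_zero, map_sub, hξ w hw] at h2
  rw [LinearMap.comp_apply, ← sub_eq_zero, h2]

section Slice

variable {B : LinearMap.BilinForm ℂ g} (hB : B.Nondegenerate) (hBsymm : B.IsSymm)
  (hBinv : B.lieInvariant g) {H f : g} (hgood : IsGoodGrading H f) {l : Submodule ℂ g}
  (hl : l ≤ omegaPerp B H f l)

-- `f` pairs to zero with degrees `≥ 3`, so only the brackets of two elements of degree `1` matter,
-- and these vanish by the definition of the orthogonal.
include hBinv hl in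
omit [FiniteDimensional ℂ g] in
theorem lie_mem_and_form_eq_zero (hf : f ∈ gr H (-2)) {x w : g}
    (hx : x ∈ omegaPerp B H f l ⊔ grGE H 2) (hw : w ∈ l ⊔ grGE H 2) :
    ⁅x, w⁆ ∈ grGE H 2 ∧ B f ⁅x, w⁆ = 0 := by
  have hw1 : w ∈ omegaPerp B H f l ⊔ grGE H 2 := sup_le_sup_right hl _ hw
  refine ⟨lie_mem_grGE_two (omegaPerp_sup_le B H f l hx) (omegaPerp_sup_le B H f l hw1), ?_⟩
  obtain ⟨a, ha, b, hb, rfl⟩ := Submodule.mem_sup.mp hx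
  obtain ⟨c, hc, d, hd, rfl⟩ := Submodule.mem_sup.mp hw
  have hc1 : c ∈ grGE H 1 := gr_le_grGE H le_rfl (hl hc).1
  have h1 := form_grGE_eq_zero hBinv hf
    (lie_mem_grGE_of_le (gr_le_grGE H le_rfl ha.1) hd (by norm_num))
  have h2 := form_grGE_eq_zero hBinv hf (lie_mem_grGE_of_le hb hc1 (by norm_num))
  have h3 := form_grGE_eq_zero hBinv hf (lie_mem_grGE_of_le hb hd (by norm_num))
  simp only [add_lie, lie_add, map_add]
  rw [ha.2 c hc, h1, h2, h3]
  simp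

include hBinv hgood hl in
theorem expStable_affineFiber_of_isotropic :
    ExpStable (omegaPerp B H f l ⊔ grGE H 2) (affineFiber (B f) (l ⊔ grGE H 2)) :=
  expStable_affineFiber
    (fun _ hx => isNilpotent_ad_of_mem hgood.iSup_gr (omegaPerp_sup_le B H f l hx))
    fun _ hx _ hw => by
      have := lie_mem_and_form_eq_zero hBinv hl hgood.mem hx hw
      exact ⟨Submodule.mem_sup_right this.1, this.2⟩

/-- The filtration of `𝔫_𝔩` by degree. -/
def nilFiltration (B : LinearMap.BilinForm ℂ g) (H f : g) (l : Submodule ℂ g) :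
    ℕ → Submodule ℂ g
  | 0 => omegaPerp B H f l ⊔ grGE H 2
  | j + 1 => grGE H ((j : ℤ) + 2)

omit [FiniteDimensional ℂ g] in
theorem nilFiltration_le (j : ℕ) : nilFiltration B H f l j ≤ grGE H ((j : ℤ) + 1) := by
  cases j with
  | zero => exact (omegaPerp_sup_le B H f l).trans_eq (by simp)
  | succ j => exact grGE_anti H (by push_cast; omega)

omit [FiniteDimensional ℂ g] in
theorem nilFiltration_succ_le (j : ℕ) :
    nilFiltration B H f l (j + 1) ≤ nilFiltration B H f l j := by
  cases j with
  | zero => exact le_sup_right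
  | succ j => exact grGE_anti H (by push_cast; omega)

/-- The affine subspace of `-χ + 𝔪^⊥` on which the first `j` degrees of `[𝔤, e]` are fixed. -/
def partialSlice (χ : Module.Dual ℂ g) (m : Submodule ℂ g) (H e : g) (j : ℕ) :
    Set (Module.Dual ℂ g) :=
  {ξ ∈ affineFiber χ m | ∀ i < j, ∀ z ∈ gr H (-((i : ℤ) + 1)), ξ ⁅e, z⁆ = -χ ⁅e, z⁆}

variable {e k : g} (ht : IsGradedTriple H e k f)
  (hperp : ∀ x ∈ gr H 1, (∀ y ∈ omegaPerp B H f l, B f ⁅y, x⁆ = 0) → x ∈ l)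

include hB hBsymm hBinv hgood hl ht hperp

/-- Stage `j` pairs degree `j + 1` of the algebra with `V = [e, 𝔤_{-(j+1)}]`, of degree `1 - j`. The
total degree is `2`, the only one seen by `f`, and the pairing is `-([e, [f, y]] | z)`. Elements of
higher degree are orthogonal to `V`. -/
theorem reduces_partialSlice (j : ℕ) :
    ExpStable (nilFiltration B H f l j) (partialSlice (B f) (l ⊔ grGE H 2) H e j) ∧
    Reduces (omegaPerp B H f l ⊔ grGE H 2) (affineFiber (B f) (l ⊔ grGE H 2))
      (nilFiltration B H f l j) (partialSlice (B f) (l ⊔ grGE H 2) H e j) := by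
  induction j with
  | zero =>
    have h0 : partialSlice (B f) (l ⊔ grGE H 2) H e 0 = affineFiber (B f) (l ⊔ grGE H 2) := by
      ext ξ
      simp [partialSlice]
    rw [h0]
    exact ⟨expStable_affineFiber_of_isotropic hBinv hgood hl, Reduces.refl _ _⟩
  | succ j ih =>
    obtain ⟨hst, hred⟩ := ih
    have hnil : AdNilpotent (nilFiltration B H f l j) := fun x hx =>
      isNilpotent_ad_of_mem hgood.iSup_gr (grGE_anti H (by omega) (nilFiltration_le j hx))
    let V : Submodule ℂ g := (gr H (-((j : ℤ) + 1))).map (LieAlgebra.ad ℂ g e : Module.End ℂ g)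
    have hV : ∀ v, v ∈ V ↔ ∃ z ∈ gr H (-((j : ℤ) + 1)), ⁅e, z⁆ = v := fun v => Iff.rfl
    have hVgr : ∀ v ∈ V, v ∈ gr H (1 - (j : ℤ)) := by
      intro v hv
      obtain ⟨z, hz, rfl⟩ := (hV v).mp hv
      exact lie_mem_gr_of_eq ht.e_mem hz (by ring)
    have hset : partialSlice (B f) (l ⊔ grGE H 2) H e (j + 1) =
        {ξ ∈ partialSlice (B f) (l ⊔ grGE H 2) H e j | ∀ v ∈ V, ξ v = -B f v} := by
      ext ξ
      constructor
      · intro h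
        refine ⟨⟨h.1, fun i hi => h.2 i (by omega)⟩, fun v hv => ?_⟩
        obtain ⟨z, hz, rfl⟩ := (hV v).mp hv
        exact h.2 j (by omega) z hz
      · intro h
        refine ⟨h.1.1, fun i hi z hz => ?_⟩
        rcases (Nat.lt_succ_iff.mp hi).eq_or_lt with rfl | hi'
        · exact h.2 _ ((hV _).mpr ⟨z, hz, rfl⟩)
        · exact h.1.2 i hi' z hz
    have hχ : ∀ ξ ∈ partialSlice (B f) (l ⊔ grGE H 2) H e j, ∀ y ∈ nilFiltration B H f l j,
        ∀ v ∈ V, ξ ⁅y, v⁆ = -B f ⁅y, v⁆ := by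
      intro ξ hξ y hy v hv
      exact hξ.1 _ (Submodule.mem_sup_right
        (lie_mem_grGE_of_le (nilFiltration_le j hy) (gr_le_grGE H le_rfl (hVgr v hv)) (by omega)))
    have h0 : ∀ y ∈ nilFiltration B H f l (j + 1), ∀ v ∈ V, B f ⁅y, v⁆ = 0 := by
      intro y hy v hv
      exact form_grGE_eq_zero hBinv hgood.mem (lie_mem_grGE_of_le
        (show y ∈ grGE H ((j : ℤ) + 2) from hy) (gr_le_grGE H le_rfl (hVgr v hv)) (by omega))
    have hform : ∀ y z, B f ⁅y, ⁅e, z⁆⁆ = -B ⁅e, ⁅f, y⁆⁆ z := fun y z => by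
      rw [← form_lie_left hBinv, hBinv e, neg_neg]
    have hleft : ∀ y ∈ nilFiltration B H f l j, (∀ v ∈ V, B f ⁅y, v⁆ = 0) →
        y ∈ nilFiltration B H f l (j + 1) := by
      intro y hy hyV
      obtain ⟨a, ha, b, hb, rfl⟩ := Submodule.mem_sup.mp (grGE_le_sup H _ (nilFiltration_le j hy))
      rw [add_assoc, one_add_one_eq_two] at hb
      have ha0 : a = 0 := by
        refine ht.eq_zero_of_lie_lie hgood (by omega) ha
          (eq_zero_of_form_left hBinv hB hgood.iSup_gr (ht.lie_lie_mem hgood ha) fun z hz => ?_)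
        have hzV := (hV _).mpr ⟨z, hz, rfl⟩
        have h1 := hyV _ hzV
        rw [add_lie, map_add, h0 b hb _ hzV, add_zero, hform] at h1
        exact neg_eq_zero.mp h1
      rw [ha0, zero_add]
      exact hb
    -- In degree `1` only `𝔩^⊥` acts, and the pairing may degenerate on the right; its radical then
    -- lies in `𝔩`, where `ξ` is already prescribed. In the later stages all of degree `j + 1` acts
    -- and the radical is zero.
    have hright : ∀ v ∈ V, (∀ y ∈ nilFiltration B H f l j, B f ⁅y, v⁆ = 0) →
        ∀ ξ ∈ partialSlice (B f) (l ⊔ grGE H 2) H e j, ξ v = -B f v := by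
      intro v hv hvn ξ hξ
      cases j with
      | zero =>
        refine hξ.1 v (Submodule.mem_sup_left (hperp v ?_ fun y hy =>
          hvn y (Submodule.mem_sup_left hy)))
        simpa using hVgr v hv
      | succ j =>
        obtain ⟨z, hz, rfl⟩ := (hV v).mp hv
        have hz0 : z = 0 := by
          refine eq_zero_of_form_right hBinv hB hBsymm hgood.iSup_gr hz fun y hy => ?_
          rw [neg_neg] at hy
          obtain ⟨y', hy', rfl⟩ := ht.exists_lie_lie_eq hgood (by omega) hy
          have := hvn y' (gr_le_grGE H (by push_cast; omega) hy')
          rw [hform] at this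
          exact neg_eq_zero.mp this
        rw [hz0, lie_zero, map_zero, map_zero, neg_zero]
    have hlie : ∀ x ∈ nilFiltration B H f l j, ∀ y ∈ nilFiltration B H f l j,
        ⁅x, y⁆ ∈ nilFiltration B H f l (j + 1) := fun x hx y hy =>
      lie_mem_grGE_of_le (nilFiltration_le j hx) (nilFiltration_le j hy) (by omega)
    rw [hset]
    refine ⟨hst.inter hnil (nilFiltration_succ_le j) _ fun ξ hξ y hy v hv => ?_,
      hred.trans (Reduces.of_pairing hnil (nilFiltration_succ_le j) hlie hst (B f) V hχ h0 hleft
        hright)⟩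
    rw [hχ ξ hξ y (nilFiltration_succ_le j hy) v hv, h0 y hy v hv, neg_zero]

/-- The Slodowy slice is a reduction of `-χ + 𝔪^⊥`. -/
theorem reduces_slodowySlice :
    Reduces (omegaPerp B H f l ⊔ grGE H 2) (affineFiber (B f) (l ⊔ grGE H 2)) ⊥
      (slodowySlice (B f) e) := by
  obtain ⟨K, hK⟩ := exists_grGE_eq_bot H
  have hred := (reduces_partialSlice hB hBsymm hBinv hgood hl ht hperp (K + 1)).2
  have h1 : nilFiltration B H f l (K + 1) = ⊥ := by
    rw [eq_bot_iff, ← hK]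
    exact grGE_anti H (by omega)
  have h2 : partialSlice (B f) (l ⊔ grGE H 2) H e (K + 1) = slodowySlice (B f) e := by
    ext ξ
    constructor
    · intro hξ
      refine ⟨ξ + B f, fun y => ?_, by abel⟩
      have : (⊤ : Submodule ℂ g) ≤
          LinearMap.ker ((ξ + B f) ∘ₗ (LieAlgebra.ad ℂ g e : Module.End ℂ g)) := by
        rw [← hgood.iSup_gr]
        refine iSup_le fun δ y hy => ?_
        change (ξ + B f) ⁅e, y⁆ = 0
        -- For `δ ≥ 0` the bracket lies in degrees `≥ 2`, where `ξ` is fixed by `𝔪`. Negative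
        -- degrees are the constraints of the stages, except very negative ones, which are zero by
        -- duality with degrees `≥ K`.
        rcases lt_or_ge δ 0 with hδ | hδ
        · obtain ⟨i, rfl⟩ : ∃ i : ℕ, δ = -((i : ℤ) + 1) := ⟨(-δ - 1).toNat, by omega⟩
          by_cases hi : i < K + 1
          · rw [LinearMap.add_apply, hξ.2 i hi y hy, neg_add_cancel]
          · have : y = 0 := eq_zero_of_form_left hBinv hB hgood.iSup_gr hy fun z hz => by
              have hz' : z ∈ grGE H K := gr_le_grGE H (by omega) hz
              rw [hK, Submodule.mem_bot] at hz'
              rw [hz', map_zero]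
            rw [this, lie_zero, map_zero]
        · have hmem : ⁅e, y⁆ ∈ grGE H 2 := gr_le_grGE H (by omega) (lie_mem_gr ht.e_mem hy)
          rw [LinearMap.add_apply, hξ.1 _ (Submodule.mem_sup_right hmem), neg_add_cancel]
      have h3 : (ξ + B f) ⁅e, y⁆ = 0 := this (Submodule.mem_top (x := y))
      rw [← lie_skew, map_neg, h3, neg_zero]
    · rintro ⟨η, hη, rfl⟩
      have hη' : ∀ y, η ⁅e, y⁆ = 0 := fun y => by rw [← lie_skew, map_neg, hη, neg_zero]
      -- Surjectivity of `ad e ∘ ad f` puts all positive degrees inside `[e, 𝔤]`, so `η` kills `𝔪`.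
      have hker : grGE H 1 ≤ LinearMap.ker η := by
        refine iSup₂_le fun δ hδ w hw => ?_
        obtain ⟨y, -, rfl⟩ := ht.exists_lie_lie_eq hgood hδ hw
        exact hη' _
      refine ⟨fun w hw => ?_, fun i _ z _ => by simp [hη']⟩
      have hw' : w ∈ grGE H 1 := omegaPerp_sup_le B H f l (sup_le_sup_right hl _ hw)
      rw [LinearMap.add_apply, LinearMap.mem_ker.mp (hker hw'), add_zero, LinearMap.neg_apply]
  rwa [h1, h2] at hred

end Slice

end SlodowyReduction

/-! ### Coadjoint orbits inside affine subspaces. -/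

namespace SlodowyReduction

variable {g : Type*} [LieRing g] [LieAlgebra ℂ g]

theorem ExpStable.comp_mem {n : AdNilpotentSubalgebra g} {X : Set (Module.Dual ℂ g)}
    (hX : ExpStable n.toLieSubalgebra.toSubmodule X) {φ : g ≃ₗ[ℂ] g}
    (hφ : φ ∈ n.unipotentGroup) :
    ∀ ξ ∈ X, ξ ∘ₗ (φ : g →ₗ[ℂ] g) ∈ X ∧ ξ ∘ₗ ((φ⁻¹ : g ≃ₗ[ℂ] g) : g →ₗ[ℂ] g) ∈ X := by
  induction hφ using Subgroup.closure_induction with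
  | mem φ h =>
    obtain ⟨x, hx, hφ⟩ := h
    intro ξ hξ
    refine ⟨hφ ▸ hX x hx ξ hξ, ?_⟩
    have h1 : ((φ⁻¹ : g ≃ₗ[ℂ] g) : g →ₗ[ℂ] g) = expAd (-x) := by
      ext y
      apply φ.injective
      have h2 : φ (expAd (-x) y) = y :=
        (DFunLike.congr_fun hφ _).trans
          (DFunLike.congr_fun (expAd_comp_neg (n.isNilpotent_ad x hx)) y)
      rw [h2]
      exact φ.apply_symm_apply y
    rw [h1]
    exact hX _ (neg_mem hx) ξ hξ
  | one => exact fun ξ hξ => ⟨hξ, hξ⟩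
  | mul φ ψ _ _ h1 h2 =>
    intro ξ hξ
    refine ⟨(h2 _ (h1 ξ hξ).1).1, ?_⟩
    rw [mul_inv_rev]
    exact (h1 _ (h2 ξ hξ).2).2
  | inv φ _ h =>
    intro ξ hξ
    rw [inv_inv]
    exact (h ξ hξ).symm

/-- The affine subspace contains `-χ` and is stable under the group, so it contains the orbit of
`-χ`; membership depends only on the restriction to `m ≤ n`. -/
theorem fiber_subset_affineFiber (n : AdNilpotentSubalgebra g) (χ : Module.Dual ℂ g)
    {m : Submodule ℂ g} (hm : m ≤ n.toLieSubalgebra.toSubmodule)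
    (h : ∀ x ∈ n.toLieSubalgebra.toSubmodule, ∀ w ∈ m, ⁅x, w⁆ ∈ m ∧ χ ⁅x, w⁆ = 0) :
    n.fiber χ ⊆ affineFiber χ m := by
  intro ξ hξ w hw
  obtain ⟨φ, hφ, hξφ⟩ := (n.mem_fiber_iff χ).mp hξ
  have := ((expStable_affineFiber n.adNilpotent h).comp_mem hφ (-χ)
    (fun w _ => LinearMap.neg_apply χ w)).1 w hw
  rw [hξφ w (hm hw), ← this]
  rfl

theorem ExpInvariant.lift_comp (n : AdNilpotentSubalgebra g) (χ : Module.Dual ℂ g)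
    {F : SymmetricAlgebra ℂ g}
    (hF : ExpInvariant n.toLieSubalgebra.toSubmodule (n.fiber χ) F) {φ : g ≃ₗ[ℂ] g}
    (hφ : φ ∈ n.unipotentGroup) {ξ : Module.Dual ℂ g} (hξ : ξ ∈ n.fiber χ) :
    SymmetricAlgebra.lift (ξ ∘ₗ (φ : g →ₗ[ℂ] g)) F = SymmetricAlgebra.lift ξ F := by
  have := (n.mem_invariantLifts_iff χ).mpr hF φ hφ
  rw [n.fiberIdeal_eq, mem_vanishingIdeal] at this
  have := this ξ hξ
  rwa [map_sub, lift_symMap, sub_eq_zero] at this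

/-! ## Pairs of gradings -/

section Commuting

variable [FiniteDimensional ℂ g]

theorem le_iSup_inf_gr {H : g} (hH : ⨆ δ : ℤ, gr H δ = ⊤) {p : Submodule ℂ g}
    (hp : ∀ x ∈ p, ⁅H, x⁆ ∈ p) : p ≤ ⨆ δ : ℤ, p ⊓ gr H δ := by
  have hle : ⨆ δ : ℤ, gr H δ ≤
      ⨆ μ : ℂ, Module.End.genEigenspace (LieAlgebra.ad ℂ g H : Module.End ℂ g) μ 1 :=
    iSup_le fun δ => le_iSup (fun μ : ℂ =>
      Module.End.genEigenspace (LieAlgebra.ad ℂ g H : Module.End ℂ g) μ 1) (δ : ℂ)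
  have h := Submodule.inf_iSup_genEigenspace (p := p)
    (f := (LieAlgebra.ad ℂ g H : Module.End ℂ g)) hp 1
  rw [hH, top_le_iff] at hle
  rw [hle, inf_top_eq] at h
  refine h.le.trans (iSup_le fun μ => ?_)
  by_cases hμ : ∃ δ : ℤ, (δ : ℂ) = μ
  · obtain ⟨δ, rfl⟩ := hμ
    exact le_iSup (fun δ : ℤ => p ⊓ gr H δ) δ
  -- A non-integral `μ` has zero eigenspace, since it is independent of the integral ones, which
  -- already span.
  · push Not at hμ
    have hind := Module.End.eigenspaces_iSupIndep (LieAlgebra.ad ℂ g H : Module.End ℂ g) μ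
    have htop : (⊤ : Submodule ℂ g) ≤ ⨆ (ν : ℂ) (_ : ν ≠ μ),
        Module.End.eigenspace (LieAlgebra.ad ℂ g H : Module.End ℂ g) ν := by
      rw [← hH]
      exact iSup_le fun δ => le_iSup₂_of_le (δ : ℂ) (hμ δ) le_rfl
    have hbot := hind.mono_right htop
    rw [disjoint_top] at hbot
    exact inf_le_right.trans (hbot.le.trans bot_le)

/-- A Cartan subalgebra is nilpotent, so some power of `ad H₁` kills `H₂`; since `ad H₁` is
diagonalisable, `ad H₁` itself does. -/
theorem lie_eq_zero_of_mem_cartan (h : LieSubalgebra ℂ g) [h.IsCartanSubalgebra] {H₁ H₂ : g}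
    (hH₁ : H₁ ∈ h) (hH₂ : H₂ ∈ h) (hgr : ⨆ δ : ℤ, gr H₁ δ = ⊤) : ⁅H₁, H₂⁆ = 0 := by
  obtain ⟨k, hk⟩ := LieModule.isNilpotent_toEnd_of_isNilpotent ℂ h h (⟨H₁, hH₁⟩ : h)
  have hpow : ∀ (j : ℕ) (y : h), ((LieAlgebra.ad ℂ g H₁ ^ j) (y : g)) =
      ((LieAlgebra.ad ℂ h (⟨H₁, hH₁⟩ : h) ^ j) y : h) := by
    intro j y
    induction j with
    | zero => rfl
    | succ j ih =>
      rw [pow_succ', pow_succ', Module.End.mul_apply, Module.End.mul_apply, ih]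
      rfl
  let p : Submodule ℂ g := LinearMap.ker (LieAlgebra.ad ℂ g H₁ ^ k)
  have hp : p ≤ gr H₁ 0 := by
    refine (le_iSup_inf_gr hgr fun x hx => ?_).trans (iSup_le fun δ x hx => ?_)
    · rw [LinearMap.mem_ker] at hx ⊢
      rw [← LieAlgebra.ad_apply (R := ℂ), ← Module.End.mul_apply, ← pow_succ, pow_succ',
        Module.End.mul_apply, hx, map_zero]
    · have hx1 : ∀ j : ℕ, (LieAlgebra.ad ℂ g H₁ ^ j) x = ((δ : ℂ) ^ j) • x := by
        intro j
        induction j with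
        | zero => simp
        | succ j ih =>
          rw [pow_succ', Module.End.mul_apply, ih, map_smul, LieAlgebra.ad_apply,
            mem_gr.mp hx.2, smul_smul, pow_succ]
      have h1 := LinearMap.mem_ker.mp hx.1
      rw [hx1, smul_eq_zero] at h1
      rcases h1 with h1 | h1
      · have : δ = 0 := by exact_mod_cast eq_zero_of_pow_eq_zero h1
        exact this ▸ hx.2
      · rw [h1]
        exact zero_mem _
  have h2 : H₂ ∈ p := by
    rw [LinearMap.mem_ker, hpow k ⟨H₂, hH₂⟩]
    exact congrArg Subtype.val (DFunLike.congr_fun hk (⟨H₂, hH₂⟩ : h))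
  have := mem_gr.mp (hp h2)
  rwa [Int.cast_zero, zero_smul] at this

end Commuting

/-! ### Bidegrees and the pairing `(f₂ | [x, y])`. -/

theorem form_eq_add_form_sub (B : LinearMap.BilinForm ℂ g) (f₁ f₂ y : g) :
    B f₂ y = B f₁ y + B (f₂ - f₁) y := by
  rw [map_sub, LinearMap.sub_apply]; ring

theorem form_lie_swap (B : LinearMap.BilinForm ℂ g) (f x y : g) : B f ⁅x, y⁆ = -B f ⁅y, x⁆ := by
  rw [← lie_skew, map_neg]

/-- Two commuting good gradings satisfying the compatibility conditions, and a nondegenerate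
symmetric invariant form. -/
structure CompatibleGradings (B : LinearMap.BilinForm ℂ g) (H₁ H₂ f₁ f₂ : g) : Prop where
  nondegenerate : B.Nondegenerate
  symm : B.IsSymm
  inv : B.lieInvariant g
  good₁ : IsGoodGrading H₁ f₁
  good₂ : IsGoodGrading H₂ f₂
  star : StarConditions H₁ H₂ f₁ f₂
  comm : ⁅H₁, H₂⁆ = 0

theorem lie_mem_bigr {H₁ H₂ x y : g} {i j k l a b : ℤ} (hx : x ∈ bigr H₁ H₂ i j)
    (hy : y ∈ bigr H₁ H₂ k l) (ha : i + k = a) (hb : j + l = b) : ⁅x, y⁆ ∈ bigr H₁ H₂ a b :=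
  ⟨lie_mem_gr_of_eq hx.1 hy.1 ha, lie_mem_gr_of_eq hx.2 hy.2 hb⟩

namespace CompatibleGradings

variable {B : LinearMap.BilinForm ℂ g} {H₁ H₂ f₁ f₂ : g}
  (hS : CompatibleGradings B H₁ H₂ f₁ f₂)

include hS

theorem gr_le_iSup_bigr [FiniteDimensional ℂ g] (i : ℤ) :
    gr H₁ i ≤ ⨆ j : ℤ, bigr H₁ H₂ i j := by
  refine le_iSup_inf_gr hS.good₂.iSup_gr fun x hx => ?_
  have h2 : H₂ ∈ gr H₁ 0 := mem_gr.mpr (by rw [hS.comm, Int.cast_zero, zero_smul])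
  exact lie_mem_gr_of_eq h2 hx (zero_add i)

theorem gr_le_iSup_bigr' [FiniteDimensional ℂ g] (j : ℤ) :
    gr H₂ j ≤ ⨆ i : ℤ, bigr H₁ H₂ i j := by
  have h1 : H₁ ∈ gr H₂ 0 := mem_gr.mpr (by
    rw [← lie_skew, hS.comm, neg_zero, Int.cast_zero, zero_smul])
  refine (le_iSup_inf_gr hS.good₁.iSup_gr fun x hx =>
    lie_mem_gr_of_eq h1 hx (zero_add j)).trans (iSup_mono fun i => ?_)
  exact (inf_comm _ _).le

/-- The four regions are the four inclusions of (★), read off on bidegrees by independence of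
eigenspaces. They turn many later inclusions into arithmetic of bidegrees. -/
theorem bigr_eq_bot {i j : ℤ}
    (h : (2 ≤ i ∧ j < 1) ∨ (1 ≤ j ∧ i < 0) ∨ (i = 1 ∧ (j < 0 ∨ 2 < j)) ∨
      (j = 1 ∧ (i < 0 ∨ 2 < i))) : bigr H₁ H₂ i j = ⊥ := by
  rw [eq_bot_iff]
  intro x hx
  rw [Submodule.mem_bot]
  rcases h with ⟨hi, hj⟩ | ⟨hj, hi⟩ | ⟨rfl, hj⟩ | ⟨rfl, hi⟩
  · exact eq_zero_of_mem_gr_of_mem_grGE hj hx.2 (hS.star.ge_two_le (gr_le_grGE H₁ hi hx.1))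
  · exact eq_zero_of_mem_gr_of_mem_grGE hi hx.1 (hS.star.ge_one_le (gr_le_grGE H₂ hj hx.2))
  · have h1 : ⨆ δ ∈ Finset.Icc (0 : ℤ) 2, bigr H₁ H₂ 1 δ ≤ ⨆ (δ : ℤ) (_ : δ ≠ j), gr H₂ δ :=
      iSup₂_le fun δ hδ => le_iSup₂_of_le δ (by rw [Finset.mem_Icc] at hδ; omega) inf_le_right
    exact Submodule.disjoint_def.mp (iSupIndep_gr H₂ j) x hx.2 (h1 (hS.star.gr_one_le hx.1))
  · have h1 : ⨆ δ ∈ Finset.Icc (0 : ℤ) 2, bigr H₁ H₂ δ 1 ≤ ⨆ (δ : ℤ) (_ : δ ≠ i), gr H₁ δ :=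
      iSup₂_le fun δ hδ => le_iSup₂_of_le δ (by rw [Finset.mem_Icc] at hδ; omega) inf_le_left
    exact Submodule.disjoint_def.mp (iSupIndep_gr H₁ i) x hx.1 (h1 (hS.star.gr_one_le' hx.2))

theorem f₁_mem : f₁ ∈ bigr H₁ H₂ (-2) (-2) := by
  refine ⟨hS.good₁.mem, ?_⟩
  have := sub_mem hS.good₂.mem hS.star.sub_mem.2
  rwa [sub_sub_cancel] at this

theorem form_f₂_eq_zero_of_gr {y : g} {i : ℤ} (hy : y ∈ gr H₁ i) (h0 : i ≠ 0) (h2 : i ≠ 2) :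
    B f₂ y = 0 := by
  rw [form_eq_add_form_sub B f₁ f₂, form_eq_zero hS.inv (by omega) hS.good₁.mem hy,
    form_eq_zero hS.inv (by omega) hS.star.sub_mem.1 hy, add_zero]

theorem form_f₂_eq_zero_of_gr' {y : g} {j : ℤ} (hy : y ∈ gr H₂ j) (h2 : j ≠ 2) : B f₂ y = 0 :=
  form_eq_zero hS.inv (by omega) hS.good₂.mem hy

/-- As `f₂` lies in `𝔤_{-2,-2} + 𝔤_{0,-2}`, the form `(f₂ | •)` sees only the bidegrees `(2, 2)` and
`(0, 2)`. -/
theorem form_f₂_eq_zero {y : g} {i j : ℤ} (hy : y ∈ bigr H₁ H₂ i j)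
    (h : j ≠ 2 ∨ (i ≠ 0 ∧ i ≠ 2)) : B f₂ y = 0 := by
  rcases h with h | h
  · exact hS.form_f₂_eq_zero_of_gr' hy.2 h
  · exact hS.form_f₂_eq_zero_of_gr hy.1 h.1 h.2

theorem form_f₂_eq_zero_of_grGE {y : g} (hy : y ∈ grGE H₁ 3) : B f₂ y = 0 := by
  have : grGE H₁ 3 ≤ LinearMap.ker (B f₂) :=
    iSup₂_le fun δ hδ y hy => hS.form_f₂_eq_zero_of_gr hy (by omega) (by omega)
  exact this hy

theorem form_f₂_of_gr_two {y : g} (hy : y ∈ gr H₁ 2) : B f₂ y = B f₁ y := by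
  rw [form_eq_add_form_sub B f₁ f₂, form_eq_zero hS.inv (by norm_num) hS.star.sub_mem.1 hy, add_zero]

/-- `f₀` has first degree `0`, hence is orthogonal to `𝔤^{(1)}_2`. There `f₂` may be replaced by
`f₁`, whose goodness for the first grading then applies. -/
theorem form_f₂_lie_of_gr_two {x y : g} (hxy : ⁅x, y⁆ ∈ gr H₁ 2) :
    B f₂ ⁅x, y⁆ = B ⁅f₁, x⁆ y := by
  rw [hS.form_f₂_of_gr_two hxy, form_lie_left hS.inv]

variable [FiniteDimensional ℂ g]

theorem eq_zero_of_form_bigr {x : g} {i j : ℤ} (hx : x ∈ bigr H₁ H₂ i j)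
    (h : ∀ y ∈ bigr H₁ H₂ (-i) (-j), B x y = 0) : x = 0 := by
  refine eq_zero_of_form_left hS.inv hS.nondegenerate hS.good₁.iSup_gr hx.1 fun y hy => ?_
  have : gr H₁ (-i) ≤ LinearMap.ker (B x) := by
    refine (hS.gr_le_iSup_bigr (-i)).trans (iSup_le fun l y hy => ?_)
    by_cases hl : l = -j
    · exact h y (hl ▸ hy)
    · exact form_eq_zero hS.inv (by omega) hx.2 hy.2
  exact this hy

/-- On `𝔤^{(1)}_1` the pairing is that of `f₁`, nondegenerate because `ad f₁` is injective, and it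
respects the second degree. In particular `𝔤_{1,0}` is dual to `𝔤_{1,2}`, and `𝔤_{1,1}` is
symplectic. -/
theorem eq_zero_of_form_lie {x : g} {j : ℤ} (hx : x ∈ bigr H₁ H₂ 1 j)
    (h : ∀ y ∈ bigr H₁ H₂ 1 (2 - j), B f₂ ⁅x, y⁆ = 0) : x = 0 := by
  refine hS.good₁.injective 1 le_rfl x hx.1 (hS.eq_zero_of_form_bigr
    (lie_mem_bigr hS.f₁_mem hx (a := -1) (b := j - 2) (by ring) (by ring)) fun y hy => ?_)
  have hy' : y ∈ bigr H₁ H₂ 1 (2 - j) := by simpa using hy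
  rw [← h y hy', hS.form_f₂_lie_of_gr_two]
  exact lie_mem_gr_of_eq hx.1 hy'.1 (by norm_num)

omit [FiniteDimensional ℂ g] in
theorem exists_eq_add_of_gr {x : g} (hx : x ∈ gr H₁ 1) : ∃ x₀ ∈ bigr H₁ H₂ 1 0,
    ∃ x₁ ∈ bigr H₁ H₂ 1 1, ∃ x₂ ∈ bigr H₁ H₂ 1 2, x = x₀ + x₁ + x₂ := by
  have : gr H₁ 1 ≤ bigr H₁ H₂ 1 0 ⊔ bigr H₁ H₂ 1 1 ⊔ bigr H₁ H₂ 1 2 := by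
    refine hS.star.gr_one_le.trans (iSup₂_le fun δ hδ => ?_)
    rw [Finset.mem_Icc] at hδ
    obtain rfl | rfl | rfl : δ = 0 ∨ δ = 1 ∨ δ = 2 := by omega
    · exact le_sup_left.trans le_sup_left
    · exact le_sup_right.trans le_sup_left
    · exact le_sup_right
  obtain ⟨y, hy, x₂, hx₂, rfl⟩ := Submodule.mem_sup.mp (this hx)
  obtain ⟨x₀, hx₀, x₁, hx₁, rfl⟩ := Submodule.mem_sup.mp hy
  exact ⟨x₀, hx₀, x₁, hx₁, x₂, hx₂, rfl⟩

omit [FiniteDimensional ℂ g] in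
theorem exists_eq_add_of_gr' {x : g} (hx : x ∈ gr H₂ 1) : ∃ x₀ ∈ bigr H₁ H₂ 0 1,
    ∃ x₁ ∈ bigr H₁ H₂ 1 1, ∃ x₂ ∈ bigr H₁ H₂ 2 1, x = x₀ + x₁ + x₂ := by
  have : gr H₂ 1 ≤ bigr H₁ H₂ 0 1 ⊔ bigr H₁ H₂ 1 1 ⊔ bigr H₁ H₂ 2 1 := by
    refine hS.star.gr_one_le'.trans (iSup₂_le fun δ hδ => ?_)
    rw [Finset.mem_Icc] at hδ
    obtain rfl | rfl | rfl : δ = 0 ∨ δ = 1 ∨ δ = 2 := by omega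
    · exact le_sup_left.trans le_sup_left
    · exact le_sup_right.trans le_sup_left
    · exact le_sup_right
  obtain ⟨y, hy, x₂, hx₂, rfl⟩ := Submodule.mem_sup.mp (this hx)
  obtain ⟨x₀, hx₀, x₁, hx₁, rfl⟩ := Submodule.mem_sup.mp hy
  exact ⟨x₀, hx₀, x₁, hx₁, x₂, hx₂, rfl⟩

/-- Every linear form on `𝔤^{(1)}_1` that vanishes on `𝔤_{1,2}` is of the form `(f₂ | [x, •])` with
`x ∈ 𝔤_{1,1} ⊕ 𝔤_{1,2}`. -/
theorem exists_form_lie_eq (ζ : Module.Dual ℂ g) (hζ : ∀ y ∈ bigr H₁ H₂ 1 2, ζ y = 0) :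
    ∃ x ∈ bigr H₁ H₂ 1 1 ⊔ bigr H₁ H₂ 1 2, ∀ y ∈ gr H₁ 1, B f₂ ⁅x, y⁆ = ζ y := by
  let T : gr H₁ 1 →ₗ[ℂ] Module.Dual ℂ (gr H₁ 1) :=
    { toFun := fun x => B f₂ ∘ₗ (LieAlgebra.ad ℂ g (x : g) : Module.End ℂ g) ∘ₗ (gr H₁ 1).subtype
      map_add' := fun x y => by ext z; simp
      map_smul' := fun c x => by ext z; simp }
  have hT : ∀ x y, T x y = B f₂ ⁅(x : g), (y : g)⁆ := fun _ _ => rfl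
  have hinj : Function.Injective T := by
    rw [injective_iff_map_eq_zero]
    rintro ⟨x, hx⟩ h
    refine Subtype.ext (hS.good₁.injective 1 le_rfl x hx ?_)
    refine eq_zero_of_form_left hS.inv hS.nondegenerate hS.good₁.iSup_gr
      (lie_mem_gr_of_eq hS.good₁.mem hx (k := -1) (by norm_num)) fun y hy => ?_
    rw [neg_neg] at hy
    rw [← hS.form_f₂_lie_of_gr_two (lie_mem_gr_of_eq hx hy (by norm_num))]
    exact DFunLike.congr_fun h ⟨y, hy⟩
  obtain ⟨⟨x, hx⟩, hxT⟩ := (LinearMap.injective_iff_surjective_of_finrank_eq_finrank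
    (Subspace.dual_finrank_eq (K := ℂ)).symm).mp hinj (ζ ∘ₗ (gr H₁ 1).subtype)
  have hxζ : ∀ y ∈ gr H₁ 1, B f₂ ⁅x, y⁆ = ζ y := fun y hy => DFunLike.congr_fun hxT ⟨y, hy⟩
  obtain ⟨x₀, hx₀, x₁, hx₁, x₂, hx₂, rfl⟩ := hS.exists_eq_add_of_gr hx
  -- The component in `𝔤_{1,0}` is detected by `𝔤_{1,2}`, where `ζ` vanishes.
  have hz : x₀ = 0 := by
    refine hS.eq_zero_of_form_lie hx₀ fun y hy => ?_
    rw [sub_zero] at hy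
    have h1 := hxζ y hy.1
    rw [hζ y hy, add_lie, add_lie, map_add, map_add,
      hS.form_f₂_eq_zero (lie_mem_bigr hx₁ hy rfl rfl) (Or.inl (by norm_num)),
      hS.form_f₂_eq_zero (lie_mem_bigr hx₂ hy rfl rfl) (Or.inl (by norm_num)), add_zero,
      add_zero] at h1
    exact h1
  refine ⟨x₁ + x₂, add_mem (Submodule.mem_sup_left hx₁) (Submodule.mem_sup_right hx₂), ?_⟩
  rwa [hz, zero_add] at hxζ

/-! ## The Lagrangian subspace -/

omit [FiniteDimensional ℂ g] in
theorem form_lie_eq_zero_of_two_one {x y : g} (hx : x ∈ bigr H₁ H₂ 2 1)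
    (hy : y ∈ bigr H₁ H₂ 2 1) : B f₂ ⁅x, y⁆ = 0 :=
  hS.form_f₂_eq_zero (lie_mem_bigr hx hy rfl rfl) (Or.inr (by norm_num))

/-- `𝔤_{2,1}` is isotropic and its orthogonal in `𝔤_{0,1}` is the kernel of `ad f₁`. Take `𝔞`
maximal isotropic in this kernel. If `x₀ + x₂` is orthogonal to `𝔞 ⊕ 𝔤_{2,1}`, then `x₀` lies in the
kernel and is orthogonal to `𝔞`, so maximality puts it in `𝔞`. -/
theorem exists_isLagrangianChoice : ∃ a : Submodule ℂ g, IsLagrangianChoice B H₁ H₂ f₁ f₂ a := by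
  let P : Set (Submodule ℂ g) := {a | a ≤ bigr H₁ H₂ 0 1 ∧ (∀ x ∈ a, ⁅f₁, x⁆ = 0) ∧
    ∀ x ∈ a, ∀ y ∈ a, B f₂ ⁅x, y⁆ = 0}
  obtain ⟨a, ⟨ha1, ha2, ha3⟩, hmax⟩ := WellFounded.has_min
    (wellFounded_gt (α := Submodule ℂ g)) P ⟨⊥, bot_le, by simp, by simp⟩
  have hcross : ∀ x ∈ bigr H₁ H₂ 0 1, ⁅f₁, x⁆ = 0 → ∀ y ∈ bigr H₁ H₂ 2 1,
      B f₂ ⁅x, y⁆ = 0 := by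
    intro x hx hfx y hy
    rw [hS.form_f₂_lie_of_gr_two (lie_mem_gr_of_eq hx.1 hy.1 (by norm_num)), hfx, map_zero,
      LinearMap.zero_apply]
  refine ⟨a, ha1, ha2, fun x hx => ⟨fun hxa y hya => ?_, fun h => ?_⟩⟩
  · obtain ⟨x₀, hx₀, x₂, hx₂, rfl⟩ := Submodule.mem_sup.mp hxa
    obtain ⟨y₀, hy₀, y₂, hy₂, rfl⟩ := Submodule.mem_sup.mp hya
    simp only [add_lie, lie_add, map_add]
    rw [ha3 x₀ hx₀ y₀ hy₀, hcross x₀ (ha1 hx₀) (ha2 x₀ hx₀) y₂ hy₂, form_lie_swap B f₂ x₂ y₀,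
      hcross y₀ (ha1 hy₀) (ha2 y₀ hy₀) x₂ hx₂, hS.form_lie_eq_zero_of_two_one hx₂ hy₂]
    simp
  · obtain ⟨x₀, hx₀, x₂, hx₂, rfl⟩ := Submodule.mem_sup.mp hx
    have hf : ⁅f₁, x₀⁆ = 0 := by
      refine hS.eq_zero_of_form_bigr (lie_mem_bigr hS.f₁_mem hx₀ (a := -2) (b := -1)
        (by norm_num) (by norm_num)) fun y hy => ?_
      rw [neg_neg, neg_neg] at hy
      have h1 := h y (Submodule.mem_sup_right hy)
      rw [add_lie, map_add, hS.form_lie_eq_zero_of_two_one hx₂ hy, add_zero] at h1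
      rw [← h1, hS.form_f₂_lie_of_gr_two (lie_mem_gr_of_eq hx₀.1 hy.1 (by norm_num))]
    have hx₀a : ∀ y ∈ a, B f₂ ⁅x₀, y⁆ = 0 := by
      intro y hy
      have h1 := h y (Submodule.mem_sup_left hy)
      rwa [add_lie, map_add, form_lie_swap B f₂ x₂ y, hcross y (ha1 hy) (ha2 y hy) x₂ hx₂,
        neg_zero, add_zero] at h1
    have hmem : a ⊔ Submodule.span ℂ {x₀} ∈ P := by
      refine ⟨sup_le ha1 ((Submodule.span_singleton_le_iff_mem _ _).mpr hx₀), ?_, ?_⟩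
      · intro x hx
        obtain ⟨y, hy, z, hz, rfl⟩ := Submodule.mem_sup.mp hx
        obtain ⟨s, rfl⟩ := Submodule.mem_span_singleton.mp hz
        rw [lie_add, lie_smul, ha2 y hy, hf]
        simp
      · intro x hx x' hx'
        obtain ⟨y, hy, z, hz, rfl⟩ := Submodule.mem_sup.mp hx
        obtain ⟨s, rfl⟩ := Submodule.mem_span_singleton.mp hz
        obtain ⟨y', hy', z', hz', rfl⟩ := Submodule.mem_sup.mp hx'
        obtain ⟨s', rfl⟩ := Submodule.mem_span_singleton.mp hz'
        simp only [add_lie, lie_add, smul_lie, lie_smul, map_add, map_smul, lie_self]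
        rw [ha3 y hy y' hy', hx₀a y' hy', form_lie_swap B f₂ y x₀, hx₀a y hy]
        simp
    have hle : a ⊔ Submodule.span ℂ {x₀} ≤ a := by
      by_contra hcon
      exact hmax _ hmem (lt_of_le_not_ge le_sup_left hcon)
    exact add_mem (Submodule.mem_sup_left (hle (Submodule.mem_sup_right
      (Submodule.mem_span_singleton_self x₀)))) (Submodule.mem_sup_right hx₂)

end CompatibleGradings

end SlodowyReduction

/-! ### The bidegrees of `𝔫₂`, `𝔪₂` and `𝔫̃₂`. -/

namespace SlodowyReduction

variable {g : Type*} [LieRing g] [LieAlgebra ℂ g]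

/-- The submodule of the `x` with `[x, y] ∈ W` for all `y ∈ A`. -/
def lieColon (A W : Submodule ℂ g) : Submodule ℂ g where
  carrier := {x | ∀ y ∈ A, ⁅x, y⁆ ∈ W}
  add_mem' := fun hx hx' y hy => by rw [add_lie]; exact add_mem (hx y hy) (hx' y hy)
  zero_mem' := fun y _ => by rw [zero_lie]; exact zero_mem _
  smul_mem' := fun c x hx y hy => by rw [smul_lie]; exact W.smul_mem c (hx y hy)

/-- The subspace `𝔩₂ = 𝔞 ⊕ 𝔤_{2,1}`. -/
abbrev lTwo (H₁ H₂ : g) (a : Submodule ℂ g) : Submodule ℂ g := a ⊔ bigr H₁ H₂ 2 1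

/-- The underlying subspace of `𝔫₂`. -/
abbrev nTwoSub (B : LinearMap.BilinForm ℂ g) (H₁ H₂ f₂ : g) (a : Submodule ℂ g) :
    Submodule ℂ g :=
  omegaPerp B H₂ f₂ (lTwo H₁ H₂ a) ⊔ grGE H₂ 2

/-- The subspace `𝔪₂ = 𝔩₂ ⊕ 𝔤^{(2)}_{≥ 2}`. -/
abbrev mTwo (H₁ H₂ : g) (a : Submodule ℂ g) : Submodule ℂ g := lTwo H₁ H₂ a ⊔ grGE H₂ 2

/-- The underlying subspace of `𝔫̃₂`. -/
abbrev nTildeSub (H₁ H₂ : g) (a : Submodule ℂ g) : Submodule ℂ g := grGE H₁ 1 ⊔ nZero H₁ H₂ a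

namespace IsLagrangianChoice

variable {B : LinearMap.BilinForm ℂ g} {H₁ H₂ f₁ f₂ : g} {a : Submodule ℂ g}
  (hL : IsLagrangianChoice B H₁ H₂ f₁ f₂ a) (hS : CompatibleGradings B H₁ H₂ f₁ f₂)

include hL

theorem form_eq_zero {x y : g} (hx : x ∈ lTwo H₁ H₂ a) (hy : y ∈ lTwo H₁ H₂ a) :
    B f₂ ⁅x, y⁆ = 0 :=
  (hL.lagrangian x (sup_le_sup_right hL.le_bigr _ hx)).mp hx y hy

theorem lTwo_le_gr : lTwo H₁ H₂ a ≤ gr H₂ 1 :=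
  sup_le (hL.le_bigr.trans inf_le_right) inf_le_right

theorem lTwo_le_omegaPerp : lTwo H₁ H₂ a ≤ omegaPerp B H₂ f₂ (lTwo H₁ H₂ a) :=
  fun _ hx => ⟨hL.lTwo_le_gr hx, fun _ hy => hL.form_eq_zero hx hy⟩

theorem mTwo_le_nTwoSub : mTwo H₁ H₂ a ≤ nTwoSub B H₁ H₂ f₂ a :=
  sup_le_sup_right hL.lTwo_le_omegaPerp _

include hS

theorem form_one_one_eq_zero {x y : g} (hx : x ∈ bigr H₁ H₂ 1 1) (hy : y ∈ lTwo H₁ H₂ a) :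
    B f₂ ⁅x, y⁆ = 0 := by
  obtain ⟨y₀, hy₀, y₂, hy₂, rfl⟩ := Submodule.mem_sup.mp hy
  rw [lie_add, map_add, hS.form_f₂_eq_zero (lie_mem_bigr hx (hL.le_bigr hy₀) rfl rfl)
    (Or.inr (by norm_num)), hS.form_f₂_eq_zero (lie_mem_bigr hx hy₂ rfl rfl)
    (Or.inr (by norm_num)), add_zero]

theorem bigr_one_one_le : bigr H₁ H₂ 1 1 ≤ omegaPerp B H₂ f₂ (lTwo H₁ H₂ a) :=
  fun _ hx => ⟨hx.2, fun _ hy => hL.form_one_one_eq_zero hS hx hy⟩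

/-- The component in `𝔤_{1,1}` is automatically orthogonal to `𝔩₂`; the other two lie in the space
where `𝔩₂` is its own orthogonal. -/
theorem omegaPerp_le : omegaPerp B H₂ f₂ (lTwo H₁ H₂ a) ≤ lTwo H₁ H₂ a ⊔ bigr H₁ H₂ 1 1 := by
  rintro x ⟨hx, hxl⟩
  obtain ⟨x₀, hx₀, x₁, hx₁, x₂, hx₂, rfl⟩ := hS.exists_eq_add_of_gr' hx
  have h1 : x₀ + x₂ ∈ lTwo H₁ H₂ a := by
    refine (hL.lagrangian _ (add_mem (Submodule.mem_sup_left hx₀)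
      (Submodule.mem_sup_right hx₂))).mpr fun y hy => ?_
    have h2 := hxl y hy
    rw [add_lie, add_lie, map_add, map_add, hL.form_one_one_eq_zero hS hx₁ hy, add_zero] at h2
    rw [add_lie, map_add, h2]
  have h2 : x₀ + x₁ + x₂ = x₀ + x₂ + x₁ := by abel
  rw [h2]
  exact add_mem (Submodule.mem_sup_left h1) (Submodule.mem_sup_right hx₁)

variable [FiniteDimensional ℂ g]

/-- The double orthogonal of `𝔩₂`: the orthogonal contains the symplectic space `𝔤_{1,1}`, which
kills the middle component of `v`, and it contains `𝔩₂`, which is Lagrangian in the rest. The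
elimination of degree `1` needs this. -/
theorem mem_lTwo_of_perp {v : g} (hv : v ∈ gr H₂ 1)
    (h : ∀ y ∈ omegaPerp B H₂ f₂ (lTwo H₁ H₂ a), B f₂ ⁅y, v⁆ = 0) : v ∈ lTwo H₁ H₂ a := by
  obtain ⟨v₀, hv₀, v₁, hv₁, v₂, hv₂, rfl⟩ := hS.exists_eq_add_of_gr' hv
  have h1 : v₁ = 0 := by
    refine hS.eq_zero_of_form_lie hv₁ fun y hy => ?_
    have hy' : y ∈ bigr H₁ H₂ 1 1 := by simpa using hy
    have h2 := h y (hL.bigr_one_one_le hS hy')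
    rw [lie_add, lie_add, map_add, map_add,
      hS.form_f₂_eq_zero (lie_mem_bigr hy' hv₀ rfl rfl) (Or.inr (by norm_num)),
      hS.form_f₂_eq_zero (lie_mem_bigr hy' hv₂ rfl rfl) (Or.inr (by norm_num)), zero_add,
      add_zero] at h2
    rw [form_lie_swap, h2, neg_zero]
  subst h1
  rw [add_zero] at h ⊢
  refine (hL.lagrangian _ (add_mem (Submodule.mem_sup_left hv₀)
    (Submodule.mem_sup_right hv₂))).mpr fun y hy => ?_
  rw [form_lie_swap, h y (hL.lTwo_le_omegaPerp hy), neg_zero]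

omit [FiniteDimensional ℂ g] in
theorem bigr_le_nTwoSub {i j : ℤ} (h : 2 ≤ j ∨ (1 ≤ i ∧ 1 ≤ j) ∨ 2 ≤ i) :
    bigr H₁ H₂ i j ≤ nTwoSub B H₁ H₂ f₂ a := by
  by_cases hj : 2 ≤ j
  · exact inf_le_right.trans ((gr_le_grGE H₂ hj).trans le_sup_right)
  by_cases hbot : (2 ≤ i ∧ j < 1) ∨ (j = 1 ∧ 2 < i)
  · rw [hS.bigr_eq_bot (by omega)]
    exact bot_le
  obtain rfl : j = 1 := by omega
  obtain rfl | rfl : i = 1 ∨ i = 2 := by omega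
  · exact (hL.bigr_one_one_le hS).trans le_sup_left
  · exact (le_sup_right.trans hL.lTwo_le_omegaPerp).trans le_sup_left

omit [FiniteDimensional ℂ g] hL in
theorem bigr_le_mTwo {i j : ℤ} (h : 2 ≤ i ∨ 2 ≤ j) : bigr H₁ H₂ i j ≤ mTwo H₁ H₂ a := by
  by_cases hj : 2 ≤ j
  · exact inf_le_right.trans ((gr_le_grGE H₂ hj).trans le_sup_right)
  by_cases hbot : j < 1 ∨ 2 < i
  · rw [hS.bigr_eq_bot (by omega)]
    exact bot_le
  obtain ⟨rfl, rfl⟩ : i = 2 ∧ j = 1 := by omega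
  exact le_sup_right.trans le_sup_left

omit hL [FiniteDimensional ℂ g] hS in
theorem bigr_le_nTildeSub {i j : ℤ} (h : 1 ≤ i ∨ (i = 0 ∧ 2 ≤ j)) :
    bigr H₁ H₂ i j ≤ nTildeSub H₁ H₂ a := by
  rcases h with h | ⟨rfl, h⟩
  · exact inf_le_left.trans ((gr_le_grGE H₁ h).trans le_sup_left)
  · exact (inf_le_inf le_rfl (gr_le_grGE H₂ h)).trans (le_sup_right.trans le_sup_right)

omit hL in
theorem grGE_two_le_of_bigr_le {W : Submodule ℂ g}
    (hW : ∀ i j : ℤ, 0 ≤ i → 2 ≤ j → bigr H₁ H₂ i j ≤ W) : grGE H₂ 2 ≤ W := by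
  refine iSup₂_le fun j hj => (hS.gr_le_iSup_bigr' j).trans (iSup_le fun i => ?_)
  by_cases hi : 0 ≤ i
  · exact hW i j hi hj
  · rw [hS.bigr_eq_bot (by omega)]
    exact bot_le

/-- Reduces linear statements about `𝔫₂` to single bidegrees. `𝔞` is kept apart because it may be a
proper subspace of `𝔤_{0,1}`. -/
theorem nTwoSub_le {W : Submodule ℂ g} (ha : a ≤ W)
    (hW : ∀ i j : ℤ, (0 ≤ i ∧ 2 ≤ j) ∨ (1 ≤ i ∧ 1 ≤ j) → bigr H₁ H₂ i j ≤ W) :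
    nTwoSub B H₁ H₂ f₂ a ≤ W :=
  sup_le ((hL.omegaPerp_le hS).trans (sup_le (sup_le ha (hW 2 1 (by norm_num)))
    (hW 1 1 (by norm_num)))) (grGE_two_le_of_bigr_le hS fun i j hi hj => hW i j (by omega))

omit hL in
theorem nTildeSub_le {W : Submodule ℂ g} (ha : a ≤ W)
    (hW : ∀ i j : ℤ, (0 ≤ i ∧ 2 ≤ j) ∨ (1 ≤ i ∧ 1 ≤ j) ∨ (i = 1 ∧ j = 0) →
      bigr H₁ H₂ i j ≤ W) : nTildeSub H₁ H₂ a ≤ W := by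
  refine sup_le (iSup₂_le fun i hi => (hS.gr_le_iSup_bigr i).trans (iSup_le fun j => ?_))
    (sup_le ha ?_)
  · by_cases hj : 1 ≤ j ∨ (i = 1 ∧ j = 0)
    · exact hW i j (by omega)
    · rw [hS.bigr_eq_bot (by omega)]
      exact bot_le
  · have h2 : H₂ ∈ gr H₁ 0 := mem_gr.mpr (by rw [hS.comm, Int.cast_zero, zero_smul])
    have h2' : H₂ ∈ grGE H₂ 0 := gr_le_grGE H₂ le_rfl (mem_gr.mpr (by simp))
    refine (le_iSup_inf_gr (p := gr H₁ 0 ⊓ grGE H₂ 2) hS.good₂.iSup_gr fun x hx =>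
      ⟨lie_mem_gr_of_eq h2 hx.1 rfl, lie_mem_grGE_of_le h2' hx.2 (by norm_num)⟩).trans
      (iSup_le fun j x hx => ?_)
    by_cases hj : 2 ≤ j
    · exact hW 0 j (by omega) ⟨hx.1.1, hx.2⟩
    · rw [eq_zero_of_mem_gr_of_mem_grGE (by omega) hx.2 hx.1.2]
      exact zero_mem _

omit hS [FiniteDimensional ℂ g] in
theorem a_le_nTwoSub : a ≤ nTwoSub B H₁ H₂ f₂ a :=
  (le_sup_left.trans hL.lTwo_le_omegaPerp).trans le_sup_left

theorem nTwoSub_le_nTildeSub : nTwoSub B H₁ H₂ f₂ a ≤ nTildeSub H₁ H₂ a :=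
  hL.nTwoSub_le hS (le_sup_left.trans le_sup_right) fun i j hij => bigr_le_nTildeSub (by omega)

/-- The directions to be eliminated: `(1, 0)` is the only bidegree of `𝔫̃₂` that `𝔫₂` can miss. -/
theorem nTildeSub_le_sup : nTildeSub H₁ H₂ a ≤ nTwoSub B H₁ H₂ f₂ a ⊔ bigr H₁ H₂ 1 0 := by
  refine nTildeSub_le hS (hL.a_le_nTwoSub.trans le_sup_left) fun i j hij => ?_
  by_cases h : i = 1 ∧ j = 0
  · obtain ⟨rfl, rfl⟩ := h
    exact le_sup_right
  · exact (hL.bigr_le_nTwoSub hS (by omega)).trans le_sup_left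

theorem lie_mem_nTwoSub : ∀ x ∈ nTildeSub H₁ H₂ a, ∀ y ∈ nTildeSub H₁ H₂ a,
    ⁅x, y⁆ ∈ nTwoSub B H₁ H₂ f₂ a := by
  have key : ∀ {i j k l : ℤ} {x y : g}, x ∈ bigr H₁ H₂ i j → y ∈ bigr H₁ H₂ k l →
      (2 ≤ j + l ∨ (1 ≤ i + k ∧ 1 ≤ j + l) ∨ 2 ≤ i + k) → ⁅x, y⁆ ∈ nTwoSub B H₁ H₂ f₂ a :=
    fun hx hy h => hL.bigr_le_nTwoSub hS h (lie_mem_bigr hx hy rfl rfl)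
  change nTildeSub H₁ H₂ a ≤ lieColon (nTildeSub H₁ H₂ a) (nTwoSub B H₁ H₂ f₂ a)
  refine nTildeSub_le hS (fun x hx => ?_) fun i j hij x hx => ?_
  · change nTildeSub H₁ H₂ a ≤ (nTwoSub B H₁ H₂ f₂ a).comap (LieAlgebra.ad ℂ g x : Module.End ℂ g)
    exact nTildeSub_le hS (fun y hy => key (hL.le_bigr hx) (hL.le_bigr hy) (by norm_num))
      fun k l hkl y hy => key (hL.le_bigr hx) hy (by omega)
  · change nTildeSub H₁ H₂ a ≤ (nTwoSub B H₁ H₂ f₂ a).comap (LieAlgebra.ad ℂ g x : Module.End ℂ g)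
    exact nTildeSub_le hS (fun y hy => key hx (hL.le_bigr hy) (by omega))
      fun k l hkl y hy => key hx hy (by omega)

omit hL in
theorem nTildeSub_le_grGE (ha : a ≤ bigr H₁ H₂ 0 1) : nTildeSub H₁ H₂ a ≤ grGE H₁ 0 :=
  nTildeSub_le hS (ha.trans (inf_le_left.trans (gr_le_grGE H₁ le_rfl)))
    fun i j hij => inf_le_left.trans (gr_le_grGE H₁ (by omega))

/-- `𝔤^{(1)}_{≥ 2}` is an ideal of `𝔫̃₂` contained in the radical of `χ₂ [•, •]`. -/
theorem lie_grGE_two : ∀ x ∈ nTildeSub H₁ H₂ a, ∀ w ∈ grGE H₁ 2,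
    ⁅x, w⁆ ∈ grGE H₁ 2 ∧ B f₂ ⁅x, w⁆ = 0 := by
  intro x hx w hw
  refine ⟨lie_mem_grGE_of_le (nTildeSub_le_grGE hS hL.le_bigr hx) hw (by norm_num), ?_⟩
  suffices h : nTildeSub H₁ H₂ a ≤ lieColon (grGE H₁ 2) (LinearMap.ker (B f₂)) from h hx w hw
  have hgr : ∀ x : g, (∀ k l : ℤ, 2 ≤ k → 1 ≤ l → ∀ w ∈ bigr H₁ H₂ k l, B f₂ ⁅x, w⁆ = 0) →
      x ∈ lieColon (grGE H₁ 2) (LinearMap.ker (B f₂)) := by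
    intro x h
    change grGE H₁ 2 ≤ (LinearMap.ker (B f₂)).comap (LieAlgebra.ad ℂ g x : Module.End ℂ g)
    refine iSup₂_le fun k hk => (hS.gr_le_iSup_bigr k).trans (iSup_le fun l => ?_)
    by_cases hl : 1 ≤ l
    · exact h k l hk hl
    · rw [hS.bigr_eq_bot (by omega)]
      exact bot_le
  refine nTildeSub_le hS (fun x hx => hgr x fun k l hk hl w hw => ?_)
    fun i j hij x hx => hgr x fun k l hk hl w hw => ?_
  · by_cases h : k = 2 ∧ l = 1
    · obtain ⟨rfl, rfl⟩ := h
      exact hL.form_eq_zero (Submodule.mem_sup_left hx) (Submodule.mem_sup_right hw)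
    · exact hS.form_f₂_eq_zero (lie_mem_bigr (hL.le_bigr hx) hw rfl rfl) (by omega)
  · exact hS.form_f₂_eq_zero (lie_mem_bigr hx hw rfl rfl) (by omega)

/-- In first degree `0` the bracket lands in `𝔤_{1,l}` with `l ≥ 3`, which is zero. It follows that
`ξ[x, v] = -χ₂[x, v]` on the large fibre. -/
theorem lie_bigr_one_two_mem : ∀ x ∈ nTildeSub H₁ H₂ a, ∀ v ∈ bigr H₁ H₂ 1 2,
    ⁅x, v⁆ ∈ grGE H₁ 2 := by
  change nTildeSub H₁ H₂ a ≤ lieColon (bigr H₁ H₂ 1 2) (grGE H₁ 2)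
  have key : ∀ {i j : ℤ} {x v : g}, x ∈ bigr H₁ H₂ i j → v ∈ bigr H₁ H₂ 1 2 →
      1 ≤ i ∨ (i = 0 ∧ 1 ≤ j) → ⁅x, v⁆ ∈ grGE H₁ 2 := by
    intro i j x v hx hv h
    have hxv := lie_mem_bigr hx hv rfl rfl
    by_cases hi : 1 ≤ i
    · exact gr_le_grGE H₁ (by omega) hxv.1
    · rw [hS.bigr_eq_bot (by omega), Submodule.mem_bot] at hxv
      rw [hxv]
      exact zero_mem _
  exact nTildeSub_le hS (fun x hx v hv => key (hL.le_bigr hx) hv (by norm_num))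
    fun i j hij x hx v hv => key hx hv (by omega)

theorem form_lie_bigr_one_two : ∀ x ∈ nTwoSub B H₁ H₂ f₂ a, ∀ v ∈ bigr H₁ H₂ 1 2,
    B f₂ ⁅x, v⁆ = 0 := by
  change nTwoSub B H₁ H₂ f₂ a ≤ lieColon (bigr H₁ H₂ 1 2) (LinearMap.ker (B f₂))
  exact hL.nTwoSub_le hS (fun x hx v hv => hS.form_f₂_eq_zero
      (lie_mem_bigr (hL.le_bigr hx) hv rfl rfl) (Or.inl (by norm_num)))
    fun i j hij x hx v hv => hS.form_f₂_eq_zero (lie_mem_bigr hx hv rfl rfl) (Or.inl (by omega))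

theorem adNilpotent_nTildeSub : AdNilpotent (nTildeSub H₁ H₂ a) := fun _ hx =>
  isNilpotent_ad_of_mem_nTwoTilde hS.good₁.iSup_gr hS.good₂.iSup_gr hL.le_bigr hx

omit hL in
theorem apply_eq_of_nTildeSub {ξ η : Module.Dual ℂ g} (ha : ∀ y ∈ a, ξ y = η y)
    (h : ∀ i j : ℤ, (0 ≤ i ∧ 2 ≤ j) ∨ (1 ≤ i ∧ 1 ≤ j) ∨ (i = 1 ∧ j = 0) →
      ∀ y ∈ bigr H₁ H₂ i j, ξ y = η y) : ∀ y ∈ nTildeSub H₁ H₂ a, ξ y = η y :=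
  nTildeSub_le hS (W := LinearMap.eqLocus ξ η) ha h

/-- Points of `-χ₂ + 𝔪₂^⊥` are conjugate to `-χ₂` modulo the annihilator of `𝔫̃₂`, under `N₂`. -/
theorem exists_expAd_eq {ξ : Module.Dual ℂ g} (hξ : ξ ∈ affineFiber (B f₂) (mTwo H₁ H₂ a)) :
    ∃ x ∈ nTwoSub B H₁ H₂ f₂ a, ∀ y ∈ nTildeSub H₁ H₂ a, ξ y = -B f₂ (expAd x y) := by
  -- The first-order effect of `exp(ad x)` corrects the discrepancy between `ξ` and `-χ₂` on
  -- `𝔤^{(1)}_1`. In first degrees `≥ 1` the higher-order terms have first degree `≥ 3` and are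
  -- killed by `f₂`.
  obtain ⟨x, hx, hxζ⟩ := hS.exists_form_lie_eq (-(ξ + B f₂)) fun y hy => by
    have := hξ y (bigr_le_mTwo hS (Or.inr le_rfl) hy)
    rw [LinearMap.neg_apply, LinearMap.add_apply, this, neg_add_cancel, neg_zero]
  have hxn : x ∈ nTwoSub B H₁ H₂ f₂ a := (sup_le (hL.bigr_le_nTwoSub hS (by norm_num))
    (hL.bigr_le_nTwoSub hS (by norm_num)) : _ ≤ nTwoSub B H₁ H₂ f₂ a) hx
  have hx1 : x ∈ gr H₁ 1 := (sup_le inf_le_left inf_le_left : _ ≤ gr H₁ 1) hx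
  have hxg1 : x ∈ grGE H₁ 1 := gr_le_grGE H₁ le_rfl hx1
  have hxg2 : x ∈ grGE H₂ 1 := (sup_le (inf_le_right.trans (gr_le_grGE H₂ le_rfl))
    (inf_le_right.trans (gr_le_grGE H₂ (by norm_num))) : _ ≤ grGE H₂ 1) hx
  have hnil := isNilpotent_ad_of_mem hS.good₁.iSup_gr hxg1
  have hW1 : ∀ w ∈ grGE H₁ 3, ⁅x, w⁆ ∈ grGE H₁ 3 := fun w hw =>
    lie_mem_grGE_of_le hxg1 hw (by norm_num)
  have hW2 : ∀ w ∈ grGE H₂ 3, ⁅x, w⁆ ∈ grGE H₂ 3 := fun w hw =>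
    lie_mem_grGE_of_le hxg2 hw (by norm_num)
  -- In first degree `0` the second grading truncates the series instead, and the linear term
  -- vanishes because it has first degree `1`.
  have hzero : ∀ j : ℤ, 1 ≤ j → ∀ y ∈ bigr H₁ H₂ 0 j, B f₂ (expAd x y) = B f₂ y := by
    intro j hj y hy
    have hy2 : y ∈ grGE H₂ 1 := gr_le_grGE H₂ hj hy.2
    have h1 := form_grGE_eq_zero hS.inv hS.good₂.mem (expAd_sub_sub_mem hnil hW2
      (lie_mem_grGE_of_le hxg2 (lie_mem_grGE_two hxg2 hy2) (by norm_num)))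
    rw [map_sub, map_add, hS.form_f₂_eq_zero_of_gr (lie_mem_gr_of_eq hx1 hy.1 (k := 1)
      (by norm_num)) (by norm_num) (by norm_num), add_zero] at h1
    exact sub_eq_zero.mp h1
  refine ⟨x, hxn, ?_⟩
  refine apply_eq_of_nTildeSub hS (η := -(B f₂ ∘ₗ expAd x)) (fun y hy => ?_)
    fun i j hij y hy => ?_
  · change ξ y = -B f₂ (expAd x y)
    rw [hzero 1 le_rfl y (hL.le_bigr hy)]
    exact hξ y (Submodule.mem_sup_left (Submodule.mem_sup_left hy))
  · change ξ y = -B f₂ (expAd x y)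
    obtain rfl | rfl | hi : i = 0 ∨ i = 1 ∨ 2 ≤ i := by omega
    · rw [hzero j (by omega) y hy]
      exact hξ y (bigr_le_mTwo hS (Or.inr (by omega)) hy)
    · have h1 := hS.form_f₂_eq_zero_of_grGE (expAd_sub_sub_mem hnil hW1
        (lie_mem_grGE_of_le hxg1 (lie_mem_grGE_two hxg1 (gr_le_grGE H₁ le_rfl hy.1))
          (by norm_num)))
      have h2 := hxζ y hy.1
      rw [LinearMap.neg_apply, LinearMap.add_apply] at h2
      rw [map_sub, map_add] at h1
      linear_combination h1 + h2
    · have h1 := hS.form_f₂_eq_zero_of_grGE (expAd_sub_self_mem hnil hW1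
        (lie_mem_grGE_of_le hxg1 (gr_le_grGE H₁ hi hy.1) (by norm_num)))
      rw [map_sub, sub_eq_zero] at h1
      rw [h1]
      exact hξ y (bigr_le_mTwo hS (Or.inl hi) hy)

end IsLagrangianChoice

end SlodowyReduction

namespace SlodowyReduction

variable {g : Type*} [LieRing g] [LieAlgebra ℂ g] [FiniteDimensional ℂ g]
  {B : LinearMap.BilinForm ℂ g} {H₁ H₂ f₁ f₂ : g} {a : Submodule ℂ g}

/-! ## Reduction by stages -/

namespace IsLagrangianChoice

variable (hL : IsLagrangianChoice B H₁ H₂ f₁ f₂ a) (hS : CompatibleGradings B H₁ H₂ f₁ f₂)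

include hL hS

theorem fiber_nTwo : (nTwo B H₁ hS.good₂ a).fiber (B f₂) =
    affineFiber (B f₂) (mTwo H₁ H₂ a) := by
  apply Set.Subset.antisymm
  · exact fiber_subset_affineFiber _ _ hL.mTwo_le_nTwoSub fun x hx w hw => by
      have := lie_mem_and_form_eq_zero hS.inv hL.lTwo_le_omegaPerp hS.good₂.mem hx hw
      exact ⟨Submodule.mem_sup_right this.1, this.2⟩
  · intro ξ hξ
    obtain ⟨x, hx, h⟩ := hL.exists_expAd_eq hS hξ
    obtain ⟨φ, hφ, -⟩ := expAd_lie ((nTwo B H₁ hS.good₂ a).isNilpotent_ad x hx)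
    refine (AdNilpotentSubalgebra.mem_fiber_iff _ _).mpr
      ⟨φ, AdNilpotentSubalgebra.mem_unipotentGroup_of_expAd _ hx hφ, fun y hy => ?_⟩
    rw [h y (hL.nTwoSub_le_nTildeSub hS hy), ← hφ]
    rfl

theorem affineFiber_subset_fiber_nTwoTilde : affineFiber (B f₂) (mTwo H₁ H₂ a) ⊆
    (nTwoTilde hS.good₁ hS.good₂ a hL.le_bigr).fiber (B f₂) := by
  intro ξ hξ
  obtain ⟨x, hx, h⟩ := hL.exists_expAd_eq hS hξ
  have hx' := hL.nTwoSub_le_nTildeSub hS hx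
  obtain ⟨φ, hφ, -⟩ := expAd_lie
    ((nTwoTilde hS.good₁ hS.good₂ a hL.le_bigr).isNilpotent_ad x hx')
  refine (AdNilpotentSubalgebra.mem_fiber_iff _ _).mpr
    ⟨φ, AdNilpotentSubalgebra.mem_unipotentGroup_of_expAd _ hx' hφ, fun y hy => ?_⟩
  rw [h y hy, ← hφ]
  rfl

theorem fiber_nTwoTilde_subset :
    (nTwoTilde hS.good₁ hS.good₂ a hL.le_bigr).fiber (B f₂) ⊆
      affineFiber (B f₂) (grGE H₁ 2) :=
  fiber_subset_affineFiber _ _ ((grGE_anti H₁ (by norm_num)).trans le_sup_left)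
    (hL.lie_grGE_two hS)

/-- The pairing of `𝔫̃₂` with `𝔤_{1,2}` has left radical `𝔫₂` and right radical zero, by the duality
of `𝔤_{1,0}` and `𝔤_{1,2}`. -/
theorem reduces_of_bigr_one_two :
    Reduces (nTildeSub H₁ H₂ a) ((nTwoTilde hS.good₁ hS.good₂ a hL.le_bigr).fiber (B f₂))
      (nTwoSub B H₁ H₂ f₂ a)
      {ξ ∈ (nTwoTilde hS.good₁ hS.good₂ a hL.le_bigr).fiber (B f₂) |
        ∀ v ∈ bigr H₁ H₂ 1 2, ξ v = -B f₂ v} := by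
  refine Reduces.of_pairing (hL.adNilpotent_nTildeSub hS) (hL.nTwoSub_le_nTildeSub hS)
    (hL.lie_mem_nTwoSub hS) ((nTwoTilde hS.good₁ hS.good₂ a hL.le_bigr).expStable_fiber _) (B f₂) (bigr H₁ H₂ 1 2)
    (fun ξ hξ y hy v hv => hL.fiber_nTwoTilde_subset hS hξ _ (hL.lie_bigr_one_two_mem hS y hy v hv))
    (hL.form_lie_bigr_one_two hS) (fun y hy h => ?_) (fun v hv h ξ hξ => ?_)
  · obtain ⟨z, hz, u, hu, rfl⟩ := Submodule.mem_sup.mp (hL.nTildeSub_le_sup hS hy)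
    have hu0 : u = 0 := hS.eq_zero_of_form_lie hu fun v hv => by
      have h1 := h v (by simpa using hv)
      rwa [add_lie, map_add, hL.form_lie_bigr_one_two hS z hz v (by simpa using hv),
        zero_add] at h1
    rwa [hu0, add_zero]
  · have hv0 : v = 0 := hS.eq_zero_of_form_lie hv fun y hy => by
      rw [form_lie_swap, h y (bigr_le_nTildeSub (Or.inl le_rfl) hy), neg_zero]
    rw [hv0, map_zero, map_zero, neg_zero]

/-- Orbits are not computed here: `Reduces` itself forces the equations `ξ(w) = -χ₂(w)`, `w ∈ 𝔪₂`,
by descending induction on the second degree. Once they hold in higher degrees, `ξ(w) + χ₂(w)` is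
`𝔫₂`-invariant on the cut locus, so it extends to an `Ñ₂`-invariant function on the fibre. Every
point of the fibre is conjugate to one in `-χ₂ + 𝔪₂^⊥`, where that function is zero. -/
theorem fiber_nTwoTilde_inter :
    {ξ ∈ (nTwoTilde hS.good₁ hS.good₂ a hL.le_bigr).fiber (B f₂) |
        ∀ v ∈ bigr H₁ H₂ 1 2, ξ v = -B f₂ v} = affineFiber (B f₂) (mTwo H₁ H₂ a) := by
  have hred := hL.reduces_of_bigr_one_two hS
  set n := nTwoTilde hS.good₁ hS.good₂ a hL.le_bigr with hn
  set X := {ξ ∈ n.fiber (B f₂) | ∀ v ∈ bigr H₁ H₂ 1 2, ξ v = -B f₂ v} with hX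
  have hsub : affineFiber (B f₂) (mTwo H₁ H₂ a) ⊆ X := fun ξ hξ =>
    ⟨hL.affineFiber_subset_fiber_nTwoTilde hS hξ,
      fun v hv => hξ v (bigr_le_mTwo hS (Or.inr le_rfl) hv)⟩
  refine Set.Subset.antisymm ?_ hsub
  obtain ⟨K, hK⟩ := exists_grGE_eq_bot H₂
  have key : ∀ j : ℕ, ∀ ξ ∈ X, ∀ w ∈ mTwo H₁ H₂ a ⊓ grGE H₂ ((K : ℤ) - j), ξ w = -B f₂ w := by
    intro j
    induction j with
    | zero =>
      intro ξ _ w hw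
      have h1 : w ∈ grGE H₂ K := by simpa using hw.2
      rw [hK, Submodule.mem_bot] at h1
      rw [h1, map_zero, map_zero, neg_zero]
    | succ j ih =>
      intro ξ hξ w hw
      let W : Submodule ℂ g :=
        mTwo H₁ H₂ a ⊓ grGE H₂ ((K : ℤ) - j) ⊓ LinearMap.ker (B f₂)
      have hlie : ∀ y ∈ nTwoSub B H₁ H₂ f₂ a, ∀ z ∈ mTwo H₁ H₂ a ⊓ grGE H₂ ((K : ℤ) - (j + 1)),
          ⁅y, z⁆ ∈ W := by
        intro y hy z hz
        have h1 := lie_mem_and_form_eq_zero hS.inv hL.lTwo_le_omegaPerp hS.good₂.mem hy hz.1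
        exact ⟨⟨Submodule.mem_sup_right h1.1, lie_mem_grGE_of_le
          (omegaPerp_sup_le B H₂ f₂ _ hy) hz.2 (by omega)⟩, h1.2⟩
      let F₀ : SymmetricAlgebra ℂ g := SymmetricAlgebra.ι ℂ g w + algebraMap ℂ _ (B f₂ w)
      have hF₀ : ∀ η : Module.Dual ℂ g, SymmetricAlgebra.lift η F₀ = η w + B f₂ w := fun η => by
        simp [F₀]
      have hinv : ExpInvariant (nTwoSub B H₁ H₂ f₂ a) X F₀ := by
        intro y hy η hη
        have h1 : expAd y w - w ∈ W := expAd_sub_self_mem (W := W)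
          (hL.adNilpotent_nTildeSub hS y (hL.nTwoSub_le_nTildeSub hS hy))
          (fun z hz => hlie y hy z ⟨hz.1.1, grGE_anti H₂ (by omega) hz.1.2⟩)
          (hlie y hy w (by simpa using hw))
        have h2 := ih η hη _ h1.1
        rw [LinearMap.mem_ker.mp h1.2, neg_zero, map_sub, sub_eq_zero] at h2
        rw [hF₀, hF₀, LinearMap.comp_apply, h2]
      obtain ⟨F, hF, hFF₀⟩ := hred.extend F₀ hinv
      obtain ⟨φ, hφ, hξφ⟩ := (n.mem_fiber_iff (B f₂)).mp hξ.1
      have hmn : mTwo H₁ H₂ a ≤ nTildeSub H₁ H₂ a :=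
        hL.mTwo_le_nTwoSub.trans (hL.nTwoSub_le_nTildeSub hS)
      -- This conjugate of `ξ` equals `-χ₂` on all of `𝔫̃₂`, hence on `𝔪₂`.
      let ξ' : Module.Dual ℂ g := ξ ∘ₗ ((φ⁻¹ : g ≃ₗ[ℂ] g) : g →ₗ[ℂ] g)
      have hξ' : ξ' ∈ affineFiber (B f₂) (mTwo H₁ H₂ a) := by
        intro z hz
        have h1 := hξφ (φ⁻¹ z) (n.map_mem hφ z (hmn hz)).2
        rwa [show φ (φ⁻¹ z) = z from φ.apply_symm_apply z] at h1
      have h1 := hF.lift_comp n (B f₂) (inv_mem hφ) hξ.1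
      have h2 := hFF₀ ξ' (hsub hξ')
      rw [hFF₀ ξ hξ, hF₀] at h1
      rw [hF₀, hξ' w hw.1, neg_add_cancel] at h2
      exact eq_neg_of_add_eq_zero_left (h1.symm.trans h2)
  intro ξ hξ w hw
  refine key K ξ hξ w ⟨hw, ?_⟩
  rw [sub_self]
  exact grGE_anti H₂ (by norm_num) (omegaPerp_sup_le B H₂ f₂ _ (hL.mTwo_le_nTwoSub hw))

theorem reduces_nTwoTilde :
    Reduces (nTildeSub H₁ H₂ a) ((nTwoTilde hS.good₁ hS.good₂ a hL.le_bigr).fiber (B f₂))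
      (nTwoSub B H₁ H₂ f₂ a) ((nTwo B H₁ hS.good₂ a).fiber (B f₂)) := by
  rw [hL.fiber_nTwo hS, ← hL.fiber_nTwoTilde_inter hS]
  exact hL.reduces_of_bigr_one_two hS

theorem reduces_nTwo {e k : g} (ht : IsGradedTriple H₂ e k f₂) :
    Reduces (nTwoSub B H₁ H₂ f₂ a) ((nTwo B H₁ hS.good₂ a).fiber (B f₂)) ⊥
      (slodowySlice (B f₂) e) := by
  rw [hL.fiber_nTwo hS]
  exact reduces_slodowySlice hS.nondegenerate hS.symm hS.inv hS.good₂ hL.lTwo_le_omegaPerp ht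
    fun x hx h => hL.mem_lTwo_of_perp hS hx h

end IsLagrangianChoice

end SlodowyReduction

/-! ### Assembly of the main theorem. -/

open SlodowyReduction
theorem mainTheorem8 {g : Type*} [LieRing g] [LieAlgebra ℂ g] [FiniteDimensional ℂ g]
    [LieAlgebra.IsSimple ℂ g]
    (B : LinearMap.BilinForm ℂ g) (hBnondeg : B.Nondegenerate) (hBsymm : B.IsSymm)
    (hBinv : B.lieInvariant g)
    (h : LieSubalgebra ℂ g) [h.IsCartanSubalgebra]
    (H₁ H₂ f₁ f₂ : g) (hH₁ : H₁ ∈ h) (hH₂ : H₂ ∈ h)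
    (hgood₁ : IsGoodGrading H₁ f₁) (hgood₂ : IsGoodGrading H₂ f₂)
    (hstar : StarConditions H₁ H₂ f₁ f₂) :
    (∃ a : Submodule ℂ g, IsLagrangianChoice B H₁ H₂ f₁ f₂ a) ∧
    ∀ (a : Submodule ℂ g) (ha : IsLagrangianChoice B H₁ H₂ f₁ f₂ a)
      (n₂ : AdNilpotentSubalgebra g) (_ : n₂ = nTwo B H₁ hgood₂ a)
      (n₂' : AdNilpotentSubalgebra g) (_ : n₂' = nTwoTilde hgood₁ hgood₂ a ha.le_bigr)
      (χ₂ : Module.Dual ℂ g) (_ : χ₂ = B f₂),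
      n₂.fiber χ₂ ⊆ n₂'.fiber χ₂ ∧
      ∃ hI : n₂'.fiberIdeal χ₂ ≤ n₂.fiberIdeal χ₂,
      ∃ φ : n₂'.invariants χ₂ →ₐ[ℂ] n₂.invariants χ₂,
        (∀ F, (φ F : n₂.FiberRing χ₂) = Ideal.Quotient.factorₐ ℂ hI F) ∧
        CategoryTheory.IsIso (quotientMap n₂ n₂' χ₂ φ) ∧
        (∀ F G, φ (n₂'.reducedBracket χ₂ F G) = n₂.reducedBracket χ₂ (φ F) (φ G)) ∧
        ∀ e k : g, ⁅k, e⁆ = (2 : ℂ) • e → ⁅k, f₂⁆ = (-2 : ℂ) • f₂ → ⁅e, f₂⁆ = k →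
          e ∈ gr H₂ 2 → k ∈ gr H₂ 0 →
          slodowySlice χ₂ e ⊆ n₂.fiber χ₂ ∧
          ∃ (hS : n₂.fiberIdeal χ₂ ≤ vanishingIdeal (slodowySlice χ₂ e))
            (hS' : n₂'.fiberIdeal χ₂ ≤ vanishingIdeal (slodowySlice χ₂ e)),
            CategoryTheory.IsIso (sliceToQuotient n₂ χ₂ e hS) ∧
            CategoryTheory.IsIso (sliceToQuotient n₂' χ₂ e hS') ∧
            ∃ β : SliceRing χ₂ e → SliceRing χ₂ e → SliceRing χ₂ e,
              (∀ F G, n₂.restrictInvariants χ₂ _ hS (n₂.reducedBracket χ₂ F G) =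
                β (n₂.restrictInvariants χ₂ _ hS F) (n₂.restrictInvariants χ₂ _ hS G)) ∧
              (∀ F G, n₂'.restrictInvariants χ₂ _ hS' (n₂'.reducedBracket χ₂ F G) =
                β (n₂'.restrictInvariants χ₂ _ hS' F) (n₂'.restrictInvariants χ₂ _ hS' G)) := by
  have hC : CompatibleGradings B H₁ H₂ f₁ f₂ :=
    ⟨hBnondeg, hBsymm, hBinv, hgood₁, hgood₂, hstar,
      lie_eq_zero_of_mem_cartan h hH₁ hH₂ hgood₁.iSup_gr⟩
  refine ⟨hC.exists_isLagrangianChoice, fun a ha n₂ hn₂ n₂' hn₂' χ₂ hχ₂ => ?_⟩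
  have hred : Reduces n₂'.toLieSubalgebra.toSubmodule (n₂'.fiber χ₂)
      n₂.toLieSubalgebra.toSubmodule (n₂.fiber χ₂) := by
    subst hn₂ hn₂' hχ₂
    exact ha.reduces_nTwoTilde hC
  have hslice : ∀ e k : g, IsGradedTriple H₂ e k f₂ →
      Reduces n₂.toLieSubalgebra.toSubmodule (n₂.fiber χ₂) ⊥ (slodowySlice χ₂ e) := by
    subst hn₂ hχ₂
    exact fun e k ht => ha.reduces_nTwo hC ht
  clear hn₂ hn₂' hχ₂
  have hI : n₂'.fiberIdeal χ₂ ≤ n₂.fiberIdeal χ₂ := by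
    rw [n₂.fiberIdeal_eq, n₂'.fiberIdeal_eq]
    exact vanishingIdeal_anti hred.subset
  obtain ⟨φ, hφ⟩ := AdNilpotentSubalgebra.exists_restriction hred.le hI
  have hbracket := AdNilpotentSubalgebra.restriction_reducedBracket hred.le hI hφ
  refine ⟨hred.subset, hI, φ, hφ, isIso_specMap_of_bijective φ
    (AdNilpotentSubalgebra.restriction_bijective hred hI hφ), hbracket,
    fun e k h1 h2 h3 h4 h5 => ?_⟩
  have hr := hslice e k ⟨h1, h2, h3, h4, h5⟩
  have hS : n₂.fiberIdeal χ₂ ≤ vanishingIdeal (slodowySlice χ₂ e) := by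
    rw [n₂.fiberIdeal_eq]
    exact vanishingIdeal_anti hr.subset
  have hbij := n₂.restrictInvariants_bijective χ₂ hr hS
  have hbij' := n₂'.restrictInvariants_bijective χ₂ (hred.trans hr) (hI.trans hS)
  refine ⟨hr.subset, hS, hI.trans hS, isIso_specMap_of_bijective _ hbij,
    isIso_specMap_of_bijective _ hbij', ?_⟩
  -- Restriction to the slice from the large fibre factors through `φ`. The bracket on the slice,
  -- transported from the small quotient, is therefore also the one transported from the large
  -- quotient.
  have hcomp : ∀ F, n₂'.restrictInvariants χ₂ _ (hI.trans hS) F =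
      n₂.restrictInvariants χ₂ _ hS (φ F) := by
    intro F
    change _ = Ideal.Quotient.factorₐ ℂ hS (φ F : n₂.FiberRing χ₂)
    rw [hφ]
    obtain ⟨_, G, -, rfl⟩ := F
    rfl
  let r := Equiv.ofBijective _ hbij
  have hr' : ∀ F, r.symm (n₂.restrictInvariants χ₂ _ hS F) = F := r.symm_apply_apply
  refine ⟨fun x y => n₂.restrictInvariants χ₂ _ hS (n₂.reducedBracket χ₂ (r.symm x) (r.symm y)),
    fun F G => by simp only [hr'], fun F G => ?_⟩
  simp only [hcomp, hbracket, hr']
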